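/- Let \(d\ge 2\). Let \(f:\mathbb R^d\to\mathbb R\) be measurable and \(2\pi\)-periodic in each variable (a function on \(\mathbb T^d=[0,2\pi]^d\)) and of bounded variation on \([0,2\pi]\) in each variable separately. For \(x\in\mathbb R^d\) and a coordinate \(j\), let \(\lfloor f\rfloor_j(x)=f(x_j^+)-f(x_j^-)\) denote the jump of \(f\) at \(x\) in the direction \(e_j\) (the other coordinates being fixed). Assume: (i) Jumps occur only across coordinate hyperplanes \(x_j=\alpha\) with \(\alpha\in(0,2\pi)\) (modulo \(2\pi\)), and the jump is constant along each hyperplane: there are functions \(J_j:\mathbb R\to\mathbb R\) with \(\lfloor f\rfloor_j(x)=J_j(x_j)\) for all \(x\) and \(j\), and \(J_j(0)=0\). Put \(L_j=\{\alpha\in(0,2\pi):J_j(\alpha)\ne0\}\). (ii) For each \(j\), \(f\) has a partial derivative \(g_j=\partial_{x_j}f\) away from its jumps, and \(g_j\) has finite Hardy–Krause variation on \([0,2\pi]^d\). Here this means that on every line parallel to \(e_j\) the derivative of \(f\) exists and equals \(g_j\) at almost every point of \([0,2\pi]\), and that for \(0\le s\le t\le 2\pi\) the increment of \(f\) from \(s^+\)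 to \(t^+\) along the line equals the integral of \(g_j\) over \([s,t]\) plus the sum of the jumps of \(f\) at the points of \((s,t]\) (so that there is no singular continuous part). The variation in the sense of Hardy–Krause over a box with sides \([a_i,b_i]\) is \(\sum_{\emptyset\ne u\subseteq\{1,\dots,d\}}V^{(u)}\), where \(V^{(u)}\) is the Vitali variation of the restriction to the face \(\{x: x_i=b_i\text{ for }i\notin u\}\), i.e. the supremum over all grids in the coordinates \(u\) of the sum of the absolute values of the \(|u|\)-fold mixed differences over the cells. Let \(c_\nu=(2\pi)^{-d}\int_{[0,2\pi]^d}f(x)e^{-i\nu\cdot x}\,dx\) for \(\nu\in\mathbb Z^d\), and \[ \widetilde S_{j,n}(x;f)=-i\sum_{|\nu_k|\le n\ \forall k}\operatorname{sign}(\nu_j)\,c_\nu e^{i\nu\cdot x},\qquad G(n)=\sum_{|\nu_k|\le n\ \forall k}|c_\nu|, \] \[ Y_{j,n}(x)=-\frac1{\log(n)\,G(n)}\sum_{|\nu_k|\le n\ \forall k}\widetilde S_{j,\|\nu\|_\infty}(x;f)\,|c_\nu| \] (with \(Y_{j,n}=0\) if \(\log(n)\,G(n)=0\)). Then there is a constant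 \(K_d>0\), depending only on \(d\), such that for every such \(f\), every axis-aligned rectangle \(R=(a_1,b_1)\times\cdots\times(a_d,b_d)\) with \(0\le a_i<b_i\le 2\pi\), and every coordinate \(j\) with \(a_j,b_j\notin L_j\), the sum \(\sum_{\alpha\in L_j\cap(a_j,b_j)}|J_j(\alpha)|\) is finite and \[ \lim_{n\to\infty}V_R(Y_{j,n})=K_d\,\frac1\pi\sum_{\alpha\in L_j\cap(a_j,b_j)}|J_j(\alpha)|, \] where \(V_R\) denotes the total variation over (the closure of) \(R\) in the sense of Hardy–Krause. -/

import Mathlib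

open Filter Topology MeasureTheory

noncomputable section

/-! ### Functions on the torus: lines, jumps, derivatives -/

/-- The restriction of `f` to the line through `x` parallel to the `j`-th axis. -/
def lineFun {d : ℕ} (f : (Fin d → ℝ) → ℝ) (j : Fin d) (x : Fin d → ℝ) : ℝ → ℝ :=
  fun t => f (Function.update x j t)

/-- A function on the torus `[0, 2π]^d`, viewed as a function on `ℝ^d` that is `2π`-periodic in
each variable. -/
def IsTorusFun {d : ℕ} (f : (Fin d → ℝ) → ℝ) : Prop :=
  ∀ (j : Fin d) (x : Fin d → ℝ), Function.Periodic (lineFun f j x) (2 * Real.pi)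

/-- `f` is of bounded variation in each variable separately. -/
def IsBVInEachVariable {d : ℕ} (f : (Fin d → ℝ) → ℝ) : Prop :=
  ∀ (j : Fin d) (x : Fin d → ℝ),
    BoundedVariationOn (lineFun f j x) (Set.Icc 0 (2 * Real.pi))

/-- The jump `f(x_j⁺) - f(x_j⁻)` of `f` at `x` in the direction of the `j`-th axis. -/
def jumpAt {d : ℕ} (f : (Fin d → ℝ) → ℝ) (j : Fin d) (x : Fin d → ℝ) : ℝ :=
  Function.rightLim (lineFun f j x) (x j) - Function.leftLim (lineFun f j x) (x j)

/-- `g` is the partial derivative `∂f/∂x_j` (away from the jumps of `f`): on every line parallel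
to the `j`-th axis, `f` has derivative `g` almost everywhere, and each increment of `f` is the
integral of `g` plus the sum of the jumps of `f` passed on the way (so there is no singular
continuous part). -/
structure IsPartialDerivative {d : ℕ} (f : (Fin d → ℝ) → ℝ) (j : Fin d)
    (g : (Fin d → ℝ) → ℝ) : Prop where
  hasDerivAt_ae : ∀ x : Fin d → ℝ, ∀ᵐ t ∂(volume.restrict (Set.Icc 0 (2 * Real.pi))),
    HasDerivAt (lineFun f j x) (g (Function.update x j t)) t
  increment : ∀ (x : Fin d → ℝ) (s t : ℝ), 0 ≤ s → s ≤ t → t ≤ 2 * Real.pi →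
    Function.rightLim (lineFun f j x) t - Function.rightLim (lineFun f j x) s
      = (∫ r in s..t, g (Function.update x j r))
        + ∑' α : Set.Ioc s t, jumpAt f j (Function.update x j (α : ℝ))

/-- The positions `α ∈ (0, 2π)` of the jump hyperplanes `x_j = α`, where `J j α` is the jump of the
function across `x_j = α`. -/
def jumpSet {d : ℕ} (J : Fin d → ℝ → ℝ) (j : Fin d) : Set ℝ :=
  {α | α ∈ Set.Ioo 0 (2 * Real.pi) ∧ J j α ≠ 0}

/-! ### Variation in the sense of Hardy and Krause -/

/-- The `u`-fold mixed difference of `F` over the cell `∏_{i ∈ u} [lo_i, hi_i]`, the coordinates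
outside `u` being frozen at those of `b`. -/
def mixedDiff {d : ℕ} {E : Type*} [NormedAddCommGroup E] (F : (Fin d → ℝ) → E)
    (u : Finset (Fin d)) (lo hi b : Fin d → ℝ) : E :=
  ∑ v ∈ u.powerset, (-1 : ℤ) ^ (u \ v).card •
    F (fun i => if i ∈ v then hi i else if i ∈ u then lo i else b i)

/-- The Vitali variation of `F` over the face `{x ∈ [a, b] : x_i = b_i for i ∉ u}` of the box
`[a, b]`: the supremum over all grids of the sum, over the cells of the grid, of the absolute values
of the mixed differences. The grid points in the `i`-th coordinate are
`p i 0 ≤ p i 1 ≤ … ≤ p i n`; repetitions only add zero summands. -/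
def vitaliVariation {d : ℕ} {E : Type*} [NormedAddCommGroup E] (F : (Fin d → ℝ) → E)
    (u : Finset (Fin d)) (a b : Fin d → ℝ) : ENNReal :=
  ⨆ (n : ℕ) (p : Fin d → ℕ → ℝ)
    (_ : ∀ i, Monotone (p i) ∧ ∀ k, p i k ∈ Set.Icc (a i) (b i)),
    ∑ k ∈ Fintype.piFinset (fun i : Fin d => if i ∈ u then Finset.range n else {0}),
      ‖mixedDiff F u (fun i => p i (k i)) (fun i => p i (k i + 1)) b‖ₑ

/-- The total variation of `F` over the box `[a, b]` in the sense of Hardy and Krause (anchored at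
`b`): the sum over all nonempty sets `u` of coordinates of the Vitali variations of `F` over the
faces `{x ∈ [a, b] : x_i = b_i for i ∉ u}`. -/
def hardyKrauseVariation {d : ℕ} {E : Type*} [NormedAddCommGroup E] (F : (Fin d → ℝ) → E)
    (a b : Fin d → ℝ) : ENNReal :=
  ∑ u ∈ (Finset.univ : Finset (Finset (Fin d))).filter (fun u => u.Nonempty),
    vitaliVariation F u a b

/-! ### Fourier series -/

/-- The frequencies `ν ∈ ℤ^d` with `|ν_k| ≤ n` for all `k`. -/
def freqBox (d n : ℕ) : Finset (Fin d → ℤ) :=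
  Fintype.piFinset fun _ => Finset.Icc (-(n : ℤ)) (n : ℤ)

/-- The character `x ↦ exp(i ν·x)`. -/
def character {d : ℕ} (ν : Fin d → ℤ) (x : Fin d → ℝ) : ℂ :=
  Complex.exp (Complex.I * ((∑ k, (ν k : ℝ) * x k : ℝ) : ℂ))

/-- The Fourier coefficient `c_ν = (2π)^{-d} ∫_{[0,2π]^d} f(x) exp(-i ν·x) dx`. -/
def fourierCoefficient {d : ℕ} (f : (Fin d → ℝ) → ℝ) (ν : Fin d → ℤ) : ℂ :=
  (1 / (2 * (Real.pi : ℂ)) ^ d) *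
    ∫ x in Set.Icc (fun _ : Fin d => (0 : ℝ)) (fun _ => 2 * Real.pi),
      (f x : ℂ) * character (-ν) x

/-- The `n`-th rectangular partial sum of the `j`-th conjugate Fourier series of `f`. -/
def conjPartialSum {d : ℕ} (f : (Fin d → ℝ) → ℝ) (j : Fin d) (n : ℕ) (x : Fin d → ℝ) : ℂ :=
  -Complex.I * ∑ ν ∈ freqBox d n,
    ((ν j).sign : ℂ) * fourierCoefficient f ν * character ν x

/-- `G(n) = ∑_{|ν_k| ≤ n} |c_ν|`. -/
def coeffSum {d : ℕ} (f : (Fin d → ℝ) → ℝ) (n : ℕ) : ℝ :=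
  ∑ ν ∈ freqBox d n, ‖fourierCoefficient f ν‖

/-- The maximum norm `‖ν‖_∞ = max_k |ν_k|`. -/
def maxNorm {d : ℕ} (ν : Fin d → ℤ) : ℕ :=
  Finset.univ.sup fun k => (ν k).natAbs

/-- `Y_{j,n}(x) = -(1 / (log(n) G(n))) ∑_{|ν_k| ≤ n} S̃_{j,‖ν‖_∞}(x; f) |c_ν|`. -/
def jumpDetector {d : ℕ} (f : (Fin d → ℝ) → ℝ) (j : Fin d) (n : ℕ) (x : Fin d → ℝ) : ℂ :=
  -(1 / ((Real.log n * coeffSum f n : ℝ) : ℂ)) *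
    ∑ ν ∈ freqBox d n, conjPartialSum f j (maxNorm ν) x * (‖fourierCoefficient f ν‖ : ℂ)

end

/-!
The constant is `K = 1`, in every dimension. Write `f = F + ∑ k, Φ k (x k)`, where
`Φ k = jumpPart (J k) (jumpSet J k)` is the superposition of sawtooth functions that carries the
jumps of `f` across the hyperplanes `x k = α`, and `F = regularPart f J`. The jump detector is linear
in the conjugate partial sums, so it splits accordingly (`jumpDetector_eq`).

*The regular part contributes nothing.* Almost everywhere, the increments of `F` along the axes are
integrals of the partial derivatives plus a constant drift; as the derivatives are of bounded
Hardy–Krause variation, all increments `F (x + t eᵢ) - F x` have variation `O(|t|)` over a period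
(`exists_hasLipschitzIncrements_regularPart`). This is one derivative more than bounded
variation, and it has two consequences. First, `|c_ν| ‖ν‖ ∏ max(1, |ν k|)` is bounded, so the Fourier
series of `F` converges absolutely (`HasLipschitzIncrements.exists_sum_fourierCoefficient_le`).
Second, the variation of the conjugate partial sums of order `m` is `o(log m)`
(`HasLipschitzIncrements.exists_gridSum_conjPartialSum_le`). The naive bound, with the `L¹` norms of
the product kernels, is a power `(log m) ^ d`; replacing `F` by a Fejér mean of order a power of
`log m` brings it down to a power of `log log m`, and the error is an average of small increments,
whose smallness beats `(log m) ^ d`.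

*The jump part.* Its Fourier coefficients live on the coordinate axes, and its `j`-th conjugate
partial sums are `-π⁻¹ ∑ α, J j α * C_m (x j - α)` with the cosine sums
`C_m t = ∑_{k ≤ m} cos (k t) / k` (`conjPartialSum_eq_regularPart_add`). Here `C_m 0 ~ log m`, while
`C_m` is bounded in `m` away from its centre. Its variation over an interval of length at most `2π`
is at most `2 log m + O(1)`, the `L¹` norm of the almost positive conjugate Dirichlet kernel, and
over an interval that avoids the centre it is bounded.

*The weights.* In the jump detector, `S̃_{j,m}` has the weight `(G(m) - G(m-1)) / (log n * G(n))`.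
Up to a bounded term, `π G(n)` is the sum over `k` and `1 ≤ r ≤ n` of `|∑ α, J k α exp(-i r α)| / r`.
The absolute value of an almost periodic sequence has a logarithmic mean
(`exists_tendsto_absLogMean`), which here is at least every `|J k α|`
(`abs_le_of_tendsto_absLogMean`); hence `G(n) ~ μ log n` with `μ > 0` as soon as there are jumps, and
summation by parts shows that the average of `log m` against the weights tends to `1 / 2`
(`tendsto_sum_mul_log_div`), whereas the weights themselves sum to at most `1 / log n`.

Consequently the averaged cosine sums tend pointwise to `1 / 2` at the centre and to `0` elsewhere,
and their variation is asymptotically at most `2 * (1 / 2) = 1`. So the variation of the jump detector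
along the edge in the direction `j` has the limit `π⁻¹ ∑ |J j α|` over the jumps in `(a j, b j)`: the
upper bound is dominated convergence over the jumps
(`IsLogWeight.eventually_sum_abs_jumpTrace_le`), and the lower bound is the lower semicontinuity of
the variation, an isolated value of height `1 / 2` having variation `1`
(`IsLogWeight.eventually_lt_eVariationOn`). The mixed differences on the other faces only see the
regular part, and vanish in the limit. In the absence of jumps in the direction `j`, no lower bound
is needed and `G` may even stay bounded: the weights are still bounded against `log m`, and
the regular part alone remains.
-/

noncomputable section

/-! ### Mixed differences and grid sums -/

section MixedDiff

variable {d : ℕ} {E : Type*} [NormedAddCommGroup E]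

/-- The index set of the cells of a grid in the coordinates `u` with `n` steps. -/
def gridCells (u : Finset (Fin d)) (n : ℕ) : Finset (Fin d → ℕ) :=
  Fintype.piFinset fun i : Fin d => if i ∈ u then Finset.range n else {0}

/-- The sum of the norms of the `u`-fold mixed differences of `F` over the cells of a grid; the
Vitali variation is the supremum of these sums. -/
def gridSum (F : (Fin d → ℝ) → E) (u : Finset (Fin d)) (n : ℕ) (p : Fin d → ℕ → ℝ)
    (b : Fin d → ℝ) : ℝ :=
  ∑ k ∈ gridCells u n, ‖mixedDiff F u (fun i => p i (k i)) (fun i => p i (k i + 1)) b‖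

lemma gridSum_nonneg (F : (Fin d → ℝ) → E) (u : Finset (Fin d)) (n : ℕ) (p : Fin d → ℕ → ℝ)
    (b : Fin d → ℝ) : 0 ≤ gridSum F u n p b :=
  Finset.sum_nonneg fun _ _ => norm_nonneg _

lemma ofReal_gridSum (F : (Fin d → ℝ) → E) (u : Finset (Fin d)) (n : ℕ) (p : Fin d → ℕ → ℝ)
    (b : Fin d → ℝ) : ENNReal.ofReal (gridSum F u n p b) =
      ∑ k ∈ Fintype.piFinset (fun i : Fin d => if i ∈ u then Finset.range n else {0}),
        ‖mixedDiff F u (fun i => p i (k i)) (fun i => p i (k i + 1)) b‖ₑ := by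
  rw [gridSum, ENNReal.ofReal_sum_of_nonneg fun _ _ => norm_nonneg _]
  simp [gridCells]

lemma gridSum_le_vitaliVariation (F : (Fin d → ℝ) → E) (u : Finset (Fin d)) (n : ℕ)
    (p : Fin d → ℕ → ℝ) (a b : Fin d → ℝ)
    (hp : ∀ i, Monotone (p i) ∧ ∀ k, p i k ∈ Set.Icc (a i) (b i)) :
    ENNReal.ofReal (gridSum F u n p b) ≤ vitaliVariation F u a b := by
  rw [ofReal_gridSum, vitaliVariation]
  exact le_iSup_of_le n (le_iSup_of_le p (le_iSup_of_le hp le_rfl))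

lemma vitaliVariation_le_ofReal {F : (Fin d → ℝ) → E} {u : Finset (Fin d)}
    {a b : Fin d → ℝ} {C : ℝ}
    (h : ∀ (n : ℕ) (p : Fin d → ℕ → ℝ),
      (∀ i, Monotone (p i) ∧ ∀ k, p i k ∈ Set.Icc (a i) (b i)) → gridSum F u n p b ≤ C) :
    vitaliVariation F u a b ≤ ENNReal.ofReal C := by
  refine iSup_le fun n => iSup_le fun p => iSup_le fun hp => ?_
  rw [← ofReal_gridSum]
  exact ENNReal.ofReal_le_ofReal (h n p hp)

/-- The mixed difference only sees the coordinates of the cell in `u` and those of the anchor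
outside `u`. -/
lemma mixedDiff_congr {F G : (Fin d → ℝ) → E} {u : Finset (Fin d)}
    {lo hi b lo' hi' b' : Fin d → ℝ}
    (h : ∀ v ⊆ u, F (fun i => if i ∈ v then hi i else if i ∈ u then lo i else b i) =
      G (fun i => if i ∈ v then hi' i else if i ∈ u then lo' i else b' i)) :
    mixedDiff F u lo hi b = mixedDiff G u lo' hi' b' := by
  refine Finset.sum_congr rfl fun v hv => ?_
  rw [h v (Finset.mem_powerset.1 hv)]

@[simp] lemma mixedDiff_empty (F : (Fin d → ℝ) → E) (lo hi b : Fin d → ℝ) :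
    mixedDiff F ∅ lo hi b = F b := by
  simp [mixedDiff]

lemma mixedDiff_insert (F : (Fin d → ℝ) → E) {u : Finset (Fin d)} {i : Fin d} (hi' : i ∉ u)
    (lo hi b : Fin d → ℝ) :
    mixedDiff F (insert i u) lo hi b =
      mixedDiff F u lo hi (Function.update b i (hi i)) -
        mixedDiff F u lo hi (Function.update b i (lo i)) := by
  unfold mixedDiff
  rw [Finset.sum_powerset_insert hi', ← sub_eq_zero]
  have h1 : ∀ v ∈ u.powerset, (-1 : ℤ) ^ (insert i u \ v).card •
        F (fun l => if l ∈ v then hi l else if l ∈ insert i u then lo l else b l) =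
      - ((-1 : ℤ) ^ (u \ v).card •
        F (fun l => if l ∈ v then hi l else if l ∈ u then lo l else
          Function.update b i (lo i) l)) := by
    intro v hv
    have hiv : i ∉ v := fun h => hi' (Finset.mem_powerset.1 hv h)
    rw [Finset.insert_sdiff_of_notMem _ hiv, Finset.card_insert_of_notMem (by simp [hi']),
      pow_succ, mul_neg_one, neg_smul]
    congr 3
    ext l
    by_cases hl : l = i
    · subst hl; simp [hiv, hi']
    · simp [hl]
  have h2 : ∀ v ∈ u.powerset, (-1 : ℤ) ^ (insert i u \ insert i v).card •
        F (fun l => if l ∈ insert i v then hi l else if l ∈ insert i u then lo l else b l) =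
      (-1 : ℤ) ^ (u \ v).card •
        F (fun l => if l ∈ v then hi l else if l ∈ u then lo l else
          Function.update b i (hi i) l) := by
    intro v hv
    have hiv : i ∉ v := fun h => hi' (Finset.mem_powerset.1 hv h)
    have : insert i u \ insert i v = u \ v := by
      ext l
      simp only [Finset.mem_sdiff, Finset.mem_insert]
      constructor
      · rintro ⟨h | h, h3⟩
        · exact absurd (Or.inl h) h3
        · exact ⟨h, fun h4 => h3 (Or.inr h4)⟩
      · rintro ⟨h, h3⟩
        refine ⟨Or.inr h, ?_⟩
        rintro (h4 | h4)
        · exact hi' (h4 ▸ h)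
        · exact h3 h4
    rw [this]
    congr 2
    ext l
    by_cases hl : l = i
    · subst hl; simp [hiv, hi']
    · simp [hl]
  rw [Finset.sum_congr rfl h1, Finset.sum_congr rfl h2, Finset.sum_neg_distrib]
  abel

lemma mixedDiff_sub (F G : (Fin d → ℝ) → E) (u : Finset (Fin d)) (lo hi b : Fin d → ℝ) :
    mixedDiff (fun x => F x - G x) u lo hi b =
      mixedDiff F u lo hi b - mixedDiff G u lo hi b := by
  simp [mixedDiff, smul_sub, Finset.sum_sub_distrib]

lemma mixedDiff_add (F G : (Fin d → ℝ) → E) (u : Finset (Fin d)) (lo hi b : Fin d → ℝ) :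
    mixedDiff (fun x => F x + G x) u lo hi b =
      mixedDiff F u lo hi b + mixedDiff G u lo hi b := by
  simp [mixedDiff, smul_add, Finset.sum_add_distrib]

lemma mixedDiff_finset_sum {ι : Type*} (s : Finset ι) (F : ι → (Fin d → ℝ) → E)
    (u : Finset (Fin d)) (lo hi b : Fin d → ℝ) :
    mixedDiff (fun x => ∑ r ∈ s, F r x) u lo hi b =
      ∑ r ∈ s, mixedDiff (F r) u lo hi b := by
  simp only [mixedDiff, Finset.smul_sum]
  exact Finset.sum_comm

lemma mixedDiff_smul {R : Type*} [Ring R] [Module R E] (c : R) (F : (Fin d → ℝ) → E)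
    (u : Finset (Fin d)) (lo hi b : Fin d → ℝ) :
    mixedDiff (fun x => c • F x) u lo hi b = c • mixedDiff F u lo hi b := by
  simp only [mixedDiff, Finset.smul_sum]
  exact Finset.sum_congr rfl fun v _ => smul_comm _ _ _

lemma mixedDiff_ofReal (F : (Fin d → ℝ) → ℝ) (u : Finset (Fin d)) (lo hi b : Fin d → ℝ) :
    mixedDiff (fun x => (F x : ℂ)) u lo hi b = ((mixedDiff F u lo hi b : ℝ) : ℂ) := by
  simp [mixedDiff]

/-- A function that does not depend on the coordinate `i ∈ u` has zero mixed difference. -/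
lemma mixedDiff_eq_zero {F : (Fin d → ℝ) → E} {u : Finset (Fin d)} {i : Fin d} (hi' : i ∈ u)
    (hF : ∀ x t, F (Function.update x i t) = F x) (lo hi b : Fin d → ℝ) :
    mixedDiff F u lo hi b = 0 := by
  rw [← Finset.insert_erase hi', mixedDiff_insert F (Finset.notMem_erase i u), sub_eq_zero]
  refine mixedDiff_congr fun v hv => ?_
  rw [← hF _ (lo i)]
  congr 1
  ext l
  by_cases hl : l = i
  · subst hl
    have : l ∉ v := fun h => Finset.notMem_erase l u (hv h)
    simp [this]
  · simp [hl]

lemma mixedDiff_update_anchor (F : (Fin d → ℝ) → E) {u : Finset (Fin d)} {i : Fin d}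
    (hi' : i ∉ u) (lo hi b : Fin d → ℝ) (t : ℝ) :
    mixedDiff F u lo hi (Function.update b i t) =
      mixedDiff (fun x => F (Function.update x i t)) u lo hi b := by
  refine mixedDiff_congr fun v hv => ?_
  congr 1
  ext l
  by_cases hl : l = i
  · subst hl
    have : l ∉ v := fun h => hi' (hv h)
    simp [this, hi']
  · simp [hl]

lemma mixedDiff_comp_add (F : (Fin d → ℝ) → E) (u : Finset (Fin d)) (lo hi b τ : Fin d → ℝ) :
    mixedDiff (fun x => F (x + τ)) u lo hi b =
      mixedDiff F u (lo + τ) (hi + τ) (b + τ) := by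
  refine mixedDiff_congr fun v _ => ?_
  congr 1
  ext l
  simp only [Pi.add_apply]
  split_ifs <;> rfl

/-! ### Algebra of grid sums -/

lemma mem_gridCells {u : Finset (Fin d)} {n : ℕ} {k : Fin d → ℕ} :
    k ∈ gridCells u n ↔ (∀ i ∈ u, k i < n) ∧ ∀ i ∉ u, k i = 0 := by
  simp only [gridCells, Fintype.mem_piFinset]
  constructor
  · intro h
    refine ⟨fun i hi => ?_, fun i hi => ?_⟩ <;> simpa [hi] using h i
  · rintro ⟨h1, h2⟩ i
    by_cases hi : i ∈ u
    · simpa [hi] using h1 i hi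
    · simpa [hi] using h2 i hi

lemma sum_gridCells_insert {M : Type*} [AddCommMonoid M] {u : Finset (Fin d)} {i : Fin d}
    (hi : i ∉ u) (n : ℕ) (φ : (Fin d → ℕ) → M) :
    ∑ k ∈ gridCells (insert i u) n, φ k =
      ∑ t ∈ Finset.range n, ∑ k ∈ gridCells u n, φ (Function.update k i t) := by
  rw [← Finset.sum_product']
  symm
  refine Finset.sum_bij' (fun q _ => Function.update q.2 i q.1)
    (fun k _ => (k i, Function.update k i 0)) ?_ ?_ ?_ ?_ ?_
  · rintro ⟨t, k⟩ h
    simp only [Finset.mem_product, Finset.mem_range, mem_gridCells] at h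
    refine mem_gridCells.2 ⟨fun l hl => ?_, fun l hl => ?_⟩
    · by_cases h' : l = i
      · subst h'; simpa using h.1
      · simp only [ne_eq, h', not_false_eq_true, Function.update_of_ne]
        exact h.2.1 l (by simpa [h'] using hl)
    · have : l ≠ i ∧ l ∉ u := by simpa using hl
      simp [this.1, h.2.2 l this.2]
  · intro k h
    rw [mem_gridCells] at h
    simp only [Finset.mem_product, Finset.mem_range, mem_gridCells]
    refine ⟨h.1 i (by simp), fun l hl => ?_, fun l hl => ?_⟩
    · have : l ≠ i := fun e => hi (e ▸ hl)
      simp [this, h.1 l (by simp [hl])]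
    · by_cases h' : l = i
      · subst h'; simp
      · simp [h', h.2 l (by simp [h', hl])]
  · rintro ⟨t, k⟩ h
    simp only [Finset.mem_product, Finset.mem_range, mem_gridCells] at h
    simp [← h.2.2 i hi]
  · intro k _
    simp
  · intro q _
    rfl

lemma gridSum_congr {F G : (Fin d → ℝ) → E} {u : Finset (Fin d)} {n : ℕ}
    {p q : Fin d → ℕ → ℝ} {b c : Fin d → ℝ}
    (h : ∀ σ : Fin d → ℕ, F (fun i => if i ∈ u then p i (σ i) else b i) =
      G (fun i => if i ∈ u then q i (σ i) else c i)) :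
    gridSum F u n p b = gridSum G u n q c := by
  refine Finset.sum_congr rfl fun k _ => ?_
  rw [mixedDiff_congr (G := G) (b' := c)]
  intro v hv
  have e := h fun i => if i ∈ v then k i + 1 else k i
  convert e using 2 <;> ext i <;> by_cases hiv : i ∈ v
  · simp [hiv, hv hiv]
  · simp [hiv]
  · simp [hiv, hv hiv]
  · simp [hiv]

lemma gridSum_mono_n (F : (Fin d → ℝ) → E) (u : Finset (Fin d)) {n m : ℕ} (h : n ≤ m)
    (p : Fin d → ℕ → ℝ) (b : Fin d → ℝ) : gridSum F u n p b ≤ gridSum F u m p b := by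
  refine Finset.sum_le_sum_of_subset_of_nonneg (fun k hk => ?_) fun _ _ _ => norm_nonneg _
  rw [mem_gridCells] at hk ⊢
  exact ⟨fun i hi => (hk.1 i hi).trans_le h, hk.2⟩

@[simp] lemma gridSum_empty (F : (Fin d → ℝ) → E) (n : ℕ) (p : Fin d → ℕ → ℝ)
    (b : Fin d → ℝ) : gridSum F ∅ n p b = ‖F b‖ := by
  have : gridCells (∅ : Finset (Fin d)) n = {0} := by
    ext k
    simp [mem_gridCells, funext_iff]
  simp [gridSum, this]

/-- A grid sum in the coordinates `insert i u` is the sum, over the steps in the `i`-th coordinate,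
of the grid sums in the coordinates `u` of the increments of the function. -/
lemma gridSum_insert (F : (Fin d → ℝ) → E) {u : Finset (Fin d)} {i : Fin d} (hi : i ∉ u)
    (n : ℕ) (p : Fin d → ℕ → ℝ) (b : Fin d → ℝ) :
    gridSum F (insert i u) n p b = ∑ t ∈ Finset.range n,
      gridSum (fun x => F (Function.update x i (p i (t + 1))) -
        F (Function.update x i (p i t))) u n p b := by
  rw [gridSum, sum_gridCells_insert hi]
  refine Finset.sum_congr rfl fun t _ => Finset.sum_congr rfl fun k _ => ?_
  rw [mixedDiff_sub, ← mixedDiff_update_anchor F hi, ← mixedDiff_update_anchor F hi,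
    mixedDiff_insert F hi]
  simp only [Function.update_self]
  congr 2 <;>
  · refine mixedDiff_congr fun v hv => ?_
    congr 1
    ext l
    by_cases hl : l = i
    · subst hl
      have : l ∉ v := fun h => hi (hv h)
      simp [hi, this]
    · simp [hl]

lemma gridSum_sub_le (F G : (Fin d → ℝ) → E) (u : Finset (Fin d)) (n : ℕ)
    (p : Fin d → ℕ → ℝ) (b : Fin d → ℝ) :
    gridSum (fun x => F x - G x) u n p b ≤ gridSum F u n p b + gridSum G u n p b := by
  rw [gridSum, gridSum, gridSum, ← Finset.sum_add_distrib]
  refine Finset.sum_le_sum fun k _ => ?_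
  rw [mixedDiff_sub]
  exact norm_sub_le _ _

lemma gridSum_add_le (F G : (Fin d → ℝ) → E) (u : Finset (Fin d)) (n : ℕ)
    (p : Fin d → ℕ → ℝ) (b : Fin d → ℝ) :
    gridSum (fun x => F x + G x) u n p b ≤ gridSum F u n p b + gridSum G u n p b := by
  rw [gridSum, gridSum, gridSum, ← Finset.sum_add_distrib]
  refine Finset.sum_le_sum fun k _ => ?_
  rw [mixedDiff_add]
  exact norm_add_le _ _

lemma gridSum_finset_sum_le {ι : Type*} (s : Finset ι) (F : ι → (Fin d → ℝ) → E)
    (u : Finset (Fin d)) (n : ℕ) (p : Fin d → ℕ → ℝ) (b : Fin d → ℝ) :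
    gridSum (fun x => ∑ r ∈ s, F r x) u n p b ≤ ∑ r ∈ s, gridSum (F r) u n p b := by
  unfold gridSum
  rw [Finset.sum_comm]
  refine Finset.sum_le_sum fun k _ => ?_
  rw [mixedDiff_finset_sum]
  exact norm_sum_le _ _

lemma gridSum_smul {𝕜 : Type*} [NormedField 𝕜] [NormedSpace 𝕜 E] (c : 𝕜)
    (F : (Fin d → ℝ) → E) (u : Finset (Fin d)) (n : ℕ) (p : Fin d → ℕ → ℝ) (b : Fin d → ℝ) :
    gridSum (fun x => c • F x) u n p b = ‖c‖ * gridSum F u n p b := by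
  unfold gridSum
  rw [Finset.mul_sum]
  refine Finset.sum_congr rfl fun k _ => ?_
  rw [mixedDiff_smul, norm_smul]

lemma gridSum_ofReal (F : (Fin d → ℝ) → ℝ) (u : Finset (Fin d)) (n : ℕ) (p : Fin d → ℕ → ℝ)
    (b : Fin d → ℝ) : gridSum (fun x => (F x : ℂ)) u n p b = gridSum F u n p b := by
  unfold gridSum
  simp [mixedDiff_ofReal]

lemma gridSum_comp_add (F : (Fin d → ℝ) → E) (u : Finset (Fin d)) (n : ℕ)
    (p : Fin d → ℕ → ℝ) (b τ : Fin d → ℝ) :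
    gridSum (fun x => F (x + τ)) u n p b = gridSum F u n (fun i k => p i k + τ i) (b + τ) := by
  unfold gridSum
  simp only [mixedDiff_comp_add]
  rfl

lemma gridSum_const_le (c : E) (u : Finset (Fin d)) (n : ℕ) (p : Fin d → ℕ → ℝ)
    (b : Fin d → ℝ) : gridSum (fun _ => c) u n p b ≤ ‖c‖ := by
  rcases u.eq_empty_or_nonempty with rfl | ⟨i, hi⟩
  · simp
  · unfold gridSum
    simp [mixedDiff_eq_zero (F := fun _ : Fin d → ℝ => c) hi fun _ _ => rfl]

lemma mixedDiff_integral {Y : Type*} [MeasurableSpace Y] {μ : Measure Y} [NormedSpace ℝ E]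
    {H : Y → (Fin d → ℝ) → E} (hH : ∀ x, Integrable (fun y => H y x) μ)
    (u : Finset (Fin d)) (lo hi b : Fin d → ℝ) :
    mixedDiff (fun x => ∫ y, H y x ∂μ) u lo hi b = ∫ y, mixedDiff (H y) u lo hi b ∂μ := by
  unfold mixedDiff
  rw [integral_finsetSum]
  · refine Finset.sum_congr rfl fun v _ => ?_
    rcases neg_one_pow_eq_or ℤ (u \ v).card with h | h
    · simp [h]
    · simp [h, integral_neg]
  · intro v _
    rcases neg_one_pow_eq_or ℤ (u \ v).card with h | h
    · simpa [h] using hH _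
    · simpa [h] using (hH _).neg

lemma integrable_mixedDiff {Y : Type*} [MeasurableSpace Y] {μ : Measure Y}
    {H : Y → (Fin d → ℝ) → E} (hH : ∀ x, Integrable (fun y => H y x) μ)
    (u : Finset (Fin d)) (lo hi b : Fin d → ℝ) :
    Integrable (fun y => mixedDiff (H y) u lo hi b) μ := by
  unfold mixedDiff
  refine integrable_finsetSum _ fun v _ => ?_
  rcases neg_one_pow_eq_or ℤ (u \ v).card with h | h
  · simpa [h] using hH _
  · simpa [h] using (hH _).neg

/-- Minkowski's inequality for grid sums. -/
lemma gridSum_integral_le {Y : Type*} [MeasurableSpace Y] {μ : Measure Y} [NormedSpace ℝ E]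
    {H : Y → (Fin d → ℝ) → E} (hH : ∀ x, Integrable (fun y => H y x) μ)
    (u : Finset (Fin d)) (n : ℕ) (p : Fin d → ℕ → ℝ) (b : Fin d → ℝ)
    {C : Y → ℝ} (hC : Integrable C μ) (h : ∀ᵐ y ∂μ, gridSum (H y) u n p b ≤ C y) :
    gridSum (fun x => ∫ y, H y x ∂μ) u n p b ≤ ∫ y, C y ∂μ := by
  have h1 : ∀ k ∈ gridCells u n, ‖mixedDiff (fun x => ∫ y, H y x ∂μ) u (fun i => p i (k i))
      (fun i => p i (k i + 1)) b‖ ≤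
      ∫ y, ‖mixedDiff (H y) u (fun i => p i (k i)) (fun i => p i (k i + 1)) b‖ ∂μ := by
    intro k _
    rw [mixedDiff_integral hH]
    exact norm_integral_le_integral_norm _
  refine (Finset.sum_le_sum h1).trans ?_
  rw [← integral_finsetSum _ fun k _ => (integrable_mixedDiff hH _ _ _ _).norm]
  exact integral_mono_ae (integrable_finsetSum _ fun k _ =>
    (integrable_mixedDiff hH _ _ _ _).norm) hC h

end MixedDiff

/-! ### Grid sums of a function of bounded Hardy–Krause variation and of its periodization -/

section Periodization

variable {d : ℕ} {g : (Fin d → ℝ) → ℝ}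

/-- The grid sums anchored at the corner `(2π, …, 2π)`, including the one for the empty set of
coordinates, are bounded. -/
lemma exists_gridSum_le_of_hardyKrause
    (hg : hardyKrauseVariation g (fun _ => 0) (fun _ => 2 * Real.pi) ≠ ⊤) :
    ∃ C : ℝ, 0 ≤ C ∧ ∀ (u : Finset (Fin d)) (n : ℕ) (p : Fin d → ℕ → ℝ),
      (∀ i ∈ u, Monotone (p i) ∧ ∀ k, p i k ∈ Set.Icc 0 (2 * Real.pi)) →
      gridSum g u n p (fun _ => 2 * Real.pi) ≤ C := by
  refine ⟨(hardyKrauseVariation g (fun _ => 0) (fun _ => 2 * Real.pi)).toReal +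
    ‖g fun _ => 2 * Real.pi‖, by positivity, fun u n p hp => ?_⟩
  rcases u.eq_empty_or_nonempty with rfl | hu
  · simp
  have h1 : gridSum g u n p (fun _ => 2 * Real.pi) =
      gridSum g u n (fun i => if i ∈ u then p i else fun _ => 0) (fun _ => 2 * Real.pi) := by
    refine gridSum_congr fun σ => ?_
    congr 1
    ext i
    by_cases hi : i ∈ u <;> simp [hi]
  have h2 : vitaliVariation g u (fun _ => 0) (fun _ => 2 * Real.pi) ≤
      hardyKrauseVariation g (fun _ => 0) (fun _ => 2 * Real.pi) :=
    Finset.single_le_sum (f := fun u => vitaliVariation g u (fun _ => 0) (fun _ => 2 * Real.pi))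
      (fun _ _ => zero_le) (by simpa using hu)
  have h3 := (gridSum_le_vitaliVariation g u n (fun i => if i ∈ u then p i else fun _ => 0)
    (fun _ => 0) (fun _ => 2 * Real.pi) (fun i => by
      by_cases hi : i ∈ u
      · simpa [hi] using hp i hi
      · simp only [hi, if_false]
        exact ⟨monotone_const, fun _ => ⟨le_rfl, by positivity⟩⟩)).trans h2
  rw [h1]
  have h4 := (ENNReal.ofReal_le_iff_le_toReal hg).1 h3
  linarith [norm_nonneg (g fun _ => 2 * Real.pi)]

/-- Moving the anchor costs a factor `2` per coordinate: the change of a mixed difference when one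
coordinate of the anchor is moved is a mixed difference in one more coordinate. -/
lemma gridSum_le_of_anchor {C : ℝ} (hC : 0 ≤ C)
    (h : ∀ (u : Finset (Fin d)) (n : ℕ) (p : Fin d → ℕ → ℝ),
      (∀ i ∈ u, Monotone (p i) ∧ ∀ k, p i k ∈ Set.Icc 0 (2 * Real.pi)) →
      gridSum g u n p (fun _ => 2 * Real.pi) ≤ C) (z : Finset (Fin d)) :
    ∀ (u : Finset (Fin d)) (n : ℕ) (p : Fin d → ℕ → ℝ) (c : Fin d → ℝ),
      (∀ i ∈ u, Monotone (p i) ∧ ∀ k, p i k ∈ Set.Icc 0 (2 * Real.pi)) →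
      (∀ i, c i ∈ Set.Icc 0 (2 * Real.pi)) → (∀ i ∉ z, i ∉ u → c i = 2 * Real.pi) →
      gridSum g u n p c ≤ 2 ^ z.card * C := by
  induction z using Finset.induction_on with
  | empty =>
    intro u n p c hp _ hc
    have : gridSum g u n p c = gridSum g u n p (fun _ => 2 * Real.pi) := by
      refine gridSum_congr fun σ => ?_
      congr 1
      ext i
      by_cases hi : i ∈ u
      · simp [hi]
      · simp [hi, hc i (by simp) hi]
    rw [this]
    simpa using h u n p hp
  | insert i z hiz ih =>
    intro u n p c hp hcI hc
    rw [Finset.card_insert_of_notMem hiz, pow_succ]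
    have hpos : 0 ≤ 2 ^ z.card * C := by positivity
    by_cases hi : i ∈ u
    · refine (ih u n p c hp hcI fun l hl hlu => hc l ?_ hlu).trans (by linarith)
      simp only [Finset.mem_insert, not_or]
      exact ⟨fun e => hlu (e ▸ hi), hl⟩
    · -- the mixed difference in the coordinates `insert i u` uses the step from `c i` to `2π`
      set q : Fin d → ℕ → ℝ :=
        Function.update p i (fun k => if k = 0 then c i else 2 * Real.pi) with hq
      have hqi : ∀ l ≠ i, q l = p l := fun l hl => by simp [hq, hl]
      have e1 : gridSum g u n p c ≤ gridSum g u (n + 1) p c :=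
        gridSum_mono_n _ _ (Nat.le_succ n) _ _
      have e2 : gridSum g u (n + 1) p c =
          gridSum (fun x => g (Function.update x i (2 * Real.pi)) -
            (g (Function.update x i (2 * Real.pi)) - g (Function.update x i (c i))))
            u (n + 1) q c := by
        refine gridSum_congr fun σ => ?_
        simp only [sub_sub_cancel]
        congr 1
        ext l
        by_cases hl : l = i
        · subst hl; simp [hi]
        · simp [hl, hqi l hl]
      have e3 : gridSum (fun x => g (Function.update x i (2 * Real.pi))) u (n + 1) q c =
          gridSum g u (n + 1) p (Function.update c i (2 * Real.pi)) := by
        refine gridSum_congr fun σ => ?_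
        congr 1
        ext l
        by_cases hl : l = i
        · subst hl; simp [hi]
        · simp [hl, hqi l hl]
      have e4 : gridSum (fun x => g (Function.update x i (2 * Real.pi)) -
          g (Function.update x i (c i))) u (n + 1) q c ≤ gridSum g (insert i u) (n + 1) q c := by
        rw [gridSum_insert g hi]
        refine le_trans (le_of_eq ?_) (Finset.single_le_sum
          (fun t _ => gridSum_nonneg _ _ _ _ _) (Finset.mem_range.2 (Nat.succ_pos n)))
        simp [hq]
      have e5 := ih u (n + 1) p (Function.update c i (2 * Real.pi)) hp
        (fun l => by
          by_cases hl : l = i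
          · subst hl; simpa using Real.pi_pos.le
          · simpa [hl] using hcI l)
        (fun l hl hlu => by
          by_cases h' : l = i
          · subst h'; simp
          · simp [h', hc l (by simp [h', hl]) hlu])
      have e6 := ih (insert i u) (n + 1) q c
        (fun l hl => by
          by_cases h' : l = i
          · subst h'
            have hq' : q l = fun k => if k = 0 then c l else 2 * Real.pi := by simp [hq]
            rw [hq']
            refine ⟨monotone_nat_of_le_succ fun k => ?_, fun k => ?_⟩
            · by_cases hk : k = 0
              · simpa [hk] using (hcI l).2
              · simp [hk]
            · by_cases hk : k = 0
              · simpa [hk] using hcI l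
              · simpa [hk] using Real.pi_pos.le
          · rw [hqi l h']
            exact hp l (by simpa [h'] using hl))
        hcI
        (fun l hl hlu => by
          simp only [Finset.mem_insert, not_or] at hlu
          exact hc l (by simp [hlu.1, hl]) hlu.2)
      have e7 := gridSum_sub_le (fun x => g (Function.update x i (2 * Real.pi)))
        (fun x => g (Function.update x i (2 * Real.pi)) - g (Function.update x i (c i)))
        u (n + 1) q c
      rw [e2] at e1
      rw [e3] at e7
      linarith

/-- The representative in `[0, 2π)^d` of a point of the torus. -/
def torusRep (x : Fin d → ℝ) : Fin d → ℝ := fun i => toIcoMod Real.two_pi_pos 0 (x i)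

lemma torusRep_mem (x : Fin d → ℝ) (i : Fin d) : torusRep x i ∈ Set.Ico 0 (2 * Real.pi) := by
  simpa [torusRep] using toIcoMod_mem_Ico Real.two_pi_pos 0 (x i)

lemma torusRep_update (x : Fin d → ℝ) (i : Fin d) (t : ℝ) :
    torusRep (Function.update x i t) =
      Function.update (torusRep x) i (toIcoMod Real.two_pi_pos 0 t) := by
  ext l
  by_cases hl : l = i
  · subst hl; simp [torusRep]
  · simp [torusRep, hl]

/-- A sum of increments along a monotone sequence that spans at most one period is, modulo the
period, made of two such sums within `[0, T)` and a single increment. -/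
lemma sum_increments_mod_le {T : ℝ} (hT : 0 < T) {A : ℝ → ℝ → ℝ} {C : ℝ} {n : ℕ}
    (hnonneg : ∀ s t, 0 ≤ A s t) (hsymm : ∀ s t, A s t = A t s)
    (hA : ∀ q : ℕ → ℝ, Monotone q → (∀ k, q k ∈ Set.Ico 0 T) →
      ∑ t ∈ Finset.range n, A (q t) (q (t + 1)) ≤ C)
    (P : ℕ → ℝ) (hP : Monotone P) (hPT : ∀ k, P k ≤ P 0 + T) :
    ∑ t ∈ Finset.range n, A (toIcoMod hT 0 (P t)) (toIcoMod hT 0 (P (t + 1))) ≤ 3 * C := by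
  have hC0 : 0 ≤ C := le_trans (Finset.sum_nonneg fun _ _ => hnonneg _ _)
    (hA (fun _ => 0) monotone_const fun _ => ⟨le_rfl, hT⟩)
  set e : ℤ := toIcoDiv hT 0 (P 0) with he
  set a : ℝ := P 0 - e • T with ha
  have ha0 : a ∈ Set.Ico 0 T := by
    have := sub_toIcoDiv_zsmul_mem_Ico hT 0 (P 0)
    rwa [zero_add] at this
  simp only [zsmul_eq_mul] at ha
  have hmod1 : ∀ k, P k - e * T < T → toIcoMod hT 0 (P k) = P k - e * T := by
    intro k hk
    rw [toIcoMod_eq_iff]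
    have := hP (Nat.zero_le k)
    exact ⟨⟨by linarith [ha0.1], by simpa using hk⟩, e, by simp⟩
  have hmod2 : ∀ k, T ≤ P k - e * T → toIcoMod hT 0 (P k) = P k - e * T - T := by
    intro k hk
    rw [toIcoMod_eq_iff]
    have := hPT k
    exact ⟨⟨by linarith, by simpa using by linarith [ha0.2]⟩, e + 1, by simp; ring⟩
  by_cases hcross : ∃ k, T ≤ P k - e * T
  · classical
    set κ := Nat.find hcross with hκ
    have hκ1 : T ≤ P κ - e * T := Nat.find_spec hcross
    have hκ0 : ∀ k < κ, P k - e * T < T := fun k hk => not_le.1 (Nat.find_min hcross hk)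
    have hκ2 : ∀ k, κ ≤ k → T ≤ P k - e * T := fun k hk => hκ1.trans (by linarith [hP hk])
    have hκpos : 0 < κ := by
      rcases Nat.eq_zero_or_pos κ with h | h
      · rw [h] at hκ1; linarith [ha0.2]
      · exact h
    set q1 : ℕ → ℝ := fun t => P (min t (κ - 1)) - e * T with hq1
    set q2 : ℕ → ℝ := fun t => P (max t κ) - e * T - T with hq2
    have hq1m : Monotone q1 := fun s t hst => by
      have : P (min s (κ - 1)) ≤ P (min t (κ - 1)) := hP (min_le_min_right _ hst)
      simp only [hq1]; linarith
    have hq2m : Monotone q2 := fun s t hst => by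
      have : P (max s κ) ≤ P (max t κ) := hP (max_le_max_right _ hst)
      simp only [hq2]; linarith
    have hq1I : ∀ k, q1 k ∈ Set.Ico 0 T := fun k => by
      have h1 := hP (Nat.zero_le (min k (κ - 1)))
      have h2 := hκ0 (min k (κ - 1)) (by omega)
      simp only [hq1]
      exact ⟨by linarith [ha0.1], h2⟩
    have hq2I : ∀ k, q2 k ∈ Set.Ico 0 T := fun k => by
      have h1 := hPT (max k κ)
      have h2 := hκ2 (max k κ) (le_max_right _ _)
      simp only [hq2]
      exact ⟨by linarith, by linarith [ha0.2]⟩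
    set s0 := P (κ - 1) - e * T with hs0
    set t0 := P κ - e * T - T with ht0
    have hs0I : s0 ∈ Set.Ico 0 T := by simpa [hq1, hs0] using hq1I (κ - 1)
    have ht0I : t0 ∈ Set.Ico 0 T := by simpa [hq2, ht0] using hq2I κ
    have hterm : ∀ t ∈ Finset.range n,
        A (toIcoMod hT 0 (P t)) (toIcoMod hT 0 (P (t + 1))) ≤
        A (q1 t) (q1 (t + 1)) + A (q2 t) (q2 (t + 1)) + if t = κ - 1 then A s0 t0 else 0 := by
      intro t _
      rcases lt_trichotomy (t + 1) κ with h | h | h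
      · rw [hmod1 t (hκ0 t (by omega)), hmod1 (t + 1) (hκ0 _ h)]
        have e1 : q1 t = P t - e * T := by simp only [hq1]; rw [min_eq_left (by omega)]
        have e2 : q1 (t + 1) = P (t + 1) - e * T := by
          simp only [hq1]; rw [min_eq_left (by omega)]
        rw [e1, e2, if_neg (by omega)]
        linarith [hnonneg (q2 t) (q2 (t + 1))]
      · have ht : t = κ - 1 := by omega
        rw [hmod1 t (hκ0 t (by omega)), hmod2 (t + 1) (hκ2 _ (by omega)), if_pos ht, hs0, ht0,
          ← ht, ← h]
        linarith [hnonneg (q2 t) (q2 (t + 1)), hnonneg (q1 t) (q1 (t + 1))]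
      · rw [hmod2 t (hκ2 t (by omega)), hmod2 (t + 1) (hκ2 _ (by omega))]
        have e1 : q2 t = P t - e * T - T := by simp only [hq2]; rw [max_eq_left (by omega)]
        have e2 : q2 (t + 1) = P (t + 1) - e * T - T := by
          simp only [hq2]; rw [max_eq_left (by omega)]
        rw [e1, e2, if_neg (by omega)]
        linarith [hnonneg (q1 t) (q1 (t + 1))]
    have hsingle : (∑ t ∈ Finset.range n, if t = κ - 1 then A s0 t0 else 0) ≤ C := by
      rw [Finset.sum_ite_eq']
      split_ifs with hn
      · rw [Finset.mem_range] at hn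
        have hn0 : 0 ∈ Finset.range n := Finset.mem_range.2 (by omega)
        -- the single increment is a grid with one nontrivial step, in one of the two orders
        have key : ∀ s t, s ∈ Set.Ico 0 T → t ∈ Set.Ico 0 T → s ≤ t → A s t ≤ C := by
          intro s t hs ht hst
          have := hA (fun k => if k = 0 then s else t)
            (monotone_nat_of_le_succ fun k => by by_cases hk : k = 0 <;> simp [hk, hst])
            (fun k => by by_cases hk : k = 0 <;> simp [hk, hs.1, hs.2, ht.1, ht.2])
          refine le_trans ?_ this
          refine le_trans (le_of_eq ?_) (Finset.single_le_sum
            (fun t _ => hnonneg _ _) hn0)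
          simp
        rcases le_total s0 t0 with h | h
        · exact key _ _ hs0I ht0I h
        · rw [hsymm]; exact key _ _ ht0I hs0I h
      · exact hC0
    calc _ ≤ _ := Finset.sum_le_sum hterm
      _ ≤ C + C + C := by
        rw [Finset.sum_add_distrib, Finset.sum_add_distrib]
        exact add_le_add (add_le_add (hA q1 hq1m hq1I) (hA q2 hq2m hq2I)) hsingle
      _ = 3 * C := by ring
  · push Not at hcross
    have : ∑ t ∈ Finset.range n, A (toIcoMod hT 0 (P t)) (toIcoMod hT 0 (P (t + 1))) =
        ∑ t ∈ Finset.range n, A (P t - e * T) (P (t + 1) - e * T) :=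
      Finset.sum_congr rfl fun t _ => by rw [hmod1 _ (hcross _), hmod1 _ (hcross _)]
    rw [this]
    have := hA (fun k => P k - e * T) (fun s t hst => by have := hP hst; simp only; linarith)
      (fun k => ⟨by have := hP (Nat.zero_le k); linarith [ha0.1], hcross k⟩)
    linarith

/-- Grids for which each coordinate spans at most one period; only the coordinates in `u` matter. -/
def IsPeriodGrid (u : Finset (Fin d)) (p : Fin d → ℕ → ℝ) : Prop :=
  ∀ i ∈ u, Monotone (p i) ∧ ∀ k, p i k ≤ p i 0 + 2 * Real.pi

/-- For a periodic function, bounds on the grid sums within one period box give bounds for all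
grids spanning at most one period. -/
lemma gridSum_le_of_periodic {F : (Fin d → ℝ) → ℝ}
    (hF : ∀ x i t, F (Function.update x i (toIcoMod Real.two_pi_pos 0 t)) =
      F (Function.update x i t)) {C : ℝ} (hC : 0 ≤ C)
    (h : ∀ (u : Finset (Fin d)) (n : ℕ) (p : Fin d → ℕ → ℝ) (b : Fin d → ℝ),
      (∀ i ∈ u, Monotone (p i) ∧ ∀ k, p i k ∈ Set.Ico 0 (2 * Real.pi)) →
      gridSum F u n p b ≤ C) (z : Finset (Fin d)) :
    ∀ (u : Finset (Fin d)) (n : ℕ) (p : Fin d → ℕ → ℝ) (b : Fin d → ℝ),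
      IsPeriodGrid u p → (∀ i ∈ u, i ∉ z → ∀ k, p i k ∈ Set.Ico 0 (2 * Real.pi)) →
      gridSum F u n p b ≤ 3 ^ z.card * C := by
  induction z using Finset.induction_on with
  | empty =>
    intro u n p b hp hI
    simpa using h u n p b (fun i hi => ⟨(hp i hi).1, hI i hi (by simp)⟩)
  | insert i z hiz ih =>
    intro u n p b hp hI
    rw [Finset.card_insert_of_notMem hiz, pow_succ]
    have hpos : 0 ≤ 3 ^ z.card * C := by positivity
    by_cases hi : i ∈ u
    · obtain ⟨w, hw, rfl⟩ : ∃ w, i ∉ w ∧ u = insert i w :=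
        ⟨u.erase i, Finset.notMem_erase i u, (Finset.insert_erase hi).symm⟩
      let A : ℝ → ℝ → ℝ := fun s t => gridSum (fun x => F (Function.update x i t) -
        F (Function.update x i s)) w n p b
      have hgrid : gridSum F (insert i w) n p b = ∑ t ∈ Finset.range n,
          A (toIcoMod Real.two_pi_pos 0 (p i t)) (toIcoMod Real.two_pi_pos 0 (p i (t + 1))) := by
        rw [gridSum_insert F hw]
        simp only [A, hF]
      have hsymm : ∀ s t, A s t = A t s := by
        intro s t
        have := gridSum_smul (-1 : ℝ) (fun x => F (Function.update x i s) -
          F (Function.update x i t)) w n p b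
        simpa [A] using this
      rw [hgrid]
      refine (sum_increments_mod_le Real.two_pi_pos (C := 3 ^ z.card * C)
        (fun s t => gridSum_nonneg _ _ _ _ _) hsymm (fun q hq hqI => ?_) (p i)
        (hp i (by simp)).1 (hp i (by simp)).2).trans (by linarith)
      have key := ih (insert i w) n (Function.update p i q) b
        (fun l hl => by
          by_cases h' : l = i
          · subst h'
            simp only [Function.update_self]
            exact ⟨hq, fun k => by linarith [(hqI k).2, (hqI 0).1]⟩
          · simpa [h'] using hp l hl)
        (fun l hl hlz k => by
          by_cases h' : l = i
          · subst h'; simpa using hqI k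
          · simpa [h'] using hI l hl (by simp [h', hlz]) k)
      rw [gridSum_insert F hw] at key
      refine le_trans (le_of_eq (Finset.sum_congr rfl fun t _ => ?_)) key
      rw [Function.update_self]
      refine gridSum_congr fun σ => ?_
      have : ∀ s, Function.update (fun l => if l ∈ w then p l (σ l) else b l) i s =
          Function.update (fun l => if l ∈ w then Function.update p i q l (σ l) else b l)
            i s := by
        intro s
        ext l
        by_cases h' : l = i
        · subst h'; simp
        · simp [h']
      rw [this, this]
    · refine (ih u n p b hp fun l hl hlz => hI l hl ?_).trans (by linarith)
      simp only [Finset.mem_insert, not_or]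
      exact ⟨fun e => hi (e ▸ hl), hlz⟩

/-- The grid sums of the periodization of a function of bounded Hardy–Krause variation are bounded,
for all grids spanning at most one period and all anchors. -/
lemma exists_gridSum_torusRep_le
    (hg : hardyKrauseVariation g (fun _ => 0) (fun _ => 2 * Real.pi) ≠ ⊤) :
    ∃ C : ℝ, 0 ≤ C ∧ ∀ (u : Finset (Fin d)) (n : ℕ) (p : Fin d → ℕ → ℝ) (b : Fin d → ℝ),
      IsPeriodGrid u p → gridSum (fun x => g (torusRep x)) u n p b ≤ C := by
  obtain ⟨C, hC, h⟩ := exists_gridSum_le_of_hardyKrause hg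
  refine ⟨3 ^ (Finset.univ : Finset (Fin d)).card * (2 ^ (Finset.univ : Finset (Fin d)).card * C),
    by positivity, fun u n p b hp => ?_⟩
  refine gridSum_le_of_periodic (fun x i t => by rw [torusRep_update, torusRep_update,
    toIcoMod_toIcoMod]) (by positivity) (fun u n p b hp => ?_) Finset.univ u n p b hp (by simp)
  have : gridSum (fun x => g (torusRep x)) u n p b = gridSum g u n p (torusRep b) := by
    refine gridSum_congr fun σ => ?_
    congr 1
    ext i
    by_cases hi : i ∈ u
    · simp only [torusRep, hi, if_true]
      rw [toIcoMod_eq_self]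
      simpa using (hp i hi).2 (σ i)
    · simp [torusRep, hi]
  rw [this]
  exact gridSum_le_of_anchor hC h Finset.univ u n p (torusRep b)
    (fun i hi => ⟨(hp i hi).1, fun k => Set.Ico_subset_Icc_self ((hp i hi).2 k)⟩)
    (fun i => Set.Ico_subset_Icc_self (torusRep_mem b i)) (by simp)

end Periodization

/-! ### Jumps of periodic functions of bounded variation -/

section OneVariable

/-- Local lower bounds for the variation near distinct points add up. -/
lemma sum_le_eVariationOn_of_local {E : Type*} [PseudoEMetricSpace E] {H : ℝ → E} {a : ℝ}
    {w : ℝ → ENNReal} {A : Finset ℝ} :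
    ∀ {b : ℝ}, (∀ α ∈ A, α ∈ Set.Ioo a b) →
      (∀ α ∈ A, ∀ c e, a ≤ c → c < α → α < e → e ≤ b → w α ≤ eVariationOn H (Set.Icc c e)) →
      ∑ α ∈ A, w α ≤ eVariationOn H (Set.Icc a b) := by
  induction A using Finset.induction_on_max with
  | empty => intro b _ _; simp
  | insert α s hs ih =>
    intro b hA hw
    have hα : α ∉ s := fun h => lt_irrefl _ (hs α h)
    rw [Finset.sum_insert hα]
    have hαI := hA α (by simp)
    obtain ⟨c, hc1, hc2, hc3⟩ : ∃ c, a < c ∧ c < α ∧ ∀ β ∈ s, β < c := by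
      have : ∃ m, m < α ∧ a ≤ m ∧ ∀ β ∈ s, β ≤ m := by
        rcases s.eq_empty_or_nonempty with rfl | hne
        · exact ⟨a, hαI.1, le_rfl, by simp⟩
        · exact ⟨s.max' hne, hs _ (s.max'_mem hne),
            (hA _ (Finset.mem_insert_of_mem (s.max'_mem hne))).1.le, fun β hβ => s.le_max' β hβ⟩
      obtain ⟨m, h1, h2, h3⟩ := this
      exact ⟨(m + α) / 2, by linarith, by linarith, fun β hβ => by linarith [h3 β hβ]⟩
    have hsplit := eVariationOn.Icc_add_Icc H (s := Set.univ) (a := a) (b := c) (c := b) hc1.le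
      (hc2.trans hαI.2).le (Set.mem_univ _)
    simp only [Set.univ_inter] at hsplit
    rw [← hsplit, add_comm]
    refine add_le_add (ih (fun β hβ => ⟨(hA β (by simp [hβ])).1, hc3 β hβ⟩)
      fun β hβ c' e hc' h1 h2 he => hw β (by simp [hβ]) c' e hc' h1 h2
        (he.trans (hc2.trans hαI.2).le)) (hw α (by simp) c b hc1.le hc2 hαI.2 le_rfl)

variable {H : ℝ → ℝ}

lemma tendsto_add_const_nhdsGT (t c : ℝ) : Tendsto (fun s => s + c) (𝓝[>] t) (𝓝[>] (t + c)) := by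
  refine tendsto_nhdsWithin_iff.2 ⟨?_, ?_⟩
  · exact ((continuous_id.add continuous_const).tendsto t).mono_left nhdsWithin_le_nhds
  · filter_upwards [self_mem_nhdsWithin] with s hs
    simpa using hs

lemma tendsto_add_const_nhdsLT (t c : ℝ) : Tendsto (fun s => s + c) (𝓝[<] t) (𝓝[<] (t + c)) := by
  refine tendsto_nhdsWithin_iff.2 ⟨?_, ?_⟩
  · exact ((continuous_id.add continuous_const).tendsto t).mono_left nhdsWithin_le_nhds
  · filter_upwards [self_mem_nhdsWithin] with s hs
    simpa using hs

lemma Function.Periodic.tendsto_rightLim_of_boundedVariationOn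
    (hper : Function.Periodic H (2 * Real.pi))
    (hbv : BoundedVariationOn H (Set.Icc 0 (2 * Real.pi))) (t : ℝ) :
    Tendsto H (𝓝[>] t) (𝓝 (Function.rightLim H t)) := by
  apply tendsto_rightLim_of_tendsto
  set t0 := toIcoMod Real.two_pi_pos 0 t with ht0
  have hI : t0 ∈ Set.Ico 0 (2 * Real.pi) := by
    simpa using toIcoMod_mem_Ico Real.two_pi_pos 0 t
  have ht : t = t0 + toIcoDiv Real.two_pi_pos 0 t • (2 * Real.pi) :=
    (toIcoMod_add_toIcoDiv_zsmul _ _ _).symm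
  obtain ⟨l, hl⟩ := hbv.exists_tendsto_right t0
  refine ⟨l, ?_⟩
  have h1 : 𝓝[Set.Icc 0 (2 * Real.pi) ∩ Set.Ioi t0] t0 = 𝓝[>] t0 := by
    refine nhdsWithin_inter_of_mem ?_
    filter_upwards [Ioo_mem_nhdsGT hI.2] with s hs
    exact ⟨hI.1.trans hs.1.le, hs.2.le⟩
  rw [h1] at hl
  have h2 := hl.comp (tendsto_add_const_nhdsGT t (-(toIcoDiv Real.two_pi_pos 0 t •
    (2 * Real.pi))) |>.mono_right (le_of_eq (by congr 1)))
  refine h2.congr fun s => ?_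
  simp only [Function.comp]
  rw [← sub_eq_add_neg]
  exact hper.sub_zsmul_eq _

lemma Function.Periodic.rightLim_add {H : ℝ → ℝ} {T : ℝ} (hper : Function.Periodic H T) (t : ℝ)
    (hlim : Tendsto H (𝓝[>] t) (𝓝 (Function.rightLim H t))) :
    Function.rightLim H (t + T) = Function.rightLim H t := by
  apply rightLim_eq_of_tendsto
  have h2 := hlim.comp ((tendsto_add_const_nhdsGT (t + T) (-T)).mono_right
    (le_of_eq (by rw [add_neg_cancel_right])))
  refine h2.congr fun s => ?_
  simp only [Function.comp]
  rw [← sub_eq_add_neg]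
  exact hper.sub_eq _

lemma BoundedVariationOn.tendsto_leftLim_of_mem_Ioo
    (hbv : BoundedVariationOn H (Set.Icc 0 (2 * Real.pi))) {t : ℝ} (ht : t ∈ Set.Ioo 0 (2 * Real.pi)) :
    Tendsto H (𝓝[<] t) (𝓝 (Function.leftLim H t)) := by
  apply tendsto_leftLim_of_tendsto
  obtain ⟨l, hl⟩ := hbv.exists_tendsto_left t
  refine ⟨l, ?_⟩
  have h1 : 𝓝[Set.Icc 0 (2 * Real.pi) ∩ Set.Iio t] t = 𝓝[<] t := by
    refine nhdsWithin_inter_of_mem ?_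
    filter_upwards [Ioo_mem_nhdsLT ht.1] with s hs
    exact ⟨hs.1.le, hs.2.le.trans ht.2.le⟩
  rwa [h1] at hl

/-- The jumps inside a period of a periodic function of bounded variation are summable. -/
lemma BoundedVariationOn.sum_abs_jump_le
    (hbv : BoundedVariationOn H (Set.Icc 0 (2 * Real.pi)))
    (hper : Function.Periodic H (2 * Real.pi)) (A : Finset ℝ)
    (hA : ∀ α ∈ A, α ∈ Set.Ioo 0 (2 * Real.pi)) :
    ∑ α ∈ A, |Function.rightLim H α - Function.leftLim H α| ≤
      (eVariationOn H (Set.Icc 0 (2 * Real.pi))).toReal := by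
  rw [← ENNReal.ofReal_le_iff_le_toReal hbv, ENNReal.ofReal_sum_of_nonneg fun _ _ => abs_nonneg _]
  refine sum_le_eVariationOn_of_local hA fun α hα c e _ hc he _ => ?_
  have hr := hper.tendsto_rightLim_of_boundedVariationOn hbv α
  have hl := hbv.tendsto_leftLim_of_mem_Ioo (hA α hα)
  have hshift : Tendsto (fun δ : ℝ => α - δ) (𝓝[>] 0) (𝓝[<] α) := by
    refine tendsto_nhdsWithin_iff.2 ⟨?_, ?_⟩
    · have : Tendsto (fun δ : ℝ => α - δ) (𝓝 0) (𝓝 (α - 0)) :=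
        (continuous_const.sub continuous_id).tendsto 0
      rw [sub_zero] at this
      exact this.mono_left nhdsWithin_le_nhds
    · filter_upwards [self_mem_nhdsWithin] with s hs
      simpa using hs
  have hshift' : Tendsto (fun δ : ℝ => δ + α) (𝓝[>] 0) (𝓝[>] α) := by
    simpa using tendsto_add_const_nhdsGT 0 α
  have h1 := (hr.comp hshift').edist (hl.comp hshift)
  rw [edist_dist, Real.dist_eq] at h1
  refine le_of_tendsto h1 ?_
  have h2 : ∀ᶠ δ : ℝ in 𝓝[>] 0, δ < min (α - c) (e - α) :=
    nhdsWithin_le_nhds (eventually_lt_nhds (lt_min (by linarith) (by linarith)))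
  filter_upwards [h2, self_mem_nhdsWithin] with δ hδ hδ0
  have h3 := lt_min_iff.1 hδ
  have h4 : 0 < δ := hδ0
  exact eVariationOn.edist_le H ⟨by linarith, by linarith⟩ ⟨by linarith, by linarith⟩

/-- The `2π`-periodic sawtooth with unit jump at `0` and zero mean. -/
def sawtooth (t : ℝ) : ℝ := 1 / 2 - Int.fract (t / (2 * Real.pi))

lemma abs_sawtooth_le (t : ℝ) : |sawtooth t| ≤ 1 / 2 := by
  rw [sawtooth, abs_le]
  constructor <;> linarith [Int.fract_nonneg (t / (2 * Real.pi)),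
    Int.fract_lt_one (t / (2 * Real.pi))]

@[fun_prop]
lemma measurable_sawtooth : Measurable sawtooth := by
  unfold sawtooth
  exact measurable_const.sub (measurable_fract.comp (measurable_id.div_const _))

lemma sawtooth_periodic : Function.Periodic sawtooth (2 * Real.pi) := by
  intro t
  simp [sawtooth, add_div, Real.pi_ne_zero]

lemma sawtooth_of_mem {t : ℝ} (h : t ∈ Set.Ico 0 (2 * Real.pi)) :
    sawtooth t = 1 / 2 - t / (2 * Real.pi) := by
  rw [sawtooth, Int.fract_eq_self.2 ⟨div_nonneg h.1 Real.two_pi_pos.le,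
    (div_lt_one Real.two_pi_pos).2 h.2⟩]

lemma sawtooth_of_mem_neg {t : ℝ} (h : t ∈ Set.Ico (-(2 * Real.pi)) 0) :
    sawtooth t = -(1 / 2) - t / (2 * Real.pi) := by
  have h1 := sawtooth_of_mem (t := t + 2 * Real.pi) ⟨by linarith [h.1], by linarith [h.2]⟩
  rw [sawtooth_periodic] at h1
  rw [h1, add_div, div_self Real.two_pi_pos.ne']
  ring

lemma sawtooth_sub_sawtooth {α s t : ℝ} (hα : α ∈ Set.Ioo 0 (2 * Real.pi)) (hs : 0 ≤ s)
    (hst : s ≤ t) (ht : t ≤ 2 * Real.pi) :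
    sawtooth (t - α) - sawtooth (s - α) =
      (Set.Ioc s t).indicator (fun _ => (1 : ℝ)) α - (t - s) / (2 * Real.pi) := by
  have h : ∀ r, 0 ≤ r → r ≤ 2 * Real.pi → sawtooth (r - α) =
      (if α ≤ r then 1 else 0) - 1 / 2 - (r - α) / (2 * Real.pi) := by
    intro r h0 h1
    split_ifs with h2
    · rw [sawtooth_of_mem ⟨by linarith, by linarith [hα.1]⟩]; ring
    · rw [sawtooth_of_mem_neg ⟨by linarith [hα.2], by linarith⟩]; ring
  rw [h t (hs.trans hst) ht, h s hs (hst.trans ht), Set.indicator_apply]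
  by_cases h1 : α ≤ s
  · rw [if_pos h1, if_pos (h1.trans hst), if_neg (by simp [h1])]; ring
  · by_cases h2 : α ≤ t
    · rw [if_neg h1, if_pos h2, if_pos ⟨not_le.1 h1, h2⟩]; ring
    · rw [if_neg h1, if_neg h2, if_neg (by simp [h2])]; ring

/-- The superposition of sawtooth functions with jumps `J α` at the points `α ∈ L`. -/
def jumpPart (J : ℝ → ℝ) (L : Set ℝ) (t : ℝ) : ℝ := ∑' α : L, J α * sawtooth (t - α)

variable {J : ℝ → ℝ} {L : Set ℝ}

lemma summable_jumpPart (hJ : Summable fun α : L => |J α|) (t : ℝ) :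
    Summable fun α : L => J α * sawtooth (t - α) := by
  refine Summable.of_norm_bounded (g := fun α : L => |J α| * (1 / 2)) (hJ.mul_right _) fun α => ?_
  rw [norm_mul, Real.norm_eq_abs, Real.norm_eq_abs]
  exact mul_le_mul_of_nonneg_left (abs_sawtooth_le _) (abs_nonneg _)

lemma abs_jumpPart_le (hJ : Summable fun α : L => |J α|) (t : ℝ) :
    |jumpPart J L t| ≤ (∑' α : L, |J α|) * (1 / 2) := by
  rw [← tsum_mul_right, ← Real.norm_eq_abs]
  refine tsum_of_norm_bounded (hJ.mul_right _).hasSum fun α => ?_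
  rw [norm_mul, Real.norm_eq_abs, Real.norm_eq_abs]
  exact mul_le_mul_of_nonneg_left (abs_sawtooth_le _) (abs_nonneg _)

lemma measurable_jumpPart (hL : L.Countable) (hJ : Summable fun α : L => |J α|) :
    Measurable (jumpPart J L) := by
  have : Countable L := hL.to_subtype
  refine measurable_of_tendsto_metrizable' (atTop : Filter (Finset L))
    (f := fun (A : Finset L) t => ∑ α ∈ A, J α * sawtooth (t - α)) (fun A => ?_) ?_
  · exact Finset.measurable_fun_sum _ fun α _ =>
      measurable_const.mul (measurable_sawtooth.comp (measurable_id.sub_const _))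
  · exact tendsto_pi_nhds.2 fun t => (summable_jumpPart hJ t).hasSum

lemma jumpPart_periodic : Function.Periodic (jumpPart J L) (2 * Real.pi) := by
  intro t
  unfold jumpPart
  congr 1
  ext α
  rw [add_sub_right_comm, sawtooth_periodic]

lemma jumpPart_sub_jumpPart (hL : L ⊆ Set.Ioo 0 (2 * Real.pi))
    (hJ : Summable fun α : L => |J α|) {s t : ℝ} (hs : 0 ≤ s)
    (hst : s ≤ t) (ht : t ≤ 2 * Real.pi)
    (hsupp : ∀ α ∈ Set.Ioc s t, J α ≠ 0 → α ∈ L) :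
    jumpPart J L t - jumpPart J L s =
      (∑' α : Set.Ioc s t, J (α : ℝ)) - (t - s) * ((∑' α : L, J (α : ℝ)) / (2 * Real.pi)) := by
  have hJ' : Summable fun α : L => J (α : ℝ) :=
    Summable.of_norm_bounded hJ fun α => (Real.norm_eq_abs _).le
  have h1 : Summable fun α : L => (Set.Ioc s t).indicator J α :=
    Summable.of_norm_bounded hJ fun α => by
      rw [Real.norm_eq_abs, Set.indicator_apply]
      split_ifs <;> simp
  have h2 : ∑' α : Set.Ioc s t, J (α : ℝ) = ∑' α : L, (Set.Ioc s t).indicator J α := by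
    rw [tsum_subtype (Set.Ioc s t) J, tsum_subtype L ((Set.Ioc s t).indicator J)]
    congr 1
    ext α
    by_cases h : α ∈ L
    · rw [Set.indicator_of_mem h]
    · rw [Set.indicator_of_notMem h]
      rw [Set.indicator_apply]
      split_ifs with h3
      · by_contra h4
        exact h (hsupp α h3 h4)
      · rfl
  have h3 : HasSum (fun α : L => (Set.Ioc s t).indicator J α -
      (t - s) * ((J α : ℝ) / (2 * Real.pi)))
      ((∑' α : L, (Set.Ioc s t).indicator J α) - (t - s) * ((∑' α : L, J (α : ℝ)) / (2 * Real.pi))) :=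
    h1.hasSum.sub ((hJ'.hasSum.div_const _).mul_left _)
  have h4 : HasSum (fun α : L => J α * sawtooth (t - α) - J α * sawtooth (s - α))
      (jumpPart J L t - jumpPart J L s) :=
    (summable_jumpPart hJ t).hasSum.sub (summable_jumpPart hJ s).hasSum
  rw [h2, ← h3.tsum_eq, ← h4.tsum_eq]
  refine tsum_congr fun α => ?_
  rw [← mul_sub, sawtooth_sub_sawtooth (hL α.2) hs hst ht, Set.indicator_apply, Set.indicator_apply]
  split_ifs <;> ring

end OneVariable

/-! ### The regular part of a function with constant jumps across hyperplanes -/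

section RegularPart

variable {d : ℕ}

/-- `F` is a measurable function on the torus all of whose increments `F (x + t eᵢ) - F x` have grid
sums at most `C |t|`, on almost every translate of each grid. (The empty set of coordinates is
allowed, so `F` is in particular Lipschitz up to a null set.) -/
structure HasLipschitzIncrements (F : (Fin d → ℝ) → ℝ) (C : ℝ) : Prop where
  nonneg : 0 ≤ C
  measurable : Measurable F
  periodic : IsTorusFun F
  gridSum_le : ∀ (u : Finset (Fin d)) (n : ℕ) (p : Fin d → ℕ → ℝ) (b : Fin d → ℝ),
    IsPeriodGrid u p → ∀ (i : Fin d) (t : ℝ), ∀ᵐ y : Fin d → ℝ,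
      gridSum (fun x => F (x + Pi.single i t) - F x) u n (fun l k => p l k - y l) (b - y)
        ≤ C * |t|

lemma IsTorusFun.add_two_pi_mul {F : (Fin d → ℝ) → ℝ} (hF : IsTorusFun F) (x : Fin d → ℝ)
    (k : Fin d → ℤ) : F (fun i => x i + k i * (2 * Real.pi)) = F x := by
  have h : ∀ S : Finset (Fin d),
      F (fun i => if i ∈ S then x i + k i * (2 * Real.pi) else x i) = F x := by
    intro S
    induction S using Finset.induction_on with
    | empty => simp
    | insert i S hi ih =>
      rw [← ih]
      set z : Fin d → ℝ := fun l => if l ∈ S then x l + k l * (2 * Real.pi) else x l with hz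
      have h1 : (fun l => if l ∈ insert i S then x l + k l * (2 * Real.pi) else x l) =
          Function.update z i (x i + k i * (2 * Real.pi)) := by
        ext l
        by_cases hl : l = i
        · subst hl; simp
        · simp [hl, hz]
      have h2 : z = Function.update z i (x i) := by
        ext l
        by_cases hl : l = i
        · subst hl; simp [hz, hi]
        · simp [hl]
      rw [h1]
      conv_rhs => rw [h2]
      exact (hF i z).int_mul (k i) (x i)
  simpa using h Finset.univ

lemma IsTorusFun.comp_torusRep {F : (Fin d → ℝ) → ℝ} (hF : IsTorusFun F) (x : Fin d → ℝ) :
    F (torusRep x) = F x := by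
  rw [← hF.add_two_pi_mul (torusRep x) (fun i => toIcoDiv Real.two_pi_pos 0 (x i))]
  congr 1
  ext i
  have := toIcoMod_add_toIcoDiv_zsmul Real.two_pi_pos 0 (x i)
  rwa [zsmul_eq_mul] at this

variable {f : (Fin d → ℝ) → ℝ}

lemma IsTorusFun.lineFun_torusRep (hf : IsTorusFun f) (j : Fin d) (x : Fin d → ℝ) :
    lineFun f j (torusRep x) = lineFun f j x := by
  ext t
  unfold lineFun
  rw [← hf.comp_torusRep (Function.update x j t), torusRep_update,
    ← hf.comp_torusRep (Function.update (torusRep x) j t), torusRep_update]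
  congr 2
  ext i
  simp [torusRep]

lemma ae_of_ae_Icc_two_pi {P : ℝ → Prop}
    (h : ∀ᵐ t ∂(volume.restrict (Set.Icc 0 (2 * Real.pi))), P t) :
    ∀ᵐ r : ℝ, P (toIcoMod Real.two_pi_pos 0 r) := by
  rw [ae_restrict_iff' measurableSet_Icc] at h
  have h1 : ∀ᵐ r : ℝ, ∀ n : ℤ, r - n * (2 * Real.pi) ∈ Set.Icc 0 (2 * Real.pi) →
      P (r - n * (2 * Real.pi)) := by
    rw [ae_all_iff]
    intro n
    exact (measurePreserving_sub_right volume (n * (2 * Real.pi))).quasiMeasurePreserving.ae h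
  filter_upwards [h1] with r hr
  have h2 := hr (toIcoDiv Real.two_pi_pos 0 r)
  have h3 : r - toIcoDiv Real.two_pi_pos 0 r * (2 * Real.pi) = toIcoMod Real.two_pi_pos 0 r := by
    rw [toIcoMod, zsmul_eq_mul]
  rw [h3] at h2
  exact h2 (by simpa using Set.Ico_subset_Icc_self (toIcoMod_mem_Ico Real.two_pi_pos 0 r))

variable {j : Fin d} {g : (Fin d → ℝ) → ℝ}

/-- On every line, the periodization of the partial derivative is the derivative of `f` almost
everywhere. -/
lemma IsPartialDerivative.ae_hasDerivAt (hg : IsPartialDerivative f j g) (hf : IsTorusFun f)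
    (x : Fin d → ℝ) : ∀ᵐ r : ℝ,
      HasDerivAt (lineFun f j x) (g (torusRep (Function.update x j r))) r := by
  have h1 := ae_of_ae_Icc_two_pi (hg.hasDerivAt_ae (torusRep x))
  filter_upwards [h1] with r hr
  rw [hf.lineFun_torusRep, ← torusRep_update] at hr
  have h2 : (fun s => lineFun f j x (s - toIcoDiv Real.two_pi_pos 0 r • (2 * Real.pi))) =
      lineFun f j x := by
    ext s
    exact (hf j x).sub_zsmul_eq _
  rw [← h2]
  exact HasDerivAt.comp_sub_const r _ hr

lemma IsPartialDerivative.intervalIntegrable (hg : IsPartialDerivative f j g)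
    (hf : IsTorusFun f) {C : ℝ} (hC : ∀ x, |g (torusRep x)| ≤ C) (x : Fin d → ℝ) (s t : ℝ) :
    IntervalIntegrable (fun r => g (torusRep (Function.update x j r))) volume s t := by
  have hm : AEStronglyMeasurable (fun r => g (torusRep (Function.update x j r))) volume := by
    refine ⟨deriv (lineFun f j x), (measurable_deriv _).stronglyMeasurable, ?_⟩
    filter_upwards [hg.ae_hasDerivAt hf x] with r hr using hr.deriv.symm
  rw [intervalIntegrable_iff]
  exact Measure.integrableOn_of_bounded (M := C) (by simp) hm
    (ae_of_all _ fun r => by simpa using hC _)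

variable {J : Fin d → ℝ → ℝ}

lemma IsTorusFun.jump_two_pi (hf : IsTorusFun f) (hbv : IsBVInEachVariable f)
    (hJ : ∀ j x, jumpAt f j x = J j (x j)) (hJ0 : ∀ j, J j 0 = 0) (j : Fin d) :
    J j (2 * Real.pi) = 0 := by
  have h := hJ j (Function.update 0 j (2 * Real.pi))
  have h0 := hJ j 0
  rw [Function.update_self] at h
  rw [Pi.zero_apply, hJ0] at h0
  rw [← h, ← h0]
  unfold jumpAt
  have hl : lineFun f j (Function.update 0 j (2 * Real.pi)) = lineFun f j 0 := by
    ext t; simp [lineFun]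
  rw [hl, Function.update_self]
  have hper := hf j 0
  have h1 := hper.rightLim_add 0 (hper.tendsto_rightLim_of_boundedVariationOn (hbv j 0) 0)
  rw [zero_add] at h1
  -- the left limit at `0` is that at `2π`, where the function has bounded variation on the left
  have h2 : Function.leftLim (lineFun f j 0) 0 = Function.leftLim (lineFun f j 0) (2 * Real.pi) := by
    obtain ⟨l, hl⟩ := (hbv j 0).exists_tendsto_left (2 * Real.pi)
    have h1 : 𝓝[Set.Icc 0 (2 * Real.pi) ∩ Set.Iio (2 * Real.pi)] (2 * Real.pi) =
        𝓝[<] (2 * Real.pi) := by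
      refine nhdsWithin_inter_of_mem ?_
      filter_upwards [Ioo_mem_nhdsLT Real.two_pi_pos] with s hs
      exact ⟨hs.1.le, hs.2.le⟩
    rw [h1] at hl
    rw [leftLim_eq_of_tendsto hl]
    apply leftLim_eq_of_tendsto
    have h2 := hl.comp ((tendsto_add_const_nhdsLT 0 (2 * Real.pi)).mono_right
      (le_of_eq (by rw [zero_add])))
    exact h2.congr fun s => hper s
  simp only [Pi.zero_apply]
  rw [h1, h2]

lemma jumpSet_subset (J : Fin d → ℝ → ℝ) (j : Fin d) :
    jumpSet J j ⊆ Set.Ioo 0 (2 * Real.pi) := fun _ h => h.1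

lemma summable_jumpSet (hf : IsTorusFun f) (hbv : IsBVInEachVariable f)
    (hJ : ∀ j x, jumpAt f j x = J j (x j)) (j : Fin d) :
    Summable fun α : jumpSet J j => |J j α| := by
  refine summable_of_sum_le (fun _ => abs_nonneg _) (c := (eVariationOn (lineFun f j 0)
    (Set.Icc 0 (2 * Real.pi))).toReal) fun A => ?_
  have h := BoundedVariationOn.sum_abs_jump_le (hbv j 0) (hf j 0)
    (A.map (Function.Embedding.subtype _)) (by
      intro α hα
      simp only [Finset.mem_map, Function.Embedding.subtype_apply] at hα
      obtain ⟨β, _, rfl⟩ := hα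
      exact β.2.1)
  rw [Finset.sum_map] at h
  refine le_trans (le_of_eq (Finset.sum_congr rfl fun α _ => ?_)) h
  have h1 := hJ j (Function.update 0 j (α : ℝ))
  rw [Function.update_self] at h1
  rw [← h1, jumpAt, Function.update_self]
  have hl : lineFun f j (Function.update 0 j (α : ℝ)) = lineFun f j 0 := by
    ext t; simp [lineFun]
  rw [hl]
  rfl

lemma countable_jumpSet (h : Summable fun α : jumpSet J j => |J j α|) :
    (jumpSet J j).Countable := by
  have h1 := h.countable_support
  have h2 : Function.support (fun α : jumpSet J j => |J j α|) = Set.univ := by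
    ext α
    simpa using α.2.2
  rw [h2, Set.countable_univ_iff] at h1
  exact Set.countable_coe_iff.1 h1

/-- The drift `(2π)⁻¹ ∑ J j α` that removing the sawtooth functions adds to the derivative. -/
def jumpDrift (J : Fin d → ℝ → ℝ) (j : Fin d) : ℝ :=
  (∑' α : jumpSet J j, J j (α : ℝ)) / (2 * Real.pi)

lemma IsPartialDerivative.increment_sub_jumpPart (hg : IsPartialDerivative f j g)
    (hf : IsTorusFun f) (hbv : IsBVInEachVariable f)
    (hJ : ∀ j x, jumpAt f j x = J j (x j)) (hJ0 : ∀ j, J j 0 = 0)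
    {C : ℝ} (hC : ∀ x, |g (torusRep x)| ≤ C) (x : Fin d → ℝ) {s t : ℝ} (hs : 0 ≤ s)
    (hst : s ≤ t) (ht : t ≤ 2 * Real.pi) :
    (Function.rightLim (lineFun f j x) t - jumpPart (J j) (jumpSet J j) t) -
      (Function.rightLim (lineFun f j x) s - jumpPart (J j) (jumpSet J j) s) =
      ∫ r in s..t, (g (torusRep (Function.update x j r)) + jumpDrift J j) := by
  have h1 := hg.increment (torusRep x) s t hs hst ht
  have h2 := jumpPart_sub_jumpPart (J := J j) (jumpSet_subset J j) (summable_jumpSet hf hbv hJ j)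
    hs hst ht (fun α hα hne => by
      refine ⟨⟨hs.trans_lt hα.1, (hα.2.trans ht).lt_of_ne ?_⟩, hne⟩
      rintro rfl
      exact hne (hf.jump_two_pi hbv hJ hJ0 j))
  rw [hf.lineFun_torusRep] at h1
  have h3 : ∀ α : Set.Ioc s t, jumpAt f j (Function.update (torusRep x) j (α : ℝ)) =
      J j (α : ℝ) := by
    intro α
    rw [hJ, Function.update_self]
  simp only [h3] at h1
  have h4 : ∫ r in s..t, g (Function.update (torusRep x) j r) =
      ∫ r in s..t, g (torusRep (Function.update x j r)) := by
    refine intervalIntegral.integral_congr_ae ?_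
    have : ∀ᵐ r : ℝ, r ≠ 2 * Real.pi := by simp [ae_iff]
    filter_upwards [this] with r hr hrI
    rw [Set.uIoc_of_le hst] at hrI
    rw [torusRep_update, (toIcoMod_eq_self Real.two_pi_pos).2]
    rw [zero_add]
    exact ⟨(hs.trans_lt hrI.1).le, (hrI.2.trans ht).lt_of_ne hr⟩
  rw [intervalIntegral.integral_add (hg.intervalIntegrable hf hC x s t)
    intervalIntegrable_const, intervalIntegral.integral_const, ← h4, jumpDrift,
    smul_eq_mul]
  linarith

/-- The increment formula holds on the whole line: a periodic function minus its integral is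
constant as soon as it is constant on one closed period. -/
lemma IsPartialDerivative.increment_real (hg : IsPartialDerivative f j g)
    (hf : IsTorusFun f) (hbv : IsBVInEachVariable f)
    (hJ : ∀ j x, jumpAt f j x = J j (x j)) (hJ0 : ∀ j, J j 0 = 0)
    {C : ℝ} (hC : ∀ x, |g (torusRep x)| ≤ C) (x : Fin d → ℝ) (s t : ℝ) :
    (Function.rightLim (lineFun f j x) t - jumpPart (J j) (jumpSet J j) t) -
      (Function.rightLim (lineFun f j x) s - jumpPart (J j) (jumpSet J j) s) =
      ∫ r in s..t, (g (torusRep (Function.update x j r)) + jumpDrift J j) := by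
  set q : ℝ → ℝ := fun t => Function.rightLim (lineFun f j x) t -
    jumpPart (J j) (jumpSet J j) t with hq
  set G : ℝ → ℝ := fun r => g (torusRep (Function.update x j r)) + jumpDrift J j with hG
  have hGi : ∀ a b, IntervalIntegrable G volume a b := fun a b =>
    (hg.intervalIntegrable hf hC x a b).add intervalIntegrable_const
  have hGper : Function.Periodic G (2 * Real.pi) := by
    intro r
    simp only [hG, torusRep_update]
    rw [toIcoMod_add_right]
  have hqper : Function.Periodic q (2 * Real.pi) := by
    intro r
    simp only [hq]
    rw [jumpPart_periodic, (hf j x).rightLim_add r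
      ((hf j x).tendsto_rightLim_of_boundedVariationOn (hbv j x) r)]
  have hinc : ∀ {s t : ℝ}, 0 ≤ s → s ≤ t → t ≤ 2 * Real.pi → q t - q s = ∫ r in s..t, G r :=
    fun h1 h2 h3 => hg.increment_sub_jumpPart hf hbv hJ hJ0 hC x h1 h2 h3
  have hint0 : ∫ r in (0 : ℝ)..(2 * Real.pi), G r = 0 := by
    rw [← hinc le_rfl Real.two_pi_pos.le le_rfl]
    have := hqper 0
    rw [zero_add] at this
    rw [this, sub_self]
  set Φ : ℝ → ℝ := fun t => q t - ∫ r in (0 : ℝ)..t, G r with hΦ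
  have hΦper : Function.Periodic Φ (2 * Real.pi) := by
    intro r
    simp only [hΦ]
    rw [hqper, ← intervalIntegral.integral_add_adjacent_intervals (hGi 0 r)
      (hGi r (r + 2 * Real.pi)), hGper.intervalIntegral_add_eq r 0, zero_add, hint0, add_zero]
  have hΦc : ∀ t, Φ t = Φ 0 := by
    intro t
    have hI : toIcoMod Real.two_pi_pos 0 t ∈ Set.Ico 0 (2 * Real.pi) := by
      simpa using toIcoMod_mem_Ico Real.two_pi_pos 0 t
    have h1 : Φ (toIcoMod Real.two_pi_pos 0 t) = Φ t := by
      rw [toIcoMod]; exact hΦper.sub_zsmul_eq _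
    rw [← h1]
    have := hinc le_rfl hI.1 hI.2.le
    simp only [hΦ, intervalIntegral.integral_same]
    linarith
  have h1 := hΦc t
  have h2 := hΦc s
  simp only [hΦ, intervalIntegral.integral_same] at h1 h2
  rw [← intervalIntegral.integral_interval_sub_left (hGi 0 t) (hGi 0 s)]
  change q t - q s = _
  linarith

/-- The right limit of `f` at `x` in the direction of the `j`-th axis. -/
def rightLimAlong (f : (Fin d → ℝ) → ℝ) (j : Fin d) (x : Fin d → ℝ) : ℝ :=
  Function.rightLim (lineFun f j x) (x j)

/-- A torus function of bounded variation in each variable that is continuous almost everywhere on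
each line agrees almost everywhere with its right limits in the direction `j`. -/
lemma ae_eq_rightLim (hfm : Measurable f) (hf : IsTorusFun f) (hbv : IsBVInEachVariable f)
    (hc : ∀ x, ∀ᵐ r : ℝ, ContinuousAt (lineFun f j x) r) :
    ∀ᵐ x : Fin d → ℝ, rightLimAlong f j x = f x := by
  set R : (Fin d → ℝ) → ℝ := rightLimAlong f j with hR
  have hRm : Measurable R := by
    refine measurable_of_tendsto_metrizable
      (f := fun (n : ℕ) x => f (Function.update x j (x j + 1 / ((n : ℝ) + 1)))) (fun n => ?_) ?_
    · refine hfm.comp ?_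
      have : Measurable fun p : (Fin d → ℝ) × ℝ => Function.update p.1 j p.2 := measurable_update'
      exact this.comp (measurable_id.prodMk ((measurable_pi_apply j).add_const _))
    · refine tendsto_pi_nhds.2 fun x => ?_
      have h1 := (hf j x).tendsto_rightLim_of_boundedVariationOn (hbv j x) (x j)
      refine h1.comp (tendsto_nhdsWithin_iff.2 ⟨?_, Eventually.of_forall fun n => ?_⟩)
      · simpa using (tendsto_one_div_add_atTop_nhds_zero_nat (𝕜 := ℝ)).const_add (x j)
      · have : (0 : ℝ) < 1 / ((n : ℝ) + 1) := by positivity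
        simpa using this
  have hline : ∀ (x : Fin d → ℝ) (t : ℝ), x + Pi.single j t = Function.update x j (x j + t) := by
    intro x t
    ext l
    by_cases hl : l = j
    · subst hl; simp
    · simp [hl]
  have hmeas : MeasurableSet {q : (Fin d → ℝ) × ℝ |
      R (q.1 + Pi.single j q.2) = f (q.1 + Pi.single j q.2)} := by
    have hs : Measurable fun q : (Fin d → ℝ) × ℝ => q.1 + Pi.single j q.2 := by
      refine measurable_fst.add (measurable_pi_lambda _ fun l => ?_)
      by_cases hl : l = j
      · subst hl; simpa using measurable_snd
      · simp [hl]
    exact measurableSet_eq_fun (hRm.comp hs) (hfm.comp hs)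
  have h1 : ∀ x : Fin d → ℝ, ∀ᵐ t : ℝ, R (x + Pi.single j t) = f (x + Pi.single j t) := by
    intro x
    have h2 := (measurePreserving_add_left volume (x j)).quasiMeasurePreserving.ae (hc x)
    filter_upwards [h2] with t ht
    have h3 : Function.rightLim (lineFun f j x) (x j + t) = lineFun f j x (x j + t) :=
      ContinuousWithinAt.rightLim_eq ht.continuousWithinAt
    rw [hline]
    have hl : lineFun f j (Function.update x j (x j + t)) = lineFun f j x := by
      ext r; simp [lineFun]
    simp only [hR, rightLimAlong, hl, Function.update_self]
    rw [h3]
    rfl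
  have h2 := (Measure.ae_ae_comm (μ := (volume : Measure (Fin d → ℝ)))
    (ν := (volume : Measure ℝ)) hmeas).1 (ae_of_all _ h1)
  obtain ⟨t, ht⟩ := h2.exists
  have h3 := (measurePreserving_sub_right volume
    (Pi.single j t : Fin d → ℝ)).quasiMeasurePreserving.ae ht
  filter_upwards [h3] with x hx
  simpa using hx

/-- The regular part of `f`: what is left when the sawtooth functions carrying the jumps are
subtracted. -/
def regularPart (f : (Fin d → ℝ) → ℝ) (J : Fin d → ℝ → ℝ) (x : Fin d → ℝ) : ℝ :=
  f x - ∑ k, jumpPart (J k) (jumpSet J k) (x k)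

/-- For almost every translate of a grid, all its points are points where `f` is right continuous
in every direction. Between such points, the increments of the regular part along an axis are
integrals of the periodized partial derivative plus the drift, so that their grid sums are bounded
by Minkowski's inequality. -/
theorem exists_hasLipschitzIncrements_regularPart (hfm : Measurable f) (hf : IsTorusFun f)
    (hbv : IsBVInEachVariable f) {g : Fin d → (Fin d → ℝ) → ℝ}
    (hg : ∀ j, IsPartialDerivative f j (g j) ∧
      hardyKrauseVariation (g j) (fun _ => 0) (fun _ => 2 * Real.pi) ≠ ⊤)
    (hJ : ∀ j x, jumpAt f j x = J j (x j)) (hJ0 : ∀ j, J j 0 = 0) :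
    ∃ C, HasLipschitzIncrements (regularPart f J) C := by
  have hsum := summable_jumpSet hf hbv hJ
  choose c hc0 hc using fun j => exists_gridSum_torusRep_le (hg j).2
  have hcx : ∀ j x, |g j (torusRep x)| ≤ c j := by
    intro j x
    have := hc j ∅ 0 (fun _ _ => 0) x (by simp [IsPeriodGrid])
    simpa using this
  set G : Fin d → (Fin d → ℝ) → ℝ := fun j x => g j (torusRep x) + jumpDrift J j with hG
  have hGgrid : ∀ j u n p b, IsPeriodGrid u p →
      gridSum (G j) u n p b ≤ ∑ j, (c j + |jumpDrift J j|) := by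
    intro j u n p b hp
    refine (gridSum_add_le _ _ _ _ _ _).trans ((add_le_add (hc j u n p b hp)
      (gridSum_const_le _ _ _ _ _)).trans ?_)
    exact Finset.single_le_sum (f := fun j => c j + |jumpDrift J j|)
      (fun i _ => add_nonneg (hc0 i) (abs_nonneg _)) (Finset.mem_univ j)
  have hGint : ∀ j x s t, IntervalIntegrable (fun r => G j (Function.update x j r)) volume s t :=
    fun j x s t => ((hg j).1.intervalIntegrable hf (hcx j) x s t).add
      intervalIntegrable_const
  have hgood : ∀ᵐ x : Fin d → ℝ, ∀ j, rightLimAlong f j x = f x := by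
    rw [ae_all_iff]
    intro j
    refine ae_eq_rightLim hfm hf hbv fun x => ?_
    filter_upwards [(hg j).1.ae_hasDerivAt hf x] with r hr using hr.continuousAt
  have hsingle : ∀ (i : Fin d) (x : Fin d → ℝ) (t : ℝ),
      x + Pi.single i t = Function.update x i (x i + t) := by
    intro i x t
    ext l
    by_cases hl : l = i
    · subst hl; simp
    · simp [hl]
  -- between points where `f` is right continuous, the increments are integrals of `G`
  have hincr : ∀ (i : Fin d) (t : ℝ) (x : Fin d → ℝ),
      (∀ j, rightLimAlong f j x = f x) →
      (∀ j, rightLimAlong f j (x + Pi.single i t) = f (x + Pi.single i t)) →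
      regularPart f J (x + Pi.single i t) - regularPart f J x =
        ∫ r in (0 : ℝ)..t, G i (x + Pi.single i r) := by
    intro i t x h1 h2
    have h3 := (hg i).1.increment_real hf hbv hJ hJ0 (hcx i) x (x i) (x i + t)
    have hl : lineFun f i (x + Pi.single i t) = lineFun f i x := by
      rw [hsingle]; ext r; simp [lineFun]
    have h2' := h2 i
    have h5 : (x + Pi.single i t : Fin d → ℝ) i = x i + t := by simp
    have h1' := h1 i
    rw [rightLimAlong] at h1'
    rw [rightLimAlong, hl, h5] at h2'
    rw [h1', h2'] at h3
    have h4 : ∫ r in (0 : ℝ)..t, G i (x + Pi.single i r) =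
        ∫ r in (x i)..(x i + t), G i (Function.update x i r) := by
      simp only [hsingle]
      rw [intervalIntegral.integral_comp_add_left (fun r => G i (Function.update x i r)) (x i),
        add_zero]
    rw [h4]
    simp only [hG]
    rw [← h3]
    have h6 : ∑ k, jumpPart (J k) (jumpSet J k) ((x + Pi.single i t : Fin d → ℝ) k) -
        ∑ k, jumpPart (J k) (jumpSet J k) (x k) =
        jumpPart (J i) (jumpSet J i) (x i + t) - jumpPart (J i) (jumpSet J i) (x i) := by
      rw [← Finset.sum_sub_distrib, Finset.sum_eq_single i]
      · rw [h5]
      · intro k _ hk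
        simp [hk]
      · simp
    simp only [regularPart]
    linarith
  refine ⟨∑ j, (c j + |jumpDrift J j|),
    Finset.sum_nonneg fun j _ => add_nonneg (hc0 j) (abs_nonneg _), ?_, ?_, ?_⟩
  · refine hfm.sub (Finset.measurable_fun_sum _ fun k _ => ?_)
    exact (measurable_jumpPart (countable_jumpSet (hsum k)) (hsum k)).comp (measurable_pi_apply k)
  · intro i x t
    simp only [lineFun, regularPart]
    congr 1
    · exact hf i x t
    · refine Finset.sum_congr rfl fun k _ => ?_
      by_cases hk : k = i
      · subst hk
        simpa using jumpPart_periodic t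
      · simp [hk]
  · intro u n p b hp i t
    -- the relevant points form a countable family, each avoiding a null set for almost every `y`
    have hpts : ∀ᵐ y : Fin d → ℝ, ∀ σ : Fin d → ℕ,
        (∀ j, rightLimAlong f j ((fun l => if l ∈ u then p l (σ l) else b l) - y) =
          f ((fun l => if l ∈ u then p l (σ l) else b l) - y)) ∧
        (∀ j, rightLimAlong f j
          (((fun l => if l ∈ u then p l (σ l) else b l) + Pi.single i t) - y) =
          f (((fun l => if l ∈ u then p l (σ l) else b l) + Pi.single i t) - y)) := by
      rw [ae_all_iff]
      intro σ
      have hq := fun c : Fin d → ℝ =>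
        (Measure.measurePreserving_sub_left volume c).quasiMeasurePreserving.ae hgood
      filter_upwards [hq (fun l => if l ∈ u then p l (σ l) else b l),
        hq ((fun l => if l ∈ u then p l (σ l) else b l) + Pi.single i t)] with y h1 h2
      exact ⟨h1, h2⟩
    filter_upwards [hpts] with y hy
    have h1 : gridSum (fun x => regularPart f J (x + Pi.single i t) - regularPart f J x) u n
        (fun l k => p l k - y l) (b - y) =
        gridSum (fun x => ∫ r in (0 : ℝ)..t, G i (x + Pi.single i r)) u n
        (fun l k => p l k - y l) (b - y) := by
      refine gridSum_congr fun σ => ?_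
      have h2 : (fun l => if l ∈ u then p l (σ l) - y l else (b - y) l) =
          (fun l => if l ∈ u then p l (σ l) else b l) - y := by
        ext l
        by_cases hl : l ∈ u <;> simp [hl]
      rw [h2]
      refine hincr i t _ (hy σ).1 ?_
      have h3 := (hy σ).2
      rwa [add_sub_right_comm] at h3
    rw [h1]
    simp only [intervalIntegral.intervalIntegral_eq_integral_uIoc]
    rw [gridSum_smul]
    have h2 : ‖(if (0 : ℝ) ≤ t then (1 : ℝ) else -1)‖ = 1 := by split_ifs <;> simp
    rw [h2, one_mul]
    have h3 : ∫ _ in Set.uIoc 0 t, (∑ j, (c j + |jumpDrift J j|)) =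
        (∑ j, (c j + |jumpDrift J j|)) * |t| := by
      rw [setIntegral_const, smul_eq_mul, mul_comm, Measure.real, Real.volume_uIoc,
        ENNReal.toReal_ofReal (abs_nonneg _), sub_zero]
    rw [← h3]
    refine gridSum_integral_le (fun x => ?_) u n _ _ ?_ ?_
    · have := hGint i x (x i + 0) (x i + t)
      have h5 := this.comp_add_left (c := x i)
      simp only [add_sub_cancel_left] at h5
      rw [intervalIntegrable_iff] at h5
      refine h5.congr_fun_ae (ae_of_all _ fun r => ?_)
      simp only [hsingle]
    · exact integrableOn_const (by simp)
    · refine ae_of_all _ fun r => ?_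
      rw [gridSum_comp_add]
      refine hGgrid i u n _ _ fun l hl => ⟨fun a b hab => ?_, fun k => ?_⟩
      · have := (hp l hl).1 hab
        simp only
        linarith
      · have := (hp l hl).2 k
        linarith

end RegularPart

/-! ### Consequences of Lipschitz increments -/

section LipschitzIncrements

variable {d : ℕ} {F : (Fin d → ℝ) → ℝ} {C : ℝ}

lemma add_pi_single (x : Fin d → ℝ) (i : Fin d) (t : ℝ) :
    x + Pi.single i t = Function.update x i (x i + t) := by
  ext l
  by_cases hl : l = i
  · subst hl; simp
  · simp [hl]

/-- One of the coordinates of the grid is used for the increments, whose steps add up to at most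
one period. -/
lemma HasLipschitzIncrements.ae_gridSum_le (hF : HasLipschitzIncrements F C)
    {u : Finset (Fin d)} (hu : u.Nonempty) (n : ℕ) (p : Fin d → ℕ → ℝ) (b : Fin d → ℝ)
    (hp : IsPeriodGrid u p) :
    ∀ᵐ y : Fin d → ℝ, gridSum F u n (fun l k => p l k - y l) (b - y) ≤ C * (2 * Real.pi) := by
  obtain ⟨i, hi⟩ := hu
  obtain ⟨w, hw, rfl⟩ : ∃ w, i ∉ w ∧ u = insert i w :=
    ⟨u.erase i, Finset.notMem_erase i u, (Finset.insert_erase hi).symm⟩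
  have hpw : IsPeriodGrid w p := fun l hl => hp l (by simp [hl])
  have h1 : ∀ᵐ y : Fin d → ℝ, ∀ t : ℕ,
      gridSum (fun x => F (x + Pi.single i (p i (t + 1) - p i t)) - F x) w n
        (fun l k => p l k - y l) (Function.update b i (p i t) - y) ≤
        C * |p i (t + 1) - p i t| := by
    rw [ae_all_iff]
    intro t
    exact hF.gridSum_le w n p _ hpw i _
  filter_upwards [h1] with y hy
  rw [gridSum_insert F hw]
  have h2 : ∀ t ∈ Finset.range n,
      gridSum (fun x => F (Function.update x i (p i (t + 1) - y i)) -
        F (Function.update x i (p i t - y i))) w n (fun l k => p l k - y l) (b - y) ≤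
      C * (p i (t + 1) - p i t) := by
    intro t _
    have h3 := hy t
    rw [abs_of_nonneg (sub_nonneg.2 ((hp i (by simp)).1 (Nat.le_succ t)))] at h3
    refine le_trans (le_of_eq (gridSum_congr fun σ => ?_)) h3
    have e1 : ∀ r, Function.update (fun l => if l ∈ w then p l (σ l) - y l else (b - y) l) i r =
        Function.update (fun l => if l ∈ w then p l (σ l) - y l else
          (Function.update b i (p i t) - y) l) i r := by
      intro r
      ext l
      by_cases hl : l = i
      · subst hl; simp
      · simp [hl]
    have e2 : ∀ z : Fin d → ℝ, z i = p i t - y i →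
        F (Function.update z i (p i (t + 1) - y i)) - F (Function.update z i (p i t - y i)) =
          F (z + Pi.single i (p i (t + 1) - p i t)) - F z := by
      intro z hz
      rw [add_pi_single, ← hz, Function.update_eq_self, hz]
      congr 3
      ring
    rw [e1, e1]
    exact e2 _ (by simp [hw])
  refine (Finset.sum_le_sum h2).trans ?_
  rw [← Finset.mul_sum, Finset.sum_range_sub]
  exact mul_le_mul_of_nonneg_left (by linarith [(hp i (by simp)).2 n]) hF.nonneg

/-- A translation by `τ` is composed of translations along the axes, one coordinate at a time. -/
lemma HasLipschitzIncrements.ae_gridSum_translate_sub_le (hF : HasLipschitzIncrements F C)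
    (u : Finset (Fin d)) (n : ℕ) (p : Fin d → ℕ → ℝ) (b : Fin d → ℝ)
    (hp : IsPeriodGrid u p) (τ : Fin d → ℝ) :
    ∀ᵐ y : Fin d → ℝ, gridSum (fun x => F (x + τ) - F x) u n (fun l k => p l k - y l) (b - y) ≤
      C * ∑ i, |τ i| := by
  have h : ∀ S : Finset (Fin d), ∀ᵐ y : Fin d → ℝ,
      gridSum (fun x => F (x + fun i => if i ∈ S then τ i else 0) - F x) u n
        (fun l k => p l k - y l) (b - y) ≤ C * ∑ i ∈ S, |τ i| := by
    intro S
    induction S using Finset.induction_on with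
    | empty =>
      refine ae_of_all _ fun y => ?_
      have : (fun x => F (x + fun i => if i ∈ (∅ : Finset (Fin d)) then τ i else 0) - F x) =
          fun _ => 0 := by
        ext x
        have h0 : (x + fun i => if i ∈ (∅ : Finset (Fin d)) then τ i else 0) = x := by
          ext i; simp
        rw [h0, sub_self]
      rw [this]
      refine (gridSum_const_le _ _ _ _ _).trans ?_
      simp
    | insert i S hi ih =>
      set τ' : Fin d → ℝ := fun i => if i ∈ S then τ i else 0 with hτ'
      have h1 := hF.gridSum_le u n (fun l k => p l k + τ' l) (b + τ')
        (fun l hl => ⟨fun a c hac => by have := (hp l hl).1 hac; simp only; linarith,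
          fun k => by have := (hp l hl).2 k; linarith⟩) i (τ i)
      filter_upwards [ih, h1] with y hy1 hy2
      have e1 : (fun x => F (x + fun l => if l ∈ insert i S then τ l else 0) - F x) =
          fun x => (F (x + τ' + Pi.single i (τ i)) - F (x + τ')) + (F (x + τ') - F x) := by
        ext x
        have : (x + fun l => if l ∈ insert i S then τ l else 0) = x + τ' + Pi.single i (τ i) := by
          ext l
          by_cases hl : l = i
          · subst hl; simp [hτ', hi]
          · simp [hτ', hl]
        rw [this]
        ring
      rw [e1]
      refine (gridSum_add_le _ _ _ _ _ _).trans ?_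
      rw [Finset.sum_insert hi, mul_add]
      refine add_le_add ?_ hy1
      rw [gridSum_comp_add (fun x => F (x + (Pi.single i (τ i) : Fin d → ℝ)) - F x) u n _ _ τ']
      refine le_trans (le_of_eq (gridSum_congr fun σ => ?_)) hy2
      have : (fun l => if l ∈ u then p l (σ l) - y l + τ' l else (b - y + τ') l) =
          fun l => if l ∈ u then p l (σ l) + τ' l - y l else (b + τ' - y) l := by
        ext l
        by_cases hl : l ∈ u
        · simp only [hl, if_true]; ring
        · simp only [hl, if_false, Pi.add_apply, Pi.sub_apply]; ring
      rw [this]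
  simpa using h Finset.univ

/-- By Fubini's theorem, a function that changes by a bounded amount under each translation, up to
null sets, is essentially bounded on bounded sets. -/
lemma HasLipschitzIncrements.ae_abs_le (hF : HasLipschitzIncrements F C) :
    ∃ A : ℝ, ∀ᵐ x : Fin d → ℝ, |F x| ≤ A + C * ∑ i, |x i| := by
  have h1 : ∀ τ : Fin d → ℝ, ∀ᵐ x : Fin d → ℝ, |F (x + τ) - F x| ≤ C * ∑ i, |τ i| := by
    intro τ
    have h2 := hF.ae_gridSum_translate_sub_le ∅ 0 (fun _ _ => 0) 0 (by simp [IsPeriodGrid]) τ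
    have h3 := (Measure.measurePreserving_neg
      (volume : Measure (Fin d → ℝ))).quasiMeasurePreserving.ae h2
    filter_upwards [h3] with x hx
    simpa using hx
  have hmeas : MeasurableSet {q : (Fin d → ℝ) × (Fin d → ℝ) |
      |F (q.2 + q.1) - F q.2| ≤ C * ∑ i, |q.1 i|} := by
    refine measurableSet_le ?_ ?_
    · have h1 : Measurable fun q : (Fin d → ℝ) × (Fin d → ℝ) => F (q.2 + q.1) - F q.2 :=
        (hF.measurable.comp (measurable_snd.add measurable_fst)).sub
          (hF.measurable.comp measurable_snd)
      exact h1.abs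
    · fun_prop
  have h2 := (Measure.ae_ae_comm (μ := (volume : Measure (Fin d → ℝ)))
    (ν := (volume : Measure (Fin d → ℝ))) hmeas).1 (ae_of_all _ h1)
  obtain ⟨x, hx⟩ := h2.exists
  refine ⟨|F x| + C * ∑ i, |x i|, ?_⟩
  have h3 := (measurePreserving_sub_right volume x).quasiMeasurePreserving.ae hx
  filter_upwards [h3] with z hz
  have h4 : x + (z - x) = z := by abel
  rw [h4] at hz
  have h5 : ∑ i, |(z - x) i| ≤ ∑ i, |z i| + ∑ i, |x i| := by
    rw [← Finset.sum_add_distrib]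
    exact Finset.sum_le_sum fun i _ => abs_sub _ _
  have h6 := mul_le_mul_of_nonneg_left h5 hF.nonneg
  have h7 := abs_sub_abs_le_abs_sub (F z) (F x)
  linarith

end LipschitzIncrements

/-! ### Integration over a period and Fourier coefficients -/

section Torus

variable {d : ℕ}

/-- The period box `[0, 2π]^d`. -/
def periodBox (d : ℕ) : Set (Fin d → ℝ) :=
  Set.Icc (fun _ : Fin d => (0 : ℝ)) (fun _ => 2 * Real.pi)

lemma periodBox_eq_pi (d : ℕ) :
    periodBox d = Set.univ.pi fun _ : Fin d => Set.Icc (0 : ℝ) (2 * Real.pi) := by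
  rw [periodBox, Set.pi_univ_Icc]

lemma restrict_periodBox (d : ℕ) : (volume : Measure (Fin d → ℝ)).restrict (periodBox d) =
    Measure.pi fun _ : Fin d => (volume : Measure ℝ).restrict (Set.Icc 0 (2 * Real.pi)) := by
  rw [periodBox_eq_pi, volume_pi, Measure.restrict_pi_pi]

lemma measurableSet_periodBox (d : ℕ) : MeasurableSet (periodBox d) := measurableSet_Icc

instance : IsFiniteMeasure ((volume : Measure (Fin d → ℝ)).restrict (periodBox d)) :=
  ⟨by rw [Measure.restrict_apply_univ]; exact isCompact_Icc.measure_lt_top⟩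

/-- A function on `ℝ^d` that is `2π`-periodic in each variable. -/
def IsPeriodic {E : Type*} (H : (Fin d → ℝ) → E) : Prop :=
  ∀ (x : Fin d → ℝ) (k : Fin d → ℤ), H (fun i => x i + k i * (2 * Real.pi)) = H x

local instance : Fact (0 < 2 * Real.pi) := ⟨Real.two_pi_pos⟩

/-- Invariance of the integral over a period box under translations and reflections; it is
transported from the Haar measure of the torus. -/
lemma IsPeriodic.integral_sub_left {E : Type*} [NormedAddCommGroup E] [NormedSpace ℝ E]
    [MeasurableSpace E] [BorelSpace E] [SecondCountableTopology E] {H : (Fin d → ℝ) → E}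
    (hper : IsPeriodic H)
    (hm : Measurable H) (x : Fin d → ℝ) :
    ∫ y in periodBox d, H (x - y) = ∫ y in periodBox d, H y := by
  set q : (Fin d → ℝ) → (Fin d → AddCircle (2 * Real.pi)) := fun y i => (y i : AddCircle _) with hq
  set rep : (Fin d → AddCircle (2 * Real.pi)) → (Fin d → ℝ) :=
    fun z i => (AddCircle.measurableEquivIoc (2 * Real.pi) 0 (z i) : ℝ) with hrep
  have hrepm : Measurable rep := by
    refine measurable_pi_lambda _ fun i => ?_
    exact measurable_subtype_coe.comp ((AddCircle.measurableEquivIoc _ 0).measurable.comp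
      (measurable_pi_apply i))
  have hHrep : ∀ y, H (rep (q y)) = H y := by
    intro y
    have h1 : ∀ i, ∃ k : ℤ, rep (q y) i = y i + k * (2 * Real.pi) := by
      intro i
      refine ⟨-toIocDiv Real.two_pi_pos 0 (y i), ?_⟩
      have h2 : rep (q y) i = toIocMod Real.two_pi_pos 0 (y i) := rfl
      rw [h2, toIocMod, zsmul_eq_mul]
      push_cast
      ring
    choose k hk using h1
    have h3 : rep (q y) = fun i => y i + k i * (2 * Real.pi) := funext hk
    rw [h3, hper]
  have hmp : MeasurePreserving q ((volume : Measure (Fin d → ℝ)).restrict (periodBox d))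
      (Measure.pi fun _ => volume) := by
    have h1 := measurePreserving_pi (fun _ : Fin d => (volume : Measure ℝ).restrict
      (Set.Ioc 0 (0 + 2 * Real.pi))) (fun _ => volume)
      (fun _ => AddCircle.measurePreserving_mk (2 * Real.pi) 0)
    have h2 : (volume : Measure ℝ).restrict (Set.Ioc 0 (0 + 2 * Real.pi)) =
        (volume : Measure ℝ).restrict (Set.Icc 0 (2 * Real.pi)) := by
      rw [zero_add]
      exact Measure.restrict_congr_set Ioc_ae_eq_Icc
    rw [h2, ← restrict_periodBox] at h1
    exact h1
  have hint : ∀ G : (Fin d → AddCircle (2 * Real.pi)) → E, Measurable G →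
      ∫ y in periodBox d, G (q y) = ∫ z, G z ∂(Measure.pi fun _ => volume) := by
    intro G hG
    rw [← hmp.map_eq, integral_map hmp.measurable.aemeasurable
      hG.stronglyMeasurable.aestronglyMeasurable]
  have hGm : Measurable fun z => H (rep z) := hm.comp hrepm
  have e1 : ∫ y in periodBox d, H y = ∫ z, H (rep z) ∂(Measure.pi fun _ => volume) := by
    rw [← hint _ hGm]
    simp only [hHrep]
  have e2 : ∫ y in periodBox d, H (x - y) =
      ∫ z, H (rep (q x - z)) ∂(Measure.pi fun _ => volume) := by
    rw [← hint (fun z => H (rep (q x - z))) 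
      (hGm.comp (measurable_id.const_sub (q x)))]
    refine integral_congr_ae (ae_of_all _ fun y => ?_)
    have : q x - q y = q (x - y) := by
      ext i; simp [hq]
    simp only [this, hHrep]
  rw [e1, e2]
  have : Measure.IsNegInvariant (volume : Measure (AddCircle (2 * Real.pi))) := inferInstance
  exact integral_sub_left_eq_self (fun z => H (rep z)) _ _

lemma IsPeriodic.integral_add_right {E : Type*} [NormedAddCommGroup E] [NormedSpace ℝ E]
    [MeasurableSpace E] [BorelSpace E] [SecondCountableTopology E] {H : (Fin d → ℝ) → E}
    (hper : IsPeriodic H) (hm : Measurable H) (τ : Fin d → ℝ) :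
    ∫ y in periodBox d, H (y + τ) = ∫ y in periodBox d, H y := by
  have hper' : IsPeriodic fun y => H (-y) := by
    intro x k
    have := hper (-x) (-k)
    simp only
    rw [← this]
    congr 1
    ext i
    simp only [Pi.neg_apply, Int.cast_neg]
    ring
  have h1 := hper'.integral_sub_left (hm.comp measurable_neg) (-τ)
  have h2 := hper.integral_sub_left hm 0
  simp only [zero_sub] at h2
  rw [← h2, ← h1]
  congr 1
  ext y
  congr 1
  abel

@[simp] lemma norm_character (ν : Fin d → ℤ) (x : Fin d → ℝ) : ‖character ν x‖ = 1 := by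
  rw [character, mul_comm]
  exact Complex.norm_exp_ofReal_mul_I _

lemma character_add (ν : Fin d → ℤ) (x y : Fin d → ℝ) :
    character ν (x + y) = character ν x * character ν y := by
  rw [character, character, character, ← Complex.exp_add, ← mul_add, ← Complex.ofReal_add,
    ← Finset.sum_add_distrib]
  simp [mul_add]

lemma character_neg_left (ν : Fin d → ℤ) (x : Fin d → ℝ) : character (-ν) x = character ν (-x) := by
  simp [character]

lemma character_eq_prod (ν : Fin d → ℤ) (x : Fin d → ℝ) :
    character ν x = ∏ k, Complex.exp (Complex.I * ((ν k * x k : ℝ) : ℂ)) := by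
  rw [← Complex.exp_sum, character, Complex.ofReal_sum, Finset.mul_sum]

lemma character_isPeriodic (ν : Fin d → ℤ) : IsPeriodic (character ν) := by
  intro x k
  rw [character_eq_prod, character_eq_prod]
  refine Finset.prod_congr rfl fun i _ => ?_
  rw [Complex.exp_eq_exp_iff_exists_int]
  refine ⟨ν i * k i, ?_⟩
  push_cast
  ring

lemma continuous_character (ν : Fin d → ℤ) : Continuous (character ν) := by
  unfold character
  fun_prop

/-- The functions whose Fourier analysis is needed: measurable, periodic and integrable over a
period box and all its translates. -/
structure IsIntegrableTorusFun (F : (Fin d → ℝ) → ℝ) : Prop where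
  measurable : Measurable F
  periodic : IsPeriodic F
  integrableOn : IntegrableOn F (periodBox d)
  integrable_sub_left : ∀ x : Fin d → ℝ, IntegrableOn (fun y => F (x - y)) (periodBox d)

lemma IsIntegrableTorusFun.of_ae_le {F : (Fin d → ℝ) → ℝ} (hm : Measurable F)
    (hper : IsPeriodic F) {A C : ℝ} (h : ∀ᵐ x : Fin d → ℝ, |F x| ≤ A + C * ∑ i, |x i|) :
    IsIntegrableTorusFun F := by
  refine ⟨hm, hper, ?_, fun x => ?_⟩
  · have h2 : IntegrableOn (fun y : Fin d → ℝ => A + C * ∑ i, |y i|) (periodBox d) :=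
      Continuous.integrableOn_Icc (by fun_prop)
    exact Integrable.mono' h2 hm.aestronglyMeasurable (ae_restrict_of_ae h)
  have h1 := (Measure.measurePreserving_sub_left volume x).quasiMeasurePreserving.ae h
  have h2 : IntegrableOn (fun y : Fin d → ℝ => A + C * ∑ i, |(x - y) i|) (periodBox d) := by
    refine Continuous.integrableOn_Icc ?_
    simp only [Pi.sub_apply]
    fun_prop
  refine Integrable.mono' h2 ?_ ?_
  · exact (hm.comp (measurable_id.const_sub x)).aestronglyMeasurable
  · exact ae_restrict_of_ae h1

end Torus

/-! ### Convolution with product kernels -/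

section Convolution

variable {d : ℕ}

lemma IsTorusFun.isPeriodic {F : (Fin d → ℝ) → ℝ} (hF : IsTorusFun F) : IsPeriodic F :=
  hF.add_two_pi_mul

lemma IsPeriodic.translate {E : Type*} {H : (Fin d → ℝ) → E} (hH : IsPeriodic H) (τ : Fin d → ℝ) :
    IsPeriodic fun x => H (x + τ) := by
  intro x k
  have := hH (x + τ) k
  simp only
  rw [← this]
  congr 1
  ext i
  simp only [Pi.add_apply]
  ring

lemma IsIntegrableTorusFun.sub {F G : (Fin d → ℝ) → ℝ} (hF : IsIntegrableTorusFun F)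
    (hG : IsIntegrableTorusFun G) : IsIntegrableTorusFun fun x => F x - G x :=
  ⟨hF.measurable.sub hG.measurable, fun x k => by simp only [hF.periodic x k, hG.periodic x k],
    hF.integrableOn.sub hG.integrableOn,
    fun x => (hF.integrable_sub_left x).sub (hG.integrable_sub_left x)⟩

lemma HasLipschitzIncrements.isIntegrable_translate {F : (Fin d → ℝ) → ℝ} {C : ℝ}
    (hF : HasLipschitzIncrements F C) (τ : Fin d → ℝ) :
    IsIntegrableTorusFun fun x => F (x + τ) := by
  obtain ⟨A, hA⟩ := hF.ae_abs_le
  have h1 := (measurePreserving_add_right volume τ).quasiMeasurePreserving.ae hA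
  refine IsIntegrableTorusFun.of_ae_le (A := A + C * ∑ i, |τ i|) (C := C)
    (hF.measurable.comp (measurable_id.add_const τ)) (hF.periodic.isPeriodic.translate τ) ?_
  filter_upwards [h1] with x hx
  refine hx.trans ?_
  have h2 : ∑ i, |(x + τ) i| ≤ ∑ i, |x i| + ∑ i, |τ i| := by
    rw [← Finset.sum_add_distrib]
    exact Finset.sum_le_sum fun i _ => abs_add_le _ _
  have h3 := mul_le_mul_of_nonneg_left h2 hF.nonneg
  linarith

lemma HasLipschitzIncrements.isIntegrable {F : (Fin d → ℝ) → ℝ} {C : ℝ}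
    (hF : HasLipschitzIncrements F C) : IsIntegrableTorusFun F := by
  simpa using hF.isIntegrable_translate 0

/-- The trigonometric kernel with coefficients `a r`, `|r| ≤ m`. -/
def trigKernel (a : ℤ → ℂ) (m : ℕ) (t : ℝ) : ℂ :=
  ∑ r ∈ Finset.Icc (-(m : ℤ)) m, a r * Complex.exp (Complex.I * ((r * t : ℝ) : ℂ))

/-- The normalized `L¹` norm of a trigonometric kernel over a period. -/
def kernelNorm (a : ℤ → ℂ) (m : ℕ) : ℝ :=
  (2 * Real.pi)⁻¹ * ∫ t in Set.Icc 0 (2 * Real.pi), ‖trigKernel a m t‖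

/-- The partial Fourier sum of `F` over the frequencies in a box, with multipliers `∏ₖ a k (ν k)`. -/
def trigSum (F : (Fin d → ℝ) → ℝ) (a : Fin d → ℤ → ℂ) (m : ℕ) (x : Fin d → ℝ) : ℂ :=
  ∑ ν ∈ freqBox d m, (∏ k, a k (ν k)) * (fourierCoefficient F ν * character ν x)

lemma continuous_trigKernel (a : ℤ → ℂ) (m : ℕ) : Continuous (trigKernel a m) := by
  unfold trigKernel
  fun_prop

lemma kernelNorm_nonneg (a : ℤ → ℂ) (m : ℕ) : 0 ≤ kernelNorm a m :=
  mul_nonneg (by positivity) (integral_nonneg fun _ => norm_nonneg _)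

lemma prod_trigKernel (a : Fin d → ℤ → ℂ) (m : ℕ) (y : Fin d → ℝ) :
    ∏ k, trigKernel (a k) m (y k) =
      ∑ ν ∈ freqBox d m, (∏ k, a k (ν k)) * character ν y := by
  unfold trigKernel freqBox
  rw [Finset.prod_univ_sum]
  refine Finset.sum_congr rfl fun ν _ => ?_
  rw [Finset.prod_mul_distrib, character_eq_prod]

lemma integral_norm_prod_trigKernel (a : Fin d → ℤ → ℂ) (m : ℕ) :
    ∫ y in periodBox d, ‖∏ k, trigKernel (a k) m (y k)‖ =
      (2 * Real.pi) ^ d * ∏ k, kernelNorm (a k) m := by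
  rw [restrict_periodBox]
  simp only [norm_prod]
  rw [integral_fintype_prod_eq_prod (fun k t => ‖trigKernel (a k) m t‖)]
  simp only [kernelNorm]
  rw [Finset.prod_mul_distrib, Finset.prod_const, Finset.card_univ, Fintype.card_fin, ← mul_assoc,
    ← mul_pow, mul_inv_cancel₀ Real.two_pi_pos.ne', one_pow, one_mul]

lemma fourierCoefficient_eq (F : (Fin d → ℝ) → ℝ) (ν : Fin d → ℤ) :
    fourierCoefficient F ν = (1 / (2 * (Real.pi : ℂ)) ^ d) *
      ∫ x in periodBox d, (F x : ℂ) * character (-ν) x := rfl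

lemma IsIntegrableTorusFun.integrable_mul_character {F : (Fin d → ℝ) → ℝ}
    (hF : IsIntegrableTorusFun F) (ν : Fin d → ℤ) :
    IntegrableOn (fun x => (F x : ℂ) * character ν x) (periodBox d) := by
  refine hF.integrableOn.ofReal.mul_bdd (c := 1)
    (continuous_character ν).aestronglyMeasurable (ae_of_all _ fun x => ?_)
  simp

lemma character_neg_sub (ν : Fin d → ℤ) (x y : Fin d → ℝ) :
    character ν (x - y) = character ν x * character (-ν) y := by
  rw [sub_eq_add_neg, character_add, character_neg_left]

lemma IsPeriodic.trigKernel_mul {F : (Fin d → ℝ) → ℝ} (hF : IsPeriodic F) (a : Fin d → ℤ → ℂ)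
    (m : ℕ) (x : Fin d → ℝ) :
    IsPeriodic fun z => (∏ k, trigKernel (a k) m ((x - z) k)) * (F z : ℂ) := by
  intro z k
  simp only
  rw [hF z k, prod_trigKernel, prod_trigKernel]
  congr 1
  refine Finset.sum_congr rfl fun ν _ => ?_
  rw [character_neg_sub, character_neg_sub, character_isPeriodic (-ν) z k]

/-- A partial Fourier sum with multipliers is the convolution with a product kernel. -/
lemma trigSum_eq_integral {F : (Fin d → ℝ) → ℝ} (hF : IsIntegrableTorusFun F)
    (a : Fin d → ℤ → ℂ) (m : ℕ) (x : Fin d → ℝ) :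
    trigSum F a m x = ∫ y in periodBox d, (1 / (2 * (Real.pi : ℂ)) ^ d) *
      ((∏ k, trigKernel (a k) m (y k)) * (F (x - y) : ℂ)) := by
  have hm : Measurable fun z : Fin d → ℝ =>
      (∏ k, trigKernel (a k) m ((x - z) k)) * (F z : ℂ) := by
    refine Measurable.mul ?_ (Complex.measurable_ofReal.comp hF.measurable)
    refine Continuous.measurable (continuous_finsetProd _ fun k _ => ?_)
    exact (continuous_trigKernel (a k) m).comp
      ((continuous_apply k).comp (continuous_const.sub continuous_id))
  have h1 := (hF.periodic.trigKernel_mul a m x).integral_sub_left hm x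
  simp only [sub_sub_cancel] at h1
  rw [integral_const_mul, h1]
  simp only [prod_trigKernel, Finset.sum_mul]
  rw [integral_finsetSum, Finset.mul_sum, trigSum]
  · refine Finset.sum_congr rfl fun ν _ => ?_
    rw [fourierCoefficient_eq]
    have h2 : ∀ z : Fin d → ℝ, (∏ k, a k (ν k)) * character ν (x - z) * (F z : ℂ) =
        ((∏ k, a k (ν k)) * character ν x) * ((F z : ℂ) * character (-ν) z) := by
      intro z
      rw [character_neg_sub]
      ring
    simp only [h2]
    rw [integral_const_mul]
    ring
  · intro ν _
    have h2 : ∀ z : Fin d → ℝ, (∏ k, a k (ν k)) * character ν (x - z) * (F z : ℂ) =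
        ((∏ k, a k (ν k)) * character ν x) * ((F z : ℂ) * character (-ν) z) := by
      intro z
      rw [character_neg_sub]
      ring
    simp only [h2]
    exact (hF.integrable_mul_character (-ν)).const_mul _

/-- Young's inequality for grid sums: convolution with a product kernel multiplies them at most by
the `L¹` norm of the kernel. -/
lemma gridSum_trigSum_le {F : (Fin d → ℝ) → ℝ} (hF : IsIntegrableTorusFun F)
    (a : Fin d → ℤ → ℂ) (m : ℕ) (u : Finset (Fin d)) (n : ℕ) (p : Fin d → ℕ → ℝ)
    (b : Fin d → ℝ) {B : ℝ}
    (h : ∀ᵐ y : Fin d → ℝ, gridSum F u n (fun l k => p l k - y l) (b - y) ≤ B) :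
    gridSum (trigSum F a m) u n p b ≤ (∏ k, kernelNorm (a k) m) * B := by
  have e1 : trigSum F a m = fun x => ∫ y in periodBox d, (1 / (2 * (Real.pi : ℂ)) ^ d) *
      ((∏ k, trigKernel (a k) m (y k)) * (F (x - y) : ℂ)) :=
    funext fun x => trigSum_eq_integral hF a m x
  have hKc : Continuous fun y : Fin d → ℝ => ∏ k, trigKernel (a k) m (y k) :=
    continuous_finsetProd _ fun k _ => (continuous_trigKernel (a k) m).comp (continuous_apply k)
  have e2 : (∏ k, kernelNorm (a k) m) * B =
      ∫ y in periodBox d, (1 / (2 * Real.pi) ^ d) * (‖∏ k, trigKernel (a k) m (y k)‖ * B) := by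
    rw [integral_const_mul, integral_mul_const, integral_norm_prod_trigKernel]
    field_simp
  rw [e1, e2]
  refine gridSum_integral_le (fun x => ?_) u n p b ?_ ?_
  · obtain ⟨M, hM⟩ := (isCompact_Icc (a := fun _ : Fin d => (0 : ℝ))
      (b := fun _ => 2 * Real.pi)).exists_bound_of_continuousOn hKc.continuousOn
    refine Integrable.const_mul ?_ _
    refine ((hF.integrable_sub_left x).ofReal (𝕜 := ℂ)).bdd_mul (c := M)
      hKc.aestronglyMeasurable ?_
    filter_upwards [ae_restrict_mem (measurableSet_periodBox d)] with y hy using hM y hy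
  · exact ((hKc.norm.integrableOn_Icc).mul_const B).const_mul _
  · filter_upwards [ae_restrict_of_ae h] with y hy
    have e3 : (fun x => (1 / (2 * (Real.pi : ℂ)) ^ d) *
        ((∏ k, trigKernel (a k) m (y k)) * (F (x - y) : ℂ))) =
        fun x => ((1 / (2 * (Real.pi : ℂ)) ^ d) * (∏ k, trigKernel (a k) m (y k))) •
          ((fun z => (F z : ℂ)) (x + -y)) := by
      ext x
      rw [smul_eq_mul, sub_eq_add_neg]
      ring
    rw [e3, gridSum_smul, gridSum_comp_add (fun z => (F z : ℂ)), gridSum_ofReal, norm_mul]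
    have e4 : ‖(1 / (2 * (Real.pi : ℂ)) ^ d)‖ = 1 / (2 * Real.pi) ^ d := by
      simp [abs_of_pos Real.pi_pos]
    rw [e4, mul_assoc]
    refine mul_le_mul_of_nonneg_left (mul_le_mul_of_nonneg_left ?_ (norm_nonneg _)) (by positivity)
    simpa [sub_eq_add_neg] using hy

end Convolution

/-! ### Absolute convergence of the Fourier series of the regular part -/

section Coefficients

variable {d : ℕ}

lemma IsIntegrableTorusFun.integral_translate_mul_character {F : (Fin d → ℝ) → ℝ}
    (hF : IsIntegrableTorusFun F) (ν : Fin d → ℤ) (τ : Fin d → ℝ) :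
    ∫ x in periodBox d, (F (x + τ) : ℂ) * character (-ν) x =
      character ν τ * ∫ x in periodBox d, (F x : ℂ) * character (-ν) x := by
  have hper : IsPeriodic fun x => (F x : ℂ) * character (-ν) x := fun x k => by
    simp only [hF.periodic x k, character_isPeriodic (-ν) x k]
  have hm : Measurable fun x => (F x : ℂ) * character (-ν) x :=
    (Complex.measurable_ofReal.comp hF.measurable).mul (continuous_character (-ν)).measurable
  rw [← hper.integral_add_right hm τ, ← integral_const_mul]
  refine integral_congr_ae (ae_of_all _ fun x => ?_)
  simp only
  have h1 : character ν τ * character (-ν) τ = 1 := by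
    rw [character_neg_left, ← character_add, add_neg_cancel]
    simp [character]
  rw [character_add (-ν) x τ]
  linear_combination (-(F (x + τ) : ℂ) * character (-ν) x) * h1

lemma fourierCoefficient_translate_sub {F : (Fin d → ℝ) → ℝ} (hF : IsIntegrableTorusFun F)
    (τ : Fin d → ℝ) (hτ : IsIntegrableTorusFun fun x => F (x + τ)) (ν : Fin d → ℤ) :
    fourierCoefficient (fun x => F (x + τ) - F x) ν =
      (character ν τ - 1) * fourierCoefficient F ν := by
  rw [fourierCoefficient_eq, fourierCoefficient_eq]
  have h1 : ∫ x in periodBox d, ((F (x + τ) - F x : ℝ) : ℂ) * character (-ν) x =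
      (∫ x in periodBox d, (F (x + τ) : ℂ) * character (-ν) x) -
        ∫ x in periodBox d, (F x : ℂ) * character (-ν) x := by
    rw [← integral_sub (hτ.integrable_mul_character (-ν)) (hF.integrable_mul_character (-ν))]
    refine integral_congr_ae (ae_of_all _ fun x => ?_)
    simp only [Complex.ofReal_sub]
    ring
  rw [h1, hF.integral_translate_mul_character]
  ring

lemma integral_mixedDiff_mul_character {F : (Fin d → ℝ) → ℝ} (hF : IsIntegrableTorusFun F)
    (hτ : ∀ τ, IsIntegrableTorusFun fun x => F (x + τ)) (u : Finset (Fin d)) (h : ℝ)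
    (ν : Fin d → ℤ) :
    ∫ x in periodBox d, mixedDiff (fun x => (F x : ℂ)) u x (x + fun _ => h) x * character (-ν) x =
      (∏ i ∈ u, (Complex.exp (Complex.I * ((ν i * h : ℝ) : ℂ)) - 1)) *
        ∫ x in periodBox d, (F x : ℂ) * character (-ν) x := by
  have h1 : ∀ x : Fin d → ℝ, mixedDiff (fun x => (F x : ℂ)) u x (x + fun _ => h) x *
      character (-ν) x = ∑ v ∈ u.powerset, (-1 : ℂ) ^ (u \ v).card *
        ((F (x + fun i => if i ∈ v then h else 0) : ℂ) * character (-ν) x) := by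
    intro x
    rw [mixedDiff, Finset.sum_mul]
    refine Finset.sum_congr rfl fun v hv => ?_
    rw [zsmul_eq_mul, mul_assoc]
    push_cast
    congr 3
    congr 1
    ext i
    by_cases hi : i ∈ v <;> simp [hi]
  simp only [h1]
  rw [integral_finsetSum]
  · simp only [integral_const_mul, hF.integral_translate_mul_character]
    simp only [sub_eq_add_neg]
    rw [Finset.prod_add, Finset.sum_mul]
    refine Finset.sum_congr rfl fun v hv => ?_
    rw [Finset.prod_const]
    have h2 : character ν (fun i => if i ∈ v then h else 0) =
        ∏ i ∈ v, Complex.exp (Complex.I * ((ν i * h : ℝ) : ℂ)) := by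
      rw [character_eq_prod, ← Finset.prod_subset (Finset.subset_univ v)]
      · refine Finset.prod_congr rfl fun i hi => ?_
        simp [hi]
      · intro i _ hi
        simp [hi]
    rw [h2]
    ring
  · intro v _
    exact ((hτ _).integrable_mul_character (-ν)).const_mul _

lemma norm_exp_I_mul_sub_one_ge {θ : ℝ} (h : |θ| ≤ Real.pi) :
    2 / Real.pi * |θ| ≤ ‖Complex.exp (Complex.I * (θ : ℂ)) - 1‖ := by
  have h1 : ‖Complex.exp (Complex.I * (θ : ℂ)) - 1‖ = 2 * |Real.sin (θ / 2)| := by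
    rw [Complex.norm_exp_I_mul_ofReal_sub_one]
    rw [norm_mul, Real.norm_eq_abs, Real.norm_eq_abs]
    simp
  rw [h1]
  have h2 := Real.mul_abs_le_abs_sin (x := θ / 2) (by rw [abs_div]; simp; linarith)
  rw [abs_div] at h2
  have h3 : |(2 : ℝ)| = 2 := by simp
  rw [h3] at h2
  linarith

lemma natAbs_le_maxNorm (ν : Fin d → ℤ) (i : Fin d) : (ν i).natAbs ≤ maxNorm ν :=
  Finset.le_sup (f := fun k => (ν k).natAbs) (Finset.mem_univ i)

lemma card_gridCells (u : Finset (Fin d)) (n : ℕ) : (gridCells u n).card = n ^ u.card := by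
  rw [gridCells, Fintype.card_piFinset]
  have : ∀ i : Fin d, (if i ∈ u then Finset.range n else {0} : Finset ℕ).card =
      if i ∈ u then n else 1 := by
    intro i; split_ifs <;> simp
  simp [this]

/-- The coefficients of a function with Lipschitz increments: apply the differences with step
`π / ‖ν‖` once in the direction of a largest frequency and once in each direction with
nonzero frequency. -/
lemma HasLipschitzIncrements.norm_fourierCoefficient_le {F : (Fin d → ℝ) → ℝ} {C : ℝ}
    (hF : HasLipschitzIncrements F C) {ν : Fin d → ℤ} (hν : 0 < maxNorm ν) :
    ‖fourierCoefficient F ν‖ * (maxNorm ν * ∏ i, max 1 |(ν i : ℝ)|) ≤ C * Real.pi := by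
  classical
  set N := maxNorm ν with hN
  have hNR : (0 : ℝ) < N := by exact_mod_cast hν
  have hne : (Finset.univ : Finset (Fin d)).Nonempty := by
    by_contra h
    rw [Finset.not_nonempty_iff_eq_empty] at h
    rw [hN, maxNorm, h] at hν
    simp at hν
  obtain ⟨i, -, hi⟩ := Finset.exists_mem_eq_sup _ hne fun k => (ν k).natAbs
  have hiN : (ν i).natAbs = N := hi.symm
  set u : Finset (Fin d) := Finset.univ.filter fun k => ν k ≠ 0 with hu
  set h : ℝ := Real.pi / N with hh
  have hhpos : 0 < h := by positivity
  have hint := hF.isIntegrable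
  have hinth := hF.isIntegrable_translate (Pi.single i h)
  set H : (Fin d → ℝ) → ℝ := fun x => F (x + Pi.single i h) - F x with hH
  have hHint : IsIntegrableTorusFun H := hinth.sub hint
  have hHτ : ∀ τ, IsIntegrableTorusFun fun x => H (x + τ) := by
    intro τ
    have := (hF.isIntegrable_translate (τ + Pi.single i h)).sub (hF.isIntegrable_translate τ)
    simpa only [hH, ← add_assoc] using this
  -- the integral of `‖D‖` is bounded by averaging over the cells of the uniform grid with `2 N`
  -- steps of width `h = π / N`, which spans exactly one period
  set D : (Fin d → ℝ) → ℂ := fun x =>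
    mixedDiff (fun x => (H x : ℂ)) u x (x + fun _ => h) x with hD
  have hDm : Measurable D := by
    simp only [hD, mixedDiff]
    refine Finset.measurable_fun_sum _ fun v _ => ?_
    refine Measurable.const_smul ?_ _
    refine Complex.measurable_ofReal.comp (hHint.measurable.comp
      (measurable_pi_lambda _ fun l => ?_))
    by_cases h1 : l ∈ v
    · simp only [h1, if_true]
      exact (measurable_pi_apply l).add_const _
    · simp only [h1, if_false, ite_self]
      exact measurable_pi_apply l
  have hDsum : ∀ x, D x = ∑ v ∈ u.powerset, (-1 : ℂ) ^ (u \ v).card *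
      (H (x + fun l => if l ∈ v then h else 0) : ℂ) := by
    intro x
    simp only [hD, mixedDiff]
    refine Finset.sum_congr rfl fun v _ => ?_
    rw [zsmul_eq_mul]
    push_cast
    congr 3
    ext l
    by_cases h1 : l ∈ v <;> simp [h1]
  have hDper : IsPeriodic D := by
    intro x k
    rw [hDsum, hDsum]
    refine Finset.sum_congr rfl fun v _ => ?_
    have h0 := (hHτ fun l => if l ∈ v then h else 0).periodic x k
    rw [h0]
  have hDi : ∀ z, IntegrableOn (fun y => D (z - y)) (periodBox d) := by
    intro z
    simp only [hDsum]
    exact integrable_finsetSum _ fun v _ =>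
      (((hHτ fun l => if l ∈ v then h else 0).integrable_sub_left z).ofReal (𝕜 := ℂ)).const_mul _
  -- the mean of `‖D‖` is controlled by the grid sums of the increment `H`
  have hDint : ((2 * N : ℕ) : ℝ) ^ u.card * ∫ x in periodBox d, ‖D x‖ ≤
      (2 * Real.pi) ^ d * (C * h) := by
    have hgrid := hF.gridSum_le u (2 * N) (fun _ k => (min k (2 * N) : ℕ) * h) 0
      (fun l _ => ⟨fun a c hac => by
        have : ((min a (2 * N) : ℕ) : ℝ) ≤ (min c (2 * N) : ℕ) := by
          exact_mod_cast min_le_min_right _ hac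
        simp only
        exact mul_le_mul_of_nonneg_right this hhpos.le, fun k => by
        have h1 : ((min k (2 * N) : ℕ) : ℝ) ≤ (2 * N : ℕ) := by exact_mod_cast min_le_right _ _
        have h2 := mul_le_mul_of_nonneg_right h1 hhpos.le
        have h3 : ((2 * N : ℕ) : ℝ) * h = 2 * Real.pi := by
          rw [hh]; push_cast; field_simp
        rw [h3] at h2
        simpa using h2⟩) i h
    rw [abs_of_pos hhpos] at hgrid
    have hcells : ∀ y : Fin d → ℝ,
        gridSum H u (2 * N) (fun l k => ((min k (2 * N) : ℕ) : ℝ) * h - y l) (0 - y) =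
        ∑ k ∈ gridCells u (2 * N), ‖D ((fun l => (k l : ℝ) * h) - y)‖ := by
      intro y
      refine Finset.sum_congr rfl fun k hk => ?_
      rw [mem_gridCells] at hk
      simp only [hD]
      rw [mixedDiff_ofReal, Complex.norm_real]
      congr 1
      refine mixedDiff_congr fun v hv => ?_
      congr 1
      ext l
      by_cases h1 : l ∈ v
      · have h2 := hk.1 l (hv h1)
        have h3 : min (k l + 1) (2 * N) = k l + 1 := min_eq_left (by omega)
        simp only [h1, if_true, h3, Pi.add_apply, Pi.sub_apply]
        push_cast
        ring
      · by_cases h4 : l ∈ u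
        · have h2 := hk.1 l h4
          have h3 : min (k l) (2 * N) = k l := min_eq_left (by omega)
          simp [h1, h4, h3]
        · simp [h1, h4, hk.2 l h4]
    have hsumint : ∫ y in periodBox d, ∑ k ∈ gridCells u (2 * N),
        ‖D ((fun l => (k l : ℝ) * h) - y)‖ =
        ((2 * N : ℕ) : ℝ) ^ u.card * ∫ x in periodBox d, ‖D x‖ := by
      rw [integral_finsetSum _ fun k _ => (hDi _).norm]
      have hper : IsPeriodic fun x => ‖D x‖ := fun x k => by simp only [hDper x k]
      simp only [hper.integral_sub_left hDm.norm, Finset.sum_const, card_gridCells]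
      rw [nsmul_eq_mul, Nat.cast_pow]
    rw [← hsumint]
    have hvol : ∫ _ in periodBox d, C * h = (2 * Real.pi) ^ d * (C * h) := by
      rw [setIntegral_const, smul_eq_mul, Measure.real, periodBox,
        Real.volume_Icc_pi_toReal (fun _ => Real.two_pi_pos.le)]
      simp
    rw [← hvol]
    refine integral_mono_ae (integrable_finsetSum _ fun k _ => (hDi _).norm)
      (integrable_const _) ?_
    filter_upwards [ae_restrict_of_ae hgrid] with y hy
    rwa [← hcells y]
  have hDnorm : ‖∫ x in periodBox d, D x * character (-ν) x‖ ≤ ∫ x in periodBox d, ‖D x‖ := by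
    refine (norm_integral_le_integral_norm _).trans (le_of_eq ?_)
    simp
  have hchar : character ν (Pi.single i h) = -1 := by
    rw [character_eq_prod, Finset.prod_eq_single i]
    · rw [Pi.single_eq_same]
      rcases Int.natAbs_eq (ν i) with h1 | h1
      · have : (ν i : ℝ) * h = Real.pi := by
          rw [h1, hiN, hh]; push_cast; field_simp
        rw [this, mul_comm]
        exact Complex.exp_pi_mul_I
      · have : (ν i : ℝ) * h = -Real.pi := by
          rw [h1, hiN, hh]; push_cast; field_simp
        rw [this, mul_comm, Complex.ofReal_neg, neg_mul, Complex.exp_neg, Complex.exp_pi_mul_I]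
        norm_num
    · intro k _ hk
      simp [hk]
    · simp
  have hDc : ∫ x in periodBox d, D x * character (-ν) x =
      (∏ l ∈ u, (Complex.exp (Complex.I * ((ν l * h : ℝ) : ℂ)) - 1)) *
        ((2 * (Real.pi : ℂ)) ^ d * (-2 * fourierCoefficient F ν)) := by
    have h1 := fourierCoefficient_translate_sub hint (Pi.single i h) hinth ν
    rw [hchar, fourierCoefficient_eq] at h1
    have h2 : (2 * (Real.pi : ℂ)) ^ d ≠ 0 := by
      have : (Real.pi : ℂ) ≠ 0 := by exact_mod_cast Real.pi_ne_zero
      exact pow_ne_zero _ (mul_ne_zero two_ne_zero this)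
    simp only [hD]
    rw [integral_mixedDiff_mul_character hHint hHτ]
    congr 1
    have h3 : (-2 : ℂ) * fourierCoefficient F ν = (-1 - 1) * fourierCoefficient F ν := by ring
    rw [h3, ← h1, ← mul_assoc, mul_one_div_cancel h2, one_mul]
  have hprod : ∏ l ∈ u, (2 / N * |(ν l : ℝ)|) ≤
      ‖∏ l ∈ u, (Complex.exp (Complex.I * ((ν l * h : ℝ) : ℂ)) - 1)‖ := by
    rw [norm_prod]
    refine Finset.prod_le_prod (fun l _ => by positivity) fun l _ => ?_
    have h1 : |(ν l : ℝ)| ≤ N := by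
      have := natAbs_le_maxNorm ν l
      rw [← Int.cast_abs, Int.abs_eq_natAbs]
      exact_mod_cast this
    have h2 : |(ν l : ℝ) * h| = |(ν l : ℝ)| * h := by rw [abs_mul, abs_of_pos hhpos]
    have h3 := norm_exp_I_mul_sub_one_ge (θ := ν l * h) (by
      rw [h2, hh, mul_div_assoc', div_le_iff₀ hNR, mul_comm]
      exact mul_le_mul_of_nonneg_left h1 Real.pi_pos.le)
    refine le_trans (le_of_eq ?_) h3
    rw [h2, hh]
    field_simp
  have hmax : ∏ l, max 1 |(ν l : ℝ)| ≤
      ((2 * N : ℕ) : ℝ) ^ u.card * ∏ l ∈ u, (2 / N * |(ν l : ℝ)|) := by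
    rw [← Finset.prod_const, ← Finset.prod_mul_distrib,
      ← Finset.prod_subset (Finset.subset_univ u)]
    · refine Finset.prod_le_prod (fun l _ => by positivity) fun l hl => ?_
      have h1 : (1 : ℝ) ≤ |(ν l : ℝ)| := by
        have : ν l ≠ 0 := by simpa [hu] using hl
        exact_mod_cast Int.one_le_abs this
      have h2 : ((2 * N : ℕ) : ℝ) * (2 / N * |(ν l : ℝ)|) = 4 * |(ν l : ℝ)| := by
        push_cast; field_simp; norm_num
      rw [h2, max_eq_right h1]
      linarith
    · intro l _ hl
      have : ν l = 0 := by simpa [hu] using hl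
      simp [this]
  rw [hDc, norm_mul, norm_mul, norm_mul] at hDnorm
  have e1 : ‖(2 * (Real.pi : ℂ)) ^ d‖ = (2 * Real.pi) ^ d := by
    simp [abs_of_pos Real.pi_pos]
  have e2 : ‖(-2 : ℂ)‖ = 2 := by simp
  rw [e1, e2] at hDnorm
  set c := ‖fourierCoefficient F ν‖ with hc
  have hc0 : 0 ≤ c := norm_nonneg _
  have hTd : 0 < (2 * Real.pi) ^ d := by positivity
  set M : ℝ := ((2 * N : ℕ) : ℝ) ^ u.card with hM
  have hM0 : 0 ≤ M := by positivity
  have f1 : M * ((∏ l ∈ u, (2 / N * |(ν l : ℝ)|)) * ((2 * Real.pi) ^ d * (2 * c))) ≤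
      (2 * Real.pi) ^ d * (C * h) := by
    refine le_trans (mul_le_mul_of_nonneg_left ?_ hM0) hDint
    refine le_trans (mul_le_mul_of_nonneg_right hprod (by positivity)) hDnorm
  have f2 : (∏ l, max 1 |(ν l : ℝ)|) * ((2 * Real.pi) ^ d * (2 * c)) ≤
      (2 * Real.pi) ^ d * (C * h) := by
    refine le_trans (mul_le_mul_of_nonneg_right hmax (by positivity)) ?_
    rw [mul_assoc]
    exact f1
  have f3 : (∏ l, max 1 |(ν l : ℝ)|) * (2 * c) ≤ C * h := by
    refine le_of_mul_le_mul_left ?_ hTd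
    linarith
  have f4 : C * h * N = C * Real.pi := by rw [hh]; field_simp
  have f5 := mul_le_mul_of_nonneg_right f3 hNR.le
  rw [f4] at f5
  have f6 : 0 ≤ (∏ l, max 1 |(ν l : ℝ)|) * c * N := by positivity
  nlinarith

/-- The Fourier series of a function with Lipschitz increments converges absolutely: since
`‖ν‖ ≥ ∏ max(1, |ν k|) ^ (1/d)`, the coefficients are dominated by a product of summable
sequences. -/
lemma HasLipschitzIncrements.exists_sum_fourierCoefficient_le {F : (Fin d → ℝ) → ℝ} {C : ℝ}
    (hF : HasLipschitzIncrements F C) (hd : 0 < d) :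
    ∃ S : ℝ, ∀ n : ℕ, coeffSum F n ≤ S := by
  have hdR : (0 : ℝ) < d := by exact_mod_cast hd
  set w : ℤ → ℝ := fun r => (max 1 |(r : ℝ)|) ^ (-(1 + 1 / (d : ℝ))) with hw
  have hw0 : ∀ r, 0 ≤ w r := fun r => by positivity
  have hws : Summable w := by
    have h1 : Summable fun r : ℤ => |(r : ℝ)| ^ (-(1 + 1 / (d : ℝ))) :=
      Real.summable_abs_int_rpow (by have : 0 < 1 / (d : ℝ) := by positivity
                                     linarith)
    have h2 : Summable fun r : ℤ => if r = 0 then (1 : ℝ) else 0 :=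
      summable_of_ne_finset_zero (s := {0}) fun r hr => by simpa using hr
    refine Summable.of_nonneg_of_le hw0 (fun r => ?_) (h1.add h2)
    by_cases hr : r = 0
    · subst hr
      have : (0 : ℝ) ^ (-(1 + 1 / (d : ℝ))) = 0 := Real.zero_rpow (by
        have : 0 < 1 / (d : ℝ) := by positivity
        linarith)
      simp [hw]
      positivity
    · have : (1 : ℝ) ≤ |(r : ℝ)| := by exact_mod_cast Int.one_le_abs hr
      simp [hw, hr, max_eq_right this]
  set A := C * Real.pi with hA
  have hA0 : 0 ≤ A := mul_nonneg hF.nonneg Real.pi_pos.le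
  have hbound : ∀ ν : Fin d → ℤ,
      ‖fourierCoefficient F ν‖ ≤ (A + ‖fourierCoefficient F 0‖) * ∏ k, w (ν k) := by
    intro ν
    by_cases hν : 0 < maxNorm ν
    · have h1 := hF.norm_fourierCoefficient_le hν
      have hNR : (0 : ℝ) < maxNorm ν := by exact_mod_cast hν
      set P : ℝ := ∏ k, max 1 |(ν k : ℝ)| with hP
      have hP1 : 0 < P := Finset.prod_pos fun k _ => by positivity
      have h2 : P ≤ (maxNorm ν : ℝ) ^ d := by
        have : (maxNorm ν : ℝ) ^ d = ∏ _k : Fin d, (maxNorm ν : ℝ) := by simp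
        rw [this]
        refine Finset.prod_le_prod (fun k _ => by positivity) fun k _ => max_le ?_ ?_
        · exact_mod_cast hν
        · have := natAbs_le_maxNorm ν k
          rw [← Int.cast_abs, Int.abs_eq_natAbs]
          exact_mod_cast this
      have h3 : P ^ (1 / (d : ℝ)) ≤ maxNorm ν := by
        have := Real.rpow_le_rpow hP1.le h2 (by positivity : (0 : ℝ) ≤ 1 / d)
        rwa [← Real.rpow_natCast, ← Real.rpow_mul hNR.le, mul_one_div_cancel hdR.ne',
          Real.rpow_one] at this
      have h4 : ∏ k, w (ν k) = (P ^ (1 + 1 / (d : ℝ)))⁻¹ := by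
        simp only [hw]
        rw [Real.finsetProd_rpow _ _ (fun k _ => by positivity), Real.rpow_neg hP1.le]
      have h5 : P ^ (1 + 1 / (d : ℝ)) ≤ maxNorm ν * P := by
        rw [Real.rpow_add hP1, Real.rpow_one, mul_comm]
        exact mul_le_mul_of_nonneg_right h3 hP1.le
      have h6 : 0 < P ^ (1 + 1 / (d : ℝ)) := by positivity
      rw [h4, ← div_eq_mul_inv, le_div_iff₀ h6]
      have h7 := mul_le_mul_of_nonneg_left h5 (norm_nonneg (fourierCoefficient F ν))
      linarith [norm_nonneg (fourierCoefficient F 0)]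
    · have h0 : ν = 0 := by
        ext k
        have := natAbs_le_maxNorm ν k
        have h2 : (ν k).natAbs = 0 := by omega
        simpa using h2
      subst h0
      have : ∏ k : Fin d, w ((0 : Fin d → ℤ) k) = 1 := by simp [hw]
      rw [this]
      linarith
  refine ⟨(A + ‖fourierCoefficient F 0‖) * (∑' r, w r) ^ d, fun n => ?_⟩
  unfold coeffSum
  refine (Finset.sum_le_sum fun ν _ => hbound ν).trans ?_
  rw [← Finset.mul_sum]
  refine mul_le_mul_of_nonneg_left ?_ (by positivity)
  rw [freqBox, ← Finset.prod_univ_sum (fun _ : Fin d => Finset.Icc (-(n : ℤ)) n) (fun _ r => w r),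
    Finset.prod_const, Finset.card_univ, Fintype.card_fin]
  exact pow_le_pow_left₀ (Finset.sum_nonneg fun r _ => hw0 r)
    (hws.sum_le_tsum _ fun r _ => hw0 r) d

end Coefficients

/-! ### Dirichlet and Fejér kernels -/

section Kernels

/-- The geometric sum `∑_{q < m} exp (i q t)`. -/
def geomExp (m : ℕ) (t : ℝ) : ℂ :=
  ∑ q ∈ Finset.range m, Complex.exp (Complex.I * ((q * t : ℝ) : ℂ))

/-- The multiplier `-i sign r` of the conjugate function. -/
def conjMultiplier (r : ℤ) : ℂ := -Complex.I * ((r.sign : ℤ) : ℂ)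

lemma sum_Icc_neg {M : Type*} [AddCommMonoid M] (g : ℤ → M) (m : ℕ) :
    ∑ r ∈ Finset.Icc (-(m : ℤ)) m, g r =
      g 0 + ∑ k ∈ Finset.range m, (g ((k : ℤ) + 1) + g (-((k : ℤ) + 1))) := by
  induction m with
  | zero => simp
  | succ m ih =>
    have h : Finset.Icc (-((m + 1 : ℕ) : ℤ)) ((m + 1 : ℕ) : ℤ) =
        insert ((m : ℤ) + 1) (insert (-((m : ℤ) + 1)) (Finset.Icc (-(m : ℤ)) m)) := by
      ext r
      simp only [Finset.mem_Icc, Finset.mem_insert]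
      omega
    rw [h, Finset.sum_insert (by simp; omega), Finset.sum_insert (by simp), ih,
      Finset.sum_range_succ, ← add_assoc, add_comm]
    rw [add_assoc]

lemma continuous_geomExp (m : ℕ) : Continuous (geomExp m) := by
  unfold geomExp
  fun_prop

lemma norm_geomExp_le (m : ℕ) (t : ℝ) : ‖geomExp m t‖ ≤ m := by
  refine (norm_sum_le _ _).trans ?_
  simp [mul_comm Complex.I, Complex.norm_exp_ofReal_mul_I, -Complex.ofReal_mul]

lemma norm_geomExp_mul_abs_sin_le (m : ℕ) (t : ℝ) : ‖geomExp m t‖ * |Real.sin (t / 2)| ≤ 1 := by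
  have h1 : geomExp m t * (Complex.exp (Complex.I * t) - 1) =
      Complex.exp (Complex.I * ((m * t : ℝ) : ℂ)) - 1 := by
    have : geomExp m t = ∑ q ∈ Finset.range m, Complex.exp (Complex.I * t) ^ q := by
      refine Finset.sum_congr rfl fun q _ => ?_
      rw [← Complex.exp_nat_mul]
      congr 1
      push_cast
      ring
    rw [this, geom_sum_mul, ← Complex.exp_nat_mul]
    congr 2
    push_cast
    ring
  have h2 := congrArg norm h1
  rw [norm_mul, Complex.norm_exp_I_mul_ofReal_sub_one, norm_mul, Real.norm_eq_abs,
    Real.norm_eq_abs] at h2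
  have h3 : ‖Complex.exp (Complex.I * ((m * t : ℝ) : ℂ)) - 1‖ ≤ 2 := by
    refine (norm_sub_le _ _).trans ?_
    rw [mul_comm, Complex.norm_exp_ofReal_mul_I, norm_one]
    norm_num
  rw [abs_two] at h2
  linarith

lemma norm_geomExp_neg (m : ℕ) (t : ℝ) : ‖geomExp m (-t)‖ = ‖geomExp m t‖ := by
  have : geomExp m (-t) = (starRingEnd ℂ) (geomExp m t) := by
    unfold geomExp
    rw [map_sum]
    refine Finset.sum_congr rfl fun q _ => ?_
    rw [← Complex.exp_conj]
    congr 1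
    simp
  rw [this, Complex.norm_conj]

lemma norm_geomExp_two_pi_sub (m : ℕ) (t : ℝ) :
    ‖geomExp m (2 * Real.pi - t)‖ = ‖geomExp m t‖ := by
  rw [← norm_geomExp_neg m t]
  congr 1
  unfold geomExp
  refine Finset.sum_congr rfl fun q _ => ?_
  rw [Complex.exp_eq_exp_iff_exists_int]
  refine ⟨q, ?_⟩
  push_cast
  ring

lemma integral_norm_geomExp_le {m : ℕ} (hm : 0 < m) :
    ∫ t in (0 : ℝ)..Real.pi, ‖geomExp m t‖ ≤ 1 + Real.pi * Real.log (Real.pi * m) := by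
  have hmR : (1 : ℝ) ≤ m := by exact_mod_cast hm
  have hm0 : (0 : ℝ) < m := by linarith
  have hmi : (0 : ℝ) < (m : ℝ)⁻¹ := by positivity
  have hm1 : (m : ℝ)⁻¹ ≤ Real.pi := (inv_le_one_of_one_le₀ hmR).trans (by linarith [Real.pi_gt_three])
  have hi : ∀ a b : ℝ, IntervalIntegrable (fun t => ‖geomExp m t‖) volume a b := fun a b =>
    (continuous_geomExp m).norm.intervalIntegrable _ _
  rw [← intervalIntegral.integral_add_adjacent_intervals (hi 0 (m : ℝ)⁻¹) (hi _ _)]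
  refine add_le_add ?_ ?_
  · calc ∫ t in (0 : ℝ)..(m : ℝ)⁻¹, ‖geomExp m t‖ ≤ ∫ _ in (0 : ℝ)..(m : ℝ)⁻¹, (m : ℝ) :=
        intervalIntegral.integral_mono_on hmi.le (hi _ _) (by simp) fun t _ => norm_geomExp_le m t
      _ = 1 := by simp [hm0.ne']
  · rw [← div_inv_eq_mul Real.pi (m : ℝ), ← integral_inv_of_pos hmi Real.pi_pos,
      ← intervalIntegral.integral_const_mul]
    have h0 : (0 : ℝ) ∉ Set.uIcc (m : ℝ)⁻¹ Real.pi := by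
      rw [Set.uIcc_of_le hm1]
      exact fun h => absurd h.1 (by linarith)
    refine intervalIntegral.integral_mono_on hm1 (hi _ _)
      ((intervalIntegral.intervalIntegrable_inv (fun t ht h => h0 (h ▸ ht))
        continuousOn_id).const_mul _) fun t ht => ?_
    have ht0 : 0 < t := hmi.trans_le ht.1
    have h1 := Real.mul_le_sin (x := t / 2) (by linarith) (by linarith [ht.2])
    have h2 := norm_geomExp_mul_abs_sin_le m t
    have h3 : 2 / Real.pi * (t / 2) = t / Real.pi := by ring
    rw [h3] at h1
    have h4 : 0 < t / Real.pi := div_pos ht0 Real.pi_pos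
    rw [abs_of_pos (h4.trans_le h1)] at h2
    have h5 : ‖geomExp m t‖ * (t / Real.pi) ≤ 1 :=
      (mul_le_mul_of_nonneg_left h1 (norm_nonneg _)).trans h2
    rw [← div_eq_mul_inv, le_div_iff₀ ht0]
    rw [← mul_div_assoc, div_le_one Real.pi_pos] at h5
    exact h5

lemma integral_two_pi_eq_two_mul {φ : ℝ → ℝ} (hc : Continuous φ)
    (h : ∀ t, φ (2 * Real.pi - t) = φ t) :
    ∫ t in Set.Icc 0 (2 * Real.pi), φ t = 2 * ∫ t in (0 : ℝ)..Real.pi, φ t := by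
  rw [integral_Icc_eq_integral_Ioc, ← intervalIntegral.integral_of_le Real.two_pi_pos.le,
    ← intervalIntegral.integral_add_adjacent_intervals (hc.intervalIntegrable 0 Real.pi)
      (hc.intervalIntegrable Real.pi _)]
  have h1 : ∫ t in Real.pi..2 * Real.pi, φ t = ∫ t in (0 : ℝ)..Real.pi, φ t := by
    have h2 := intervalIntegral.integral_comp_sub_left φ (2 * Real.pi) (a := 0) (b := Real.pi)
    rw [sub_zero, show 2 * Real.pi - Real.pi = Real.pi by ring] at h2
    rw [← h2]
    simp only [h]
  rw [h1]
  ring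

/-- The bound for the `L¹` norms of the Dirichlet kernels and of their conjugates. -/
def lebesgueBound (m : ℕ) : ℝ := 8 * (1 + Real.log (m + 1))

lemma lebesgueBound_mono : Monotone lebesgueBound := by
  intro m n h
  unfold lebesgueBound
  have : (m : ℝ) ≤ n := by exact_mod_cast h
  gcongr

lemma one_le_lebesgueBound (m : ℕ) : 1 ≤ lebesgueBound m := by
  have : 0 ≤ Real.log ((m : ℝ) + 1) := Real.log_nonneg (by linarith [m.cast_nonneg (α := ℝ)])
  unfold lebesgueBound
  linarith

lemma kernelNorm_le_of_norm_le {a : ℤ → ℂ} {m : ℕ}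
    (h : ∀ t, ‖trigKernel a m t‖ ≤ 1 + 2 * ‖geomExp (m + 1) t‖) :
    kernelNorm a m ≤ lebesgueBound m := by
  have h1 : ∫ t in Set.Icc 0 (2 * Real.pi), ‖trigKernel a m t‖ ≤
      ∫ t in Set.Icc 0 (2 * Real.pi), (1 + 2 * ‖geomExp (m + 1) t‖) := by
    refine setIntegral_mono ?_ ?_ h
    · exact (continuous_trigKernel a m).norm.integrableOn_Icc
    · have := continuous_geomExp (m + 1)
      exact Continuous.integrableOn_Icc (by fun_prop)
  have h2 := integral_two_pi_eq_two_mul (continuous_geomExp (m + 1)).norm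
    (norm_geomExp_two_pi_sub (m + 1))
  have h3 := integral_norm_geomExp_le (Nat.succ_pos m)
  have h4 : ∫ t in Set.Icc 0 (2 * Real.pi), (1 + 2 * ‖geomExp (m + 1) t‖) =
      2 * Real.pi + 2 * ∫ t in Set.Icc 0 (2 * Real.pi), ‖geomExp (m + 1) t‖ := by
    rw [integral_add (by simp) ((continuous_geomExp (m + 1)).norm.integrableOn_Icc.const_mul 2),
      integral_const_mul]
    simp [Real.pi_pos.le]
  have hlog : Real.log (Real.pi * ((m + 1 : ℕ) : ℝ)) ≤ 3 + Real.log (m + 1) := by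
    push_cast
    rw [Real.log_mul Real.pi_ne_zero (by positivity)]
    have := Real.log_le_sub_one_of_pos Real.pi_pos
    linarith [Real.pi_le_four]
  have hl0 : 0 ≤ Real.log ((m : ℝ) + 1) := Real.log_nonneg (by linarith [m.cast_nonneg (α := ℝ)])
  have hπ := Real.pi_pos
  rw [kernelNorm, inv_mul_le_iff₀ Real.two_pi_pos]
  refine h1.trans ?_
  rw [h4, h2]
  have h5 : Real.pi * Real.log (Real.pi * ((m + 1 : ℕ) : ℝ)) ≤ Real.pi * (3 + Real.log (m + 1)) :=
    mul_le_mul_of_nonneg_left hlog hπ.le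
  unfold lebesgueBound
  have h6 : 0 ≤ Real.pi * Real.log ((m : ℝ) + 1) := mul_nonneg hπ.le hl0
  simp only [Nat.succ_eq_add_one] at h3
  have h7 := Real.pi_gt_three
  linarith

lemma geomExp_succ_sub_one (m : ℕ) (t : ℝ) : geomExp (m + 1) t - 1 =
    ∑ k ∈ Finset.range m, Complex.exp (Complex.I * ((((k : ℤ) + 1 : ℤ) * t : ℝ) : ℂ)) := by
  rw [geomExp, Finset.sum_range_succ']
  simp

lemma geomExp_succ_neg_sub_one (m : ℕ) (t : ℝ) : geomExp (m + 1) (-t) - 1 =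
    ∑ k ∈ Finset.range m, Complex.exp (Complex.I * (((-((k : ℤ) + 1) : ℤ) * t : ℝ) : ℂ)) := by
  rw [geomExp_succ_sub_one]
  refine Finset.sum_congr rfl fun k _ => ?_
  congr 1
  push_cast
  ring

lemma trigKernel_one (m : ℕ) (t : ℝ) :
    trigKernel (fun _ => 1) m t = geomExp (m + 1) t + geomExp (m + 1) (-t) - 1 := by
  have h1 := geomExp_succ_sub_one m t
  have h2 := geomExp_succ_neg_sub_one m t
  rw [trigKernel, sum_Icc_neg, Finset.sum_add_distrib]
  simp only [one_mul]
  rw [← h1, ← h2]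
  simp only [Int.cast_zero, zero_mul, Complex.ofReal_zero, mul_zero, Complex.exp_zero]
  ring

lemma trigKernel_conjMultiplier (m : ℕ) (t : ℝ) :
    trigKernel conjMultiplier m t =
      -Complex.I * (geomExp (m + 1) t - geomExp (m + 1) (-t)) := by
  have h1 := geomExp_succ_sub_one m t
  have h2 := geomExp_succ_neg_sub_one m t
  have h3 : ∀ k : ℕ, conjMultiplier ((k : ℤ) + 1) = -Complex.I := fun k => by
    rw [conjMultiplier, Int.sign_eq_one_of_pos (by positivity)]
    simp
  have h4 : ∀ k : ℕ, conjMultiplier (-((k : ℤ) + 1)) = Complex.I := fun k => by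
    rw [conjMultiplier, Int.sign_neg, Int.sign_eq_one_of_pos (by positivity)]
    simp
  rw [trigKernel, sum_Icc_neg, Finset.sum_add_distrib]
  simp only [h3, h4, ← Finset.mul_sum]
  rw [← h1, ← h2]
  simp [conjMultiplier]
  ring

lemma kernelNorm_one_le (m : ℕ) : kernelNorm (fun _ => 1) m ≤ lebesgueBound m := by
  refine kernelNorm_le_of_norm_le fun t => ?_
  rw [trigKernel_one]
  refine (norm_sub_le _ _).trans ?_
  have := norm_add_le (geomExp (m + 1) t) (geomExp (m + 1) (-t))
  rw [norm_geomExp_neg] at this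
  rw [norm_one]
  linarith

lemma kernelNorm_conjMultiplier_le (m : ℕ) : kernelNorm conjMultiplier m ≤ lebesgueBound m := by
  refine kernelNorm_le_of_norm_le fun t => ?_
  rw [trigKernel_conjMultiplier, norm_mul, norm_neg, Complex.norm_I, one_mul]
  have := norm_sub_le (geomExp (m + 1) t) (geomExp (m + 1) (-t))
  rw [norm_geomExp_neg] at this
  linarith

/-- The Fejér multiplier `max 0 (1 - |r| / N)`, written as the average over `q < N` of the
indicator functions of `|r| ≤ q`. -/
def fejerMultiplier (N : ℕ) (r : ℤ) : ℝ :=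
  (N : ℝ)⁻¹ * ∑ q ∈ Finset.range N, if r ∈ Finset.Icc (-(q : ℤ)) q then 1 else 0

/-- Multiplying by the Fejér multiplier averages the truncations of the kernel. -/
lemma kernelNorm_mul_fejerMultiplier_le {a : ℤ → ℂ} (ha : ∀ m, kernelNorm a m ≤ lebesgueBound m)
    (m : ℕ) {N : ℕ} (hN : 0 < N) :
    kernelNorm (fun r => a r * (fejerMultiplier N r : ℂ)) m ≤ lebesgueBound N := by
  have hNR : (0 : ℝ) < N := by exact_mod_cast hN
  have h1 : ∀ t, trigKernel (fun r => a r * (fejerMultiplier N r : ℂ)) m t =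
      (N : ℂ)⁻¹ * ∑ q ∈ Finset.range N, trigKernel a (min q m) t := by
    intro t
    have h2 : ∀ q : ℕ, trigKernel a (min q m) t = ∑ r ∈ Finset.Icc (-(m : ℤ)) m,
        if r ∈ Finset.Icc (-(q : ℤ)) q then
          a r * Complex.exp (Complex.I * ((r * t : ℝ) : ℂ)) else 0 := by
      intro q
      rw [← Finset.sum_filter, trigKernel]
      refine Finset.sum_congr ?_ fun _ _ => rfl
      ext r
      simp only [Finset.mem_Icc, Finset.mem_filter]
      omega
    simp only [h2]
    rw [Finset.sum_comm, trigKernel, Finset.mul_sum]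
    refine Finset.sum_congr rfl fun r _ => ?_
    rw [fejerMultiplier]
    push_cast
    rw [Finset.mul_sum, Finset.mul_sum, Finset.mul_sum, Finset.sum_mul]
    refine Finset.sum_congr rfl fun q _ => ?_
    split_ifs
    · rw [Complex.ofReal_one]
      ring
    · simp
  have h3 : kernelNorm (fun r => a r * (fejerMultiplier N r : ℂ)) m ≤
      (N : ℝ)⁻¹ * ∑ q ∈ Finset.range N, kernelNorm a (min q m) := by
    simp only [kernelNorm]
    rw [← Finset.mul_sum, ← integral_finsetSum _ fun q _ =>
      (continuous_trigKernel a _).norm.integrableOn_Icc, mul_left_comm]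
    refine mul_le_mul_of_nonneg_left ?_ (by positivity)
    rw [← integral_const_mul]
    refine setIntegral_mono ?_ ?_ fun t => ?_
    · exact (continuous_trigKernel _ m).norm.integrableOn_Icc
    · refine Continuous.integrableOn_Icc (continuous_const.mul
        (continuous_finsetSum _ fun q _ => (continuous_trigKernel a _).norm))
    · simp only [h1]
      rw [norm_mul, norm_inv, Complex.norm_natCast]
      exact mul_le_mul_of_nonneg_left (norm_sum_le _ _) (inv_nonneg.2 hNR.le)
  refine h3.trans ?_
  have h4 : ∑ q ∈ Finset.range N, kernelNorm a (min q m) ≤ N * lebesgueBound N := by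
    refine (Finset.sum_le_card_nsmul _ _ (lebesgueBound N) fun q hq => ?_).trans
      (le_of_eq (by simp))
    refine (ha _).trans (lebesgueBound_mono ?_)
    have := Finset.mem_range.1 hq
    omega
  rwa [inv_mul_le_iff₀ hNR]

/-- The Fejér kernel `N⁻¹ |∑_{q < N} exp (i q t)|²`. -/
def fejerKernel (N : ℕ) (t : ℝ) : ℝ := (N : ℝ)⁻¹ * ‖geomExp N t‖ ^ 2

lemma normSq_geomExp (N : ℕ) (t : ℝ) :
    ((‖geomExp N t‖ ^ 2 : ℝ) : ℂ) = ∑ q ∈ Finset.range N, trigKernel (fun _ => 1) q t := by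
  have hneg : ∀ m, geomExp m (-t) = (starRingEnd ℂ) (geomExp m t) := by
    intro m
    unfold geomExp
    rw [map_sum]
    refine Finset.sum_congr rfl fun q _ => ?_
    rw [← Complex.exp_conj]
    congr 1
    simp
  induction N with
  | zero => simp [geomExp]
  | succ N ih =>
    rw [Finset.sum_range_succ, ← ih, trigKernel_one]
    push_cast
    rw [← Complex.mul_conj', ← Complex.mul_conj', ← hneg, ← hneg]
    have e1 : ∀ s : ℝ, geomExp (N + 1) s = geomExp N s + Complex.exp (Complex.I * ((N * s : ℝ) : ℂ)) :=
      fun s => Finset.sum_range_succ _ _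
    have e2 : ∀ s : ℝ, geomExp N s * Complex.exp (Complex.I * ((N * (-s) : ℝ) : ℂ)) =
        geomExp (N + 1) (-s) - 1 := by
      intro s
      rw [geomExp, Finset.sum_mul, geomExp_succ_neg_sub_one, ← Finset.sum_range_reflect]
      refine Finset.sum_congr rfl fun k hk => ?_
      have h3 : ((N - 1 - k : ℕ) : ℝ) = N - 1 - k := by
        have := Finset.mem_range.1 hk
        rw [Nat.cast_sub (by omega), Nat.cast_sub (by omega)]
        simp
      rw [← Complex.exp_add, h3]
      congr 1
      push_cast
      ring
    have e3 := e2 t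
    have e4 := e2 (-t)
    have e5 : Complex.exp (Complex.I * ((N * t : ℝ) : ℂ)) *
        Complex.exp (Complex.I * ((N * -t : ℝ) : ℂ)) = 1 := by
      rw [← Complex.exp_add, ← Complex.exp_zero]
      congr 1
      push_cast
      ring
    rw [neg_neg] at e4
    rw [e1 t, e1 (-t)] at *
    linear_combination e3 + e4 + e5

end Kernels

/-! ### Fejér smoothing of conjugate partial sums -/

section Fejer

/-- The Fejér kernel as a probability measure on `[-π, π]`. -/
def fejerMeasure (N : ℕ) : Measure ℝ :=
  (volume.restrict (Set.Icc (-Real.pi) Real.pi)).withDensity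
    fun t => ENNReal.ofReal ((2 * Real.pi)⁻¹ * fejerKernel N t)

lemma continuous_fejerKernel (N : ℕ) : Continuous (fejerKernel N) := by
  have := continuous_geomExp N
  unfold fejerKernel
  fun_prop

lemma fejerKernel_nonneg (N : ℕ) (t : ℝ) : 0 ≤ fejerKernel N t := by
  unfold fejerKernel
  positivity

lemma integral_fejerMeasure {E : Type*} [NormedAddCommGroup E] [NormedSpace ℝ E] (N : ℕ)
    (φ : ℝ → E) : ∫ t, φ t ∂(fejerMeasure N) =
      ∫ t in (-Real.pi)..Real.pi, ((2 * Real.pi)⁻¹ * fejerKernel N t) • φ t := by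
  have hc := continuous_fejerKernel N
  have hm : Measurable fun t => ENNReal.ofReal ((2 * Real.pi)⁻¹ * fejerKernel N t) := by
    have : Measurable fun t => (2 * Real.pi)⁻¹ * fejerKernel N t :=
      (continuous_const.mul hc).measurable
    exact this.ennreal_ofReal
  rw [fejerMeasure, integral_withDensity_eq_integral_toReal_smul hm (by simp),
    intervalIntegral.integral_of_le (by linarith [Real.pi_pos]), integral_Icc_eq_integral_Ioc]
  congr 1
  ext t
  rw [ENNReal.toReal_ofReal (mul_nonneg (by positivity) (fejerKernel_nonneg N t))]

lemma integrable_fejerMeasure {E : Type*} [NormedAddCommGroup E] [NormedSpace ℝ E] (N : ℕ)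
    {φ : ℝ → E} (hφ : Continuous φ) : Integrable φ (fejerMeasure N) := by
  have hc := continuous_fejerKernel N
  have hm : Measurable fun t => ENNReal.ofReal ((2 * Real.pi)⁻¹ * fejerKernel N t) := by
    have : Measurable fun t => (2 * Real.pi)⁻¹ * fejerKernel N t :=
      (continuous_const.mul hc).measurable
    exact this.ennreal_ofReal
  rw [fejerMeasure, integrable_withDensity_iff_integrable_smul' hm (by simp)]
  have : (fun t => (ENNReal.ofReal ((2 * Real.pi)⁻¹ * fejerKernel N t)).toReal • φ t) =
      fun t => ((2 * Real.pi)⁻¹ * fejerKernel N t) • φ t := by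
    ext t
    rw [ENNReal.toReal_ofReal (mul_nonneg (by positivity) (fejerKernel_nonneg N t))]
  rw [this]
  exact Continuous.integrableOn_Icc ((continuous_const.mul hc).smul hφ)

lemma integral_exp_int_mul (k : ℤ) :
    ∫ t in (-Real.pi)..Real.pi, Complex.exp (Complex.I * ((k * t : ℝ) : ℂ)) =
      if k = 0 then 2 * (Real.pi : ℂ) else 0 := by
  split_ifs with h
  · subst h
    simp
    ring
  · have hk : (Complex.I * k : ℂ) ≠ 0 := mul_ne_zero Complex.I_ne_zero (by exact_mod_cast h)
    have h1 : ∀ t : ℝ, Complex.exp (Complex.I * ((k * t : ℝ) : ℂ)) =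
        Complex.exp ((Complex.I * k) * t) := by
      intro t
      congr 1
      push_cast
      ring
    simp only [h1]
    rw [integral_exp_mul_complex hk, div_eq_zero_iff]
    left
    rw [sub_eq_zero, Complex.exp_eq_exp_iff_exists_int]
    refine ⟨k, ?_⟩
    push_cast
    ring

/-- The Fourier transform of the Fejér kernel is the Fejér multiplier. -/
lemma integral_exp_fejerMeasure (N : ℕ) (r : ℤ) :
    ∫ t, Complex.exp (Complex.I * ((r * t : ℝ) : ℂ)) ∂(fejerMeasure N) = fejerMultiplier N r := by
  rw [integral_fejerMeasure]
  have h1 : ∀ t : ℝ, ((2 * Real.pi)⁻¹ * fejerKernel N t) •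
      Complex.exp (Complex.I * ((r * t : ℝ) : ℂ)) = (2 * (Real.pi : ℂ))⁻¹ * ((N : ℂ)⁻¹ *
      ∑ q ∈ Finset.range N, ∑ s ∈ Finset.Icc (-(q : ℤ)) q,
        Complex.exp (Complex.I * (((s + r : ℤ) * t : ℝ) : ℂ))) := by
    intro t
    have h2 := normSq_geomExp N t
    rw [Complex.real_smul, fejerKernel, Complex.ofReal_mul, Complex.ofReal_mul, h2]
    push_cast
    rw [mul_assoc, mul_assoc, Finset.sum_mul]
    congr 2
    refine Finset.sum_congr rfl fun q _ => ?_
    rw [trigKernel, Finset.sum_mul]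
    refine Finset.sum_congr rfl fun s _ => ?_
    rw [one_mul, ← Complex.exp_add]
    congr 1
    push_cast
    ring
  have hc : ∀ s : ℤ, Continuous fun t : ℝ => Complex.exp (Complex.I * (((s + r : ℤ) * t : ℝ) : ℂ)) :=
    fun s => by fun_prop
  simp only [h1]
  rw [intervalIntegral.integral_const_mul, intervalIntegral.integral_const_mul,
    intervalIntegral.integral_finsetSum fun q _ =>
      (continuous_finsetSum _ fun s _ => hc s).intervalIntegrable _ _]
  have h3 : ∀ q : ℕ, ∫ t in (-Real.pi)..Real.pi, ∑ s ∈ Finset.Icc (-(q : ℤ)) q,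
      Complex.exp (Complex.I * (((s + r : ℤ) * t : ℝ) : ℂ)) =
      2 * (Real.pi : ℂ) * if r ∈ Finset.Icc (-(q : ℤ)) q then 1 else 0 := by
    intro q
    rw [intervalIntegral.integral_finsetSum fun s _ => (hc s).intervalIntegrable _ _]
    simp only [integral_exp_int_mul]
    have h4 : ∀ s : ℤ, (if s + r = 0 then 2 * (Real.pi : ℂ) else 0) =
        if s = -r then 2 * (Real.pi : ℂ) else 0 := by
      intro s
      simp only [add_eq_zero_iff_eq_neg]
    simp only [h4]
    rw [Finset.sum_ite_eq']
    have h5 : -r ∈ Finset.Icc (-(q : ℤ)) q ↔ r ∈ Finset.Icc (-(q : ℤ)) q := by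
      simp only [Finset.mem_Icc]
      omega
    simp only [h5, mul_ite, mul_one, mul_zero]
  simp only [h3]
  rw [← Finset.mul_sum, fejerMultiplier]
  push_cast
  have : (2 * (Real.pi : ℂ)) ≠ 0 := by
    simp
  rw [inv_mul_eq_div, ← mul_assoc, mul_comm ((N : ℂ)⁻¹), mul_assoc, mul_div_cancel_left₀ _ this]
  simp only [apply_ite Complex.ofReal, Complex.ofReal_one, Complex.ofReal_zero]

lemma fejerMultiplier_zero {N : ℕ} (hN : 0 < N) : fejerMultiplier N 0 = 1 := by
  have : (N : ℝ) ≠ 0 := by positivity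
  simp [fejerMultiplier, this]

lemma fejerMultiplier_one {N : ℕ} (hN : 0 < N) : fejerMultiplier N 1 = 1 - (N : ℝ)⁻¹ := by
  obtain ⟨n, rfl⟩ : ∃ n, N = n + 1 := ⟨N - 1, by omega⟩
  have h : ∀ q : ℕ, (1 : ℤ) ∈ Finset.Icc (-((q + 1 : ℕ) : ℤ)) ((q + 1 : ℕ) : ℤ) := by
    intro q
    simp only [Finset.mem_Icc]
    omega
  rw [fejerMultiplier, Finset.sum_range_succ']
  simp only [h, if_true]
  simp
  field_simp
  ring

lemma isProbabilityMeasure_fejerMeasure {N : ℕ} (hN : 0 < N) :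
    IsProbabilityMeasure (fejerMeasure N) := by
  have h := integral_exp_fejerMeasure N 0
  rw [fejerMultiplier_zero hN] at h
  simp only [Int.cast_zero, zero_mul, Complex.ofReal_zero, mul_zero, Complex.exp_zero,
    integral_const, Complex.real_smul, mul_one, Complex.ofReal_one, Complex.ofReal_eq_one] at h
  constructor
  rw [Measure.real] at h
  rwa [ENNReal.toReal_eq_one_iff] at h

lemma integral_one_sub_cos_fejerMeasure {N : ℕ} (hN : 0 < N) :
    ∫ t, (1 - Real.cos t) ∂(fejerMeasure N) = (N : ℝ)⁻¹ := by
  have := isProbabilityMeasure_fejerMeasure hN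
  have h := congrArg Complex.re (integral_exp_fejerMeasure N 1)
  have hi : Integrable (fun t : ℝ => Complex.exp (Complex.I * (((1 : ℤ) * t : ℝ) : ℂ)))
      (fejerMeasure N) := integrable_fejerMeasure N (by fun_prop)
  have h2 : ∀ t : ℝ, (Complex.exp (Complex.I * (((1 : ℤ) * t : ℝ) : ℂ))).re = Real.cos t := by
    intro t
    rw [mul_comm, Complex.exp_ofReal_mul_I_re]
    simp
  have h3 := integral_re (𝕜 := ℂ) hi
  simp only [RCLike.re_eq_complex_re] at h3
  rw [← h3] at h
  simp only [h2] at h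
  rw [integral_sub (integrable_const _) (integrable_fejerMeasure N Real.continuous_cos), h,
    fejerMultiplier_one hN]
  simp

/-- The first absolute moment of the Fejér kernel. -/
lemma integral_abs_fejerMeasure_le {N : ℕ} (hN : 0 < N) :
    ∫ t, |t| ∂(fejerMeasure N) ≤ 4 / Real.sqrt N := by
  have hp := isProbabilityMeasure_fejerMeasure hN
  have hNR : (0 : ℝ) < N := by exact_mod_cast hN
  set s := Real.sqrt N with hs
  have hs0 : 0 < s := Real.sqrt_pos.2 hNR
  have hss : s * s = N := Real.mul_self_sqrt hNR.le
  have hpt : ∀ t ∈ Set.Icc (-Real.pi) Real.pi,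
      |t| ≤ (s * (Real.pi ^ 2 / 2 * (1 - Real.cos t)) + s⁻¹) / 2 := by
    intro t ht
    have h1 : |t| ≤ Real.pi := abs_le.2 ht
    have h2 := Real.mul_le_sin (x := |t| / 2) (by positivity) (by linarith)
    have h3 := Real.sin_sq_eq_half_sub (|t| / 2)
    rw [mul_div_cancel₀ _ (two_ne_zero' ℝ), Real.cos_abs] at h3
    have h4 : 2 / Real.pi * (|t| / 2) = |t| / Real.pi := by ring
    rw [h4] at h2
    have h5 : (|t| / Real.pi) ^ 2 ≤ Real.sin (|t| / 2) ^ 2 :=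
      pow_le_pow_left₀ (by positivity) h2 2
    have h6 : t ^ 2 ≤ Real.pi ^ 2 / 2 * (1 - Real.cos t) := by
      rw [h3, div_pow, sq_abs, div_le_iff₀ (by positivity)] at h5
      linarith
    have h7 : 2 * |t| ≤ s * t ^ 2 + s⁻¹ := by
      have h8 : 0 ≤ s⁻¹ * (s * |t| - 1) ^ 2 := by positivity
      have h9 : s⁻¹ * (s * |t| - 1) ^ 2 = s * |t| ^ 2 - 2 * |t| + s⁻¹ := by
        field_simp
        ring
      rw [h9, sq_abs] at h8
      linarith
    have h10 := mul_le_mul_of_nonneg_left h6 hs0.le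
    linarith
  have hae : ∀ᵐ t ∂(fejerMeasure N), t ∈ Set.Icc (-Real.pi) Real.pi := by
    have : fejerMeasure N ≪ volume.restrict (Set.Icc (-Real.pi) Real.pi) :=
      withDensity_absolutelyContinuous _ _
    exact this.ae_le (ae_restrict_mem measurableSet_Icc)
  have hcos : Integrable (fun t => 1 - Real.cos t) (fejerMeasure N) :=
    integrable_fejerMeasure N (by fun_prop)
  calc ∫ t, |t| ∂(fejerMeasure N)
      ≤ ∫ t, (s * (Real.pi ^ 2 / 2 * (1 - Real.cos t)) + s⁻¹) / 2 ∂(fejerMeasure N) :=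
        integral_mono_ae (integrable_fejerMeasure N continuous_abs)
          (integrable_fejerMeasure N (by fun_prop)) (hae.mono hpt)
    _ = (s * (Real.pi ^ 2 / 2 * (N : ℝ)⁻¹) + s⁻¹) / 2 := by
        rw [integral_div, integral_add ((hcos.const_mul _).const_mul _) (integrable_const _),
          integral_const_mul, integral_const_mul, integral_one_sub_cos_fejerMeasure hN]
        simp
    _ = (Real.pi ^ 2 / 4 + 1 / 2) / s := by
        rw [← hss]
        field_simp
        ring
    _ ≤ 4 / s := by
        have := Real.pi_lt_d2
        have h1 : Real.pi ^ 2 ≤ 3.15 ^ 2 := pow_le_pow_left₀ Real.pi_pos.le this.le 2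
        gcongr
        norm_num at h1 ⊢
        linarith

variable {d : ℕ}

lemma integral_character_pi_fejerMeasure {N : ℕ} (hN : 0 < N) (ν : Fin d → ℤ) :
    ∫ τ, character ν τ ∂(Measure.pi fun _ : Fin d => fejerMeasure N) =
      ∏ k, (fejerMultiplier N (ν k) : ℂ) := by
  have := isProbabilityMeasure_fejerMeasure hN
  simp only [character_eq_prod]
  rw [integral_fintype_prod_eq_prod
    (fun (k : Fin d) (t : ℝ) => Complex.exp (Complex.I * ((ν k * t : ℝ) : ℂ)))]
  simp only [integral_exp_fejerMeasure]

lemma integrable_abs_pi_fejerMeasure {N : ℕ} (hN : 0 < N) (i : Fin d) :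
    Integrable (fun τ : Fin d → ℝ => |τ i|) (Measure.pi fun _ : Fin d => fejerMeasure N) := by
  have := isProbabilityMeasure_fejerMeasure hN
  exact (measurePreserving_eval (fun _ : Fin d => fejerMeasure N) i).integrable_comp_of_integrable
    (integrable_fejerMeasure N continuous_abs)

lemma integral_abs_pi_fejerMeasure_le {N : ℕ} (hN : 0 < N) (i : Fin d) :
    ∫ τ : Fin d → ℝ, |τ i| ∂(Measure.pi fun _ : Fin d => fejerMeasure N) ≤ 4 / Real.sqrt N := by
  have := isProbabilityMeasure_fejerMeasure hN
  have hmp := measurePreserving_eval (fun _ : Fin d => fejerMeasure N) i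
  have h := integral_map (μ := Measure.pi fun _ : Fin d => fejerMeasure N)
    (φ := Function.eval i) hmp.aemeasurable (f := fun t : ℝ => |t|)
    continuous_abs.aestronglyMeasurable
  rw [hmp.map_eq] at h
  exact h.symm.le.trans (integral_abs_fejerMeasure_le hN)

/-- The effect of the Fejér multipliers on a partial sum is an average of increments. -/
lemma trigSum_fejer_sub {F : (Fin d → ℝ) → ℝ} (hF : IsIntegrableTorusFun F)
    (hFτ : ∀ τ : Fin d → ℝ, IsIntegrableTorusFun fun x => F (x + τ)) (a : Fin d → ℤ → ℂ)
    (m : ℕ) {N : ℕ} (hN : 0 < N) (x : Fin d → ℝ) :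
    trigSum F (fun k r => a k r * (fejerMultiplier N r : ℂ)) m x - trigSum F a m x =
      ∫ τ, trigSum (fun y => F (y + τ) - F y) a m x ∂(Measure.pi fun _ : Fin d => fejerMeasure N) := by
  have := isProbabilityMeasure_fejerMeasure hN
  have hi : ∀ ν : Fin d → ℤ, Integrable (character ν)
      (Measure.pi fun _ : Fin d => fejerMeasure N) := fun ν =>
    Integrable.of_bound (continuous_character ν).aestronglyMeasurable 1
      (ae_of_all _ fun τ => by simp)
  simp only [trigSum, fourierCoefficient_translate_sub hF _ (hFτ _)]
  rw [integral_finsetSum, ← Finset.sum_sub_distrib]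
  · refine Finset.sum_congr rfl fun ν _ => ?_
    rw [integral_const_mul, integral_mul_const, integral_mul_const,
      integral_sub (hi ν) (integrable_const _), integral_character_pi_fejerMeasure hN,
      Finset.prod_mul_distrib]
    simp
    ring
  · intro ν _
    exact ((((hi ν).sub (integrable_const _)).mul_const _).mul_const _).const_mul _

/-- The multipliers of the `j`-th conjugate partial sums. -/
def conjMultipliers (j k : Fin d) : ℤ → ℂ := if k = j then conjMultiplier else fun _ => 1

lemma conjPartialSum_eq_trigSum (F : (Fin d → ℝ) → ℝ) (j : Fin d) (m : ℕ) :
    conjPartialSum F j m = trigSum F (conjMultipliers j) m := by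
  ext x
  rw [conjPartialSum, trigSum, Finset.mul_sum]
  refine Finset.sum_congr rfl fun ν _ => ?_
  have : ∏ k, conjMultipliers j k (ν k) = conjMultiplier (ν j) := by
    rw [Finset.prod_eq_single j]
    · simp [conjMultipliers]
    · intro k _ hk
      simp [conjMultipliers, hk]
    · simp
  rw [this, conjMultiplier]
  ring

lemma kernelNorm_conjMultipliers_le (j k : Fin d) (m : ℕ) :
    kernelNorm (conjMultipliers j k) m ≤ lebesgueBound m := by
  unfold conjMultipliers
  split_ifs
  · exact kernelNorm_conjMultiplier_le m
  · exact kernelNorm_one_le m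

variable {F : (Fin d → ℝ) → ℝ} {C : ℝ}

/-- Splitting a partial sum into its Fejér smoothing, whose kernels have small norm, and the
remainder, which is an average of small increments. -/
lemma HasLipschitzIncrements.gridSum_trigSum_le_fejer (hF : HasLipschitzIncrements F C)
    {a : Fin d → ℤ → ℂ} (ha : ∀ k m, kernelNorm (a k) m ≤ lebesgueBound m) (m : ℕ) {N : ℕ}
    (hN : 0 < N) {u : Finset (Fin d)} (hu : u.Nonempty) (n : ℕ) (p : Fin d → ℕ → ℝ)
    (b : Fin d → ℝ) (hp : IsPeriodGrid u p) :
    gridSum (trigSum F a m) u n p b ≤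
      lebesgueBound N ^ d * (C * (2 * Real.pi)) +
        lebesgueBound m ^ d * (C * (d * (4 / Real.sqrt N))) := by
  have hprob := isProbabilityMeasure_fejerMeasure hN
  have hint := hF.isIntegrable
  set aσ : Fin d → ℤ → ℂ := fun k r => a k r * (fejerMultiplier N r : ℂ) with haσ
  set μ := Measure.pi fun _ : Fin d => fejerMeasure N with hμ
  have hprod : ∀ {b : Fin d → ℤ → ℂ} {q M : ℕ}, (∀ k, kernelNorm (b k) q ≤ lebesgueBound M) →
      ∏ k, kernelNorm (b k) q ≤ lebesgueBound M ^ d := by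
    intro b q M hb
    refine (Finset.prod_le_prod (fun k _ => kernelNorm_nonneg _ _) fun k _ => hb k).trans ?_
    simp
  have hdec : trigSum F a m = fun x => trigSum F aσ m x -
      ∫ τ, trigSum (fun y => F (y + τ) - F y) a m x ∂μ := by
    ext x
    rw [← trigSum_fejer_sub hint hF.isIntegrable_translate a m hN x]
    ring
  rw [hdec]
  refine (gridSum_sub_le _ _ u n p b).trans (add_le_add ?_ ?_)
  · refine (gridSum_trigSum_le hint aσ m u n p b (hF.ae_gridSum_le hu n p b hp)).trans ?_
    exact mul_le_mul_of_nonneg_right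
      (hprod fun k => kernelNorm_mul_fejerMultiplier_le (ha k) m hN)
      (mul_nonneg hF.nonneg Real.two_pi_pos.le)
  · have hi : ∀ x, Integrable (fun τ => trigSum (fun y => F (y + τ) - F y) a m x) μ := by
      intro x
      simp only [trigSum, fourierCoefficient_translate_sub hint _ (hF.isIntegrable_translate _)]
      refine integrable_finsetSum _ fun ν _ => ?_
      have hc : Integrable (character ν) μ :=
        Integrable.of_bound (continuous_character ν).aestronglyMeasurable 1
          (ae_of_all _ fun τ => by simp)
      exact (((hc.sub (integrable_const _)).mul_const _).mul_const _).const_mul _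
    have hC : Integrable (fun τ : Fin d → ℝ => lebesgueBound m ^ d * (C * ∑ i, |τ i|)) μ :=
      ((integrable_finsetSum _ fun i _ => integrable_abs_pi_fejerMeasure hN i).const_mul _).const_mul _
    refine (gridSum_integral_le hi u n p b hC (ae_of_all _ fun τ => ?_)).trans ?_
    · refine (gridSum_trigSum_le ((hF.isIntegrable_translate τ).sub hint) a m u n p b
        (hF.ae_gridSum_translate_sub_le u n p b hp τ)).trans ?_
      exact mul_le_mul_of_nonneg_right (hprod fun k => ha k m)
        (mul_nonneg hF.nonneg (Finset.sum_nonneg fun _ _ => abs_nonneg _))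
    · rw [integral_const_mul, integral_const_mul,
        integral_finsetSum _ fun i _ => integrable_abs_pi_fejerMeasure hN i]
      have h1 : ∑ i : Fin d, ∫ τ : Fin d → ℝ, |τ i| ∂μ ≤ d * (4 / Real.sqrt N) := by
        refine (Finset.sum_le_sum fun i _ => integral_abs_pi_fejerMeasure_le hN i).trans ?_
        simp
      have h2 : 0 ≤ lebesgueBound m := zero_le_one.trans (one_le_lebesgueBound m)
      have h3 := hF.nonneg
      gcongr

lemma exists_log_pow_le (k : ℕ) {ε : ℝ} (hε : 0 < ε) :
    ∃ K : ℝ, ∀ y : ℝ, 1 ≤ y → Real.log y ^ k ≤ ε * y + K := by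
  have h := (Real.isLittleO_pow_log_id_atTop (n := k)).def hε
  obtain ⟨Y, hY⟩ := eventually_atTop.1 h
  refine ⟨Real.log (max 1 Y) ^ k, fun y hy => ?_⟩
  have h0 : 0 ≤ Real.log (max 1 Y) := Real.log_nonneg (le_max_left _ _)
  by_cases h1 : Y ≤ y
  · have h2 := hY y h1
    rw [Real.norm_eq_abs, Real.norm_eq_abs, id, abs_of_nonneg (by linarith : (0 : ℝ) ≤ y)] at h2
    have := le_abs_self (Real.log y ^ k)
    have := pow_nonneg h0 k
    linarith
  · have h2 : Real.log y ≤ Real.log (max 1 Y) :=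
      Real.log_le_log (by linarith) ((not_le.1 h1).le.trans (le_max_right _ _))
    have h3 := pow_le_pow_left₀ (Real.log_nonneg hy) h2 k
    have : 0 ≤ ε * y := by positivity
    linarith

/-- The variation of the conjugate partial sums of a function with Lipschitz increments is
`o(log m)`. The Fejér smoothing is taken of order a power of `log m`, so that it costs only powers
of `log log m`. -/
theorem HasLipschitzIncrements.exists_gridSum_conjPartialSum_le (hF : HasLipschitzIncrements F C)
    (j : Fin d) {ε : ℝ} (hε : 0 < ε) :
    ∃ K : ℝ, ∀ (m : ℕ) (u : Finset (Fin d)) (n : ℕ) (p : Fin d → ℕ → ℝ) (b : Fin d → ℝ),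
      u.Nonempty → IsPeriodGrid u p →
        gridSum (conjPartialSum F j m) u n p b ≤ ε * Real.log (m + 1) + K := by
  have hC := hF.nonneg
  set A : ℝ := (8 * (1 + (2 * d + 1))) ^ d * (C * (2 * Real.pi)) with hA
  have hA0 : 0 ≤ A := by positivity
  obtain ⟨K, hK⟩ := exists_log_pow_le d (ε := ε / (A + 1)) (by positivity)
  refine ⟨A * K + 3 * ε + 8 ^ d * (C * (d * 4)), fun m u n p b hu hp => ?_⟩
  set X : ℝ := Real.log (m + 1) with hX
  have hX0 : 0 ≤ X := Real.log_nonneg (by linarith [m.cast_nonneg (α := ℝ)])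
  -- the remainder of the smoothing is of order `X ^ d / √N`, hence bounded for this choice of `N`
  set N : ℕ := ⌈(1 + X) ^ (2 * d)⌉₊ with hN
  have hone : (1 : ℝ) ≤ (1 + X) ^ (2 * d) := one_le_pow₀ (by linarith)
  have hN1 : (1 + X) ^ (2 * d) ≤ N := Nat.le_ceil _
  have hN2 : (N : ℝ) + 1 ≤ (3 + X) ^ (2 * d + 1) := by
    have h1 : (N : ℝ) < (1 + X) ^ (2 * d) + 1 := Nat.ceil_lt_add_one (by positivity)
    have h2 : (1 + X) ^ (2 * d) ≤ (3 + X) ^ (2 * d) := by gcongr; norm_num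
    have h3 : (3 : ℝ) * (3 + X) ^ (2 * d) ≤ (3 + X) ^ (2 * d + 1) := by
      rw [pow_succ, mul_comm]
      gcongr
      linarith
    linarith
  have hNpos : 0 < N := by
    have : (0 : ℝ) < N := by linarith
    exact_mod_cast this
  have hlog1 : 1 ≤ Real.log (3 + X) := by
    rw [Real.le_log_iff_exp_le (by linarith)]
    linarith [Real.exp_one_lt_d9]
  have hℓN : lebesgueBound N ≤ 8 * (1 + (2 * d + 1)) * Real.log (3 + X) := by
    have h1 : Real.log ((N : ℝ) + 1) ≤ (2 * d + 1) * Real.log (3 + X) := by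
      refine (Real.log_le_log (by positivity) hN2).trans ?_
      rw [Real.log_pow]
      push_cast
      exact le_rfl
    unfold lebesgueBound
    linarith
  have h1 := hF.gridSum_trigSum_le_fejer (kernelNorm_conjMultipliers_le j) m hNpos hu n p b hp
  rw [conjPartialSum_eq_trigSum]
  refine h1.trans ?_
  have h2 : lebesgueBound N ^ d * (C * (2 * Real.pi)) ≤ A * K + 3 * ε + ε * X := by
    have h3 : lebesgueBound N ^ d ≤ (8 * (1 + (2 * d + 1)) * Real.log (3 + X)) ^ d :=
      pow_le_pow_left₀ (zero_le_one.trans (one_le_lebesgueBound N)) hℓN d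
    have h4 : lebesgueBound N ^ d * (C * (2 * Real.pi)) ≤ A * Real.log (3 + X) ^ d := by
      have := mul_le_mul_of_nonneg_right h3 (mul_nonneg hC Real.two_pi_pos.le)
      rw [mul_pow] at this
      refine this.trans (le_of_eq ?_)
      rw [hA]
      ring
    have h5 := mul_le_mul_of_nonneg_left (hK (3 + X) (by linarith)) hA0
    have h6 : A * (ε / (A + 1) * (3 + X)) ≤ ε * (3 + X) := by
      have : A / (A + 1) ≤ 1 := by
        rw [div_le_one (by positivity)]
        linarith
      calc A * (ε / (A + 1) * (3 + X)) = A / (A + 1) * (ε * (3 + X)) := by ring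
        _ ≤ 1 * (ε * (3 + X)) := by gcongr
        _ = _ := one_mul _
    linarith
  have h7 : lebesgueBound m ^ d * (C * (d * (4 / Real.sqrt N))) ≤ 8 ^ d * (C * (d * 4)) := by
    have h8 : (1 + X) ^ d ≤ Real.sqrt N := by
      refine Real.le_sqrt_of_sq_le ?_
      rwa [← pow_mul, mul_comm d 2]
    have h9 : 0 < (1 + X) ^ d := by positivity
    have h10 : lebesgueBound m ^ d = 8 ^ d * (1 + X) ^ d := by
      rw [lebesgueBound, mul_pow]
    rw [h10]
    have h11 : 4 / Real.sqrt N ≤ 4 / (1 + X) ^ d := by gcongr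
    calc 8 ^ d * (1 + X) ^ d * (C * (d * (4 / Real.sqrt N)))
        ≤ 8 ^ d * (1 + X) ^ d * (C * (d * (4 / (1 + X) ^ d))) := by gcongr
      _ = 8 ^ d * (C * (d * 4)) := by field_simp
  linarith

end Fejer

/-! ### Logarithmic means -/

section LogMeans

/-- The logarithmic means `(log n)⁻¹ ∑_{1 ≤ r ≤ n} A r / r` of a sequence. -/
def logMean (A : ℕ → ℂ) (n : ℕ) : ℂ :=
  (∑ k ∈ Finset.range n, A (k + 1) / ((k : ℂ) + 1)) / (Real.log n : ℂ)

/-- The real harmonic numbers. -/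
def harmonicSum (n : ℕ) : ℝ := ∑ k ∈ Finset.range n, 1 / ((k : ℝ) + 1)

lemma harmonicSum_eq (n : ℕ) : harmonicSum n = (harmonic n : ℝ) := by
  rw [harmonicSum, harmonic]
  push_cast
  simp

lemma harmonicSum_le (n : ℕ) : harmonicSum n ≤ 1 + Real.log n := by
  rw [harmonicSum_eq]
  exact harmonic_le_one_add_log n

lemma log_add_one_le_harmonicSum (n : ℕ) : Real.log (n + 1) ≤ harmonicSum n := by
  rw [harmonicSum_eq]
  exact_mod_cast log_add_one_le_harmonic n

lemma one_le_log_natCast {n : ℕ} (hn : 3 ≤ n) : 1 ≤ Real.log n := by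
  have h : (3 : ℝ) ≤ n := by exact_mod_cast hn
  rw [Real.le_log_iff_exp_le (by linarith)]
  linarith [Real.exp_one_lt_d9]

lemma tendsto_log_natCast : Tendsto (fun n : ℕ => Real.log n) atTop atTop :=
  Real.tendsto_log_atTop.comp tendsto_natCast_atTop_atTop

lemma tendsto_const_div_log (c : ℝ) : Tendsto (fun n : ℕ => c / Real.log n) atTop (𝓝 0) :=
  tendsto_const_nhds.div_atTop tendsto_log_natCast

lemma tendsto_harmonicSum_div_log :
    Tendsto (fun n : ℕ => harmonicSum n / Real.log n) atTop (𝓝 1) := by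
  have h1 : Tendsto (fun n : ℕ => 1 / Real.log n + 1) atTop (𝓝 1) := by
    simpa using (tendsto_const_div_log 1).add_const 1
  refine tendsto_of_tendsto_of_tendsto_of_le_of_le' tendsto_const_nhds h1 ?_ ?_
  · filter_upwards [eventually_ge_atTop 3] with n hn
    have h := one_le_log_natCast hn
    rw [le_div_iff₀ (by linarith), one_mul]
    refine le_trans (Real.log_le_log (by positivity) (by linarith)) (log_add_one_le_harmonicSum n)
  · filter_upwards [eventually_ge_atTop 3] with n hn
    have h := one_le_log_natCast hn
    rw [div_add_one (by linarith)]
    exact div_le_div_of_nonneg_right (harmonicSum_le n) (by linarith)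

lemma logMean_sub (A B : ℕ → ℂ) (n : ℕ) :
    logMean (fun r => A r - B r) n = logMean A n - logMean B n := by
  simp [logMean, sub_div, Finset.sum_sub_distrib]

lemma logMean_add (A B : ℕ → ℂ) (n : ℕ) : logMean (A + B) n = logMean A n + logMean B n := by
  simp [logMean, add_div, Finset.sum_add_distrib]

lemma logMean_smul (c : ℂ) (A : ℕ → ℂ) (n : ℕ) : logMean (c • A) n = c * logMean A n := by
  simp only [logMean, Pi.smul_apply, smul_eq_mul, mul_div_assoc, ← Finset.mul_sum]

lemma norm_logMean_le {A : ℕ → ℂ} {R : ℝ} (hA : ∀ r, ‖A r‖ ≤ R) {n : ℕ} (hn : 3 ≤ n) :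
    ‖logMean A n‖ ≤ 2 * R := by
  have hlog := one_le_log_natCast hn
  have hR : 0 ≤ R := (norm_nonneg _).trans (hA 0)
  have h1 : ‖∑ k ∈ Finset.range n, A (k + 1) / ((k : ℂ) + 1)‖ ≤ R * harmonicSum n := by
    refine (norm_sum_le _ _).trans ?_
    rw [harmonicSum, Finset.mul_sum]
    refine Finset.sum_le_sum fun k _ => ?_
    have h2 : ‖(k : ℂ) + 1‖ = (k : ℝ) + 1 := by
      rw [← Nat.cast_add_one, Complex.norm_natCast]
      push_cast
      rfl
    rw [norm_div, h2, mul_one_div]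
    exact div_le_div_of_nonneg_right (hA _) (by positivity)
  have h3 : R * harmonicSum n ≤ R * (2 * Real.log n) :=
    mul_le_mul_of_nonneg_left ((harmonicSum_le n).trans (by linarith)) hR
  rw [logMean, norm_div, Complex.norm_real, Real.norm_eq_abs, abs_of_nonneg (by linarith),
    div_le_iff₀ (by linarith)]
  linarith

/-- The sequences with a logarithmic mean are closed under uniform limits. -/
lemma exists_tendsto_logMean_of_approx {A : ℕ → ℂ}
    (h : ∀ ε : ℝ, 0 < ε → ∃ B : ℕ → ℂ, (∃ μ, Tendsto (logMean B) atTop (𝓝 μ)) ∧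
      ∀ r, ‖A r - B r‖ ≤ ε) : ∃ μ, Tendsto (logMean A) atTop (𝓝 μ) := by
  refine cauchySeq_tendsto_of_complete (Metric.cauchySeq_iff.2 fun ε hε => ?_)
  obtain ⟨B, ⟨μ, hμ⟩, hB⟩ := h (ε / 8) (by positivity)
  obtain ⟨N, hN⟩ := Metric.cauchySeq_iff.1 hμ.cauchySeq (ε / 4) (by positivity)
  refine ⟨max N 3, fun m hm n hn => ?_⟩
  have h1 : ∀ k, max N 3 ≤ k → dist (logMean A k) (logMean B k) ≤ ε / 4 := by
    intro k hk
    have := norm_logMean_le hB (le_of_max_le_right hk)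
    rw [logMean_sub] at this
    rw [dist_eq_norm]
    linarith
  have h2 := hN m (le_of_max_le_left hm) n (le_of_max_le_left hn)
  have h3 := h1 m hm
  have h4 := h1 n hn
  rw [dist_comm] at h4
  have h5 := dist_triangle4 (logMean A m) (logMean B m) (logMean B n) (logMean A n)
  linarith

/-- The sequence `r ↦ exp (i r β)`. -/
def expSeq (β : ℝ) (r : ℕ) : ℂ := Complex.exp (Complex.I * ((r * β : ℝ) : ℂ))

@[simp] lemma norm_expSeq (β : ℝ) (r : ℕ) : ‖expSeq β r‖ = 1 := by
  rw [expSeq, mul_comm, Complex.norm_exp_ofReal_mul_I]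

lemma expSeq_add (β γ : ℝ) (r : ℕ) : expSeq (β + γ) r = expSeq β r * expSeq γ r := by
  rw [expSeq, expSeq, expSeq, ← Complex.exp_add]
  congr 1
  push_cast
  ring

lemma conj_expSeq (β : ℝ) (r : ℕ) : (starRingEnd ℂ) (expSeq β r) = expSeq (-β) r := by
  rw [expSeq, expSeq, ← Complex.exp_conj]
  congr 1
  simp

/-- Dirichlet's test for `∑ exp (i r β) / r`. -/
lemma exists_norm_sum_expSeq_div_le {β : ℝ} (hβ : Real.sin (β / 2) ≠ 0) :
    ∃ K : ℝ, ∀ n, ‖∑ k ∈ Finset.range n, expSeq β (k + 1) / ((k : ℂ) + 1)‖ ≤ K := by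
  have hanti : Antitone fun k : ℕ => 1 / ((k : ℝ) + 1) := by
    intro a b hab
    have : (a : ℝ) ≤ b := by exact_mod_cast hab
    simp only
    gcongr
  have hb : ∀ n, ‖∑ k ∈ Finset.range n, expSeq β (k + 1)‖ ≤ 1 / |Real.sin (β / 2)| + 1 := by
    intro n
    have h1 : ∑ k ∈ Finset.range n, expSeq β (k + 1) = geomExp (n + 1) β - 1 := by
      rw [geomExp_succ_sub_one]
      refine Finset.sum_congr rfl fun k _ => ?_
      simp [expSeq]
    rw [h1]
    refine (norm_sub_le _ _).trans (add_le_add ?_ (by simp))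
    rw [le_div_iff₀ (abs_pos.2 hβ)]
    exact norm_geomExp_mul_abs_sin_le _ _
  have h := hanti.cauchySeq_series_mul_of_tendsto_zero_of_bounded
    tendsto_one_div_add_atTop_nhds_zero_nat hb
  obtain ⟨K, hK⟩ := h.isBounded_range.exists_norm_le
  refine ⟨K, fun n => ?_⟩
  refine le_trans (le_of_eq ?_) (hK _ ⟨n, rfl⟩)
  congr 1
  refine Finset.sum_congr rfl fun k _ => ?_
  rw [Complex.real_smul]
  push_cast
  ring

lemma tendsto_logMean_expSeq {β : ℝ} (hβ : Real.sin (β / 2) ≠ 0) :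
    Tendsto (logMean (expSeq β)) atTop (𝓝 0) := by
  obtain ⟨K, hK⟩ := exists_norm_sum_expSeq_div_le hβ
  refine squeeze_zero_norm' ?_ (tendsto_const_div_log K)
  filter_upwards [eventually_ge_atTop 3] with n hn
  have := one_le_log_natCast hn
  rw [logMean, norm_div, Complex.norm_real, Real.norm_eq_abs,
    abs_of_nonneg (by linarith : (0 : ℝ) ≤ Real.log n)]
  exact div_le_div_of_nonneg_right (hK n) (by linarith)

lemma tendsto_logMean_one : Tendsto (logMean fun _ => 1) atTop (𝓝 1) := by
  have h := (Complex.continuous_ofReal.tendsto _).comp tendsto_harmonicSum_div_log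
  rw [Complex.ofReal_one] at h
  refine h.congr fun n => ?_
  simp only [Function.comp, logMean, harmonicSum]
  push_cast
  rfl

lemma exists_tendsto_logMean_expSeq (β : ℝ) : ∃ μ, Tendsto (logMean (expSeq β)) atTop (𝓝 μ) := by
  by_cases hβ : Real.sin (β / 2) = 0
  · refine ⟨1, ?_⟩
    have : expSeq β = fun _ => 1 := by
      obtain ⟨n, hn⟩ := Real.sin_eq_zero_iff.1 hβ
      ext r
      rw [expSeq, ← Complex.exp_zero, Complex.exp_eq_exp_iff_exists_int]
      refine ⟨n * r, ?_⟩
      have h2 : β = 2 * (n * Real.pi) := by linarith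
      rw [h2]
      push_cast
      ring
    rw [this]
    exact tendsto_logMean_one
  · exact ⟨0, tendsto_logMean_expSeq hβ⟩

/-- The trigonometric polynomials, as sequences. -/
def trigPolySeq : Subalgebra ℂ (ℕ → ℂ) := Algebra.adjoin ℂ (Set.range expSeq)

lemma expSeq_mem (β : ℝ) : expSeq β ∈ trigPolySeq := Algebra.subset_adjoin ⟨β, rfl⟩

lemma exists_tendsto_logMean_of_mem {A : ℕ → ℂ} (hA : A ∈ trigPolySeq) :
    ∃ μ, Tendsto (logMean A) atTop (𝓝 μ) := by
  have hA' : A ∈ Submodule.span ℂ (Submonoid.closure (Set.range expSeq) : Set (ℕ → ℂ)) := by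
    rw [← Algebra.adjoin_eq_span]
    exact hA
  clear hA
  induction hA' using Submodule.span_induction with
  | mem x hx =>
    have : x ∈ Set.range expSeq := by
      induction hx using Submonoid.closure_induction with
      | mem x hx => exact hx
      | one =>
        refine ⟨0, ?_⟩
        ext r
        simp [expSeq]
      | mul x y _ _ hx hy =>
        obtain ⟨β, rfl⟩ := hx
        obtain ⟨γ, rfl⟩ := hy
        exact ⟨β + γ, funext fun r => expSeq_add β γ r⟩
    obtain ⟨β, rfl⟩ := this
    exact exists_tendsto_logMean_expSeq β
  | zero =>
    refine ⟨0, tendsto_const_nhds.congr fun n => ?_⟩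
    simp [logMean]
  | add x y _ _ hx hy =>
    obtain ⟨μ, hμ⟩ := hx
    obtain ⟨ν, hν⟩ := hy
    exact ⟨μ + ν, (hμ.add hν).congr fun n => (logMean_add x y n).symm⟩
  | smul c x _ hx =>
    obtain ⟨μ, hμ⟩ := hx
    exact ⟨c * μ, (hμ.const_mul c).congr fun n => (logMean_smul c x n).symm⟩

lemma star_mem_trigPolySeq {q : ℕ → ℂ} (hq : q ∈ trigPolySeq) :
    (fun r => (starRingEnd ℂ) (q r)) ∈ trigPolySeq := by
  induction hq using Algebra.adjoin_induction with
  | mem x hx =>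
    obtain ⟨β, rfl⟩ := hx
    simp only [conj_expSeq]
    exact expSeq_mem (-β)
  | algebraMap c => exact trigPolySeq.algebraMap_mem ((starRingEnd ℂ) c)
  | add x y _ _ hx hy =>
    simp only [Pi.add_apply, map_add]
    exact trigPolySeq.add_mem hx hy
  | mul x y _ _ hx hy =>
    simp only [Pi.mul_apply, map_mul]
    exact trigPolySeq.mul_mem hx hy

/-- The logarithmic means of the absolute values of a sequence. -/
def absLogMean (s : ℕ → ℂ) (n : ℕ) : ℝ :=
  (∑ k ∈ Finset.range n, ‖s (k + 1)‖ / ((k : ℝ) + 1)) / Real.log n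

lemma ofReal_absLogMean (s : ℕ → ℂ) (n : ℕ) :
    (absLogMean s n : ℂ) = logMean (fun r => (‖s r‖ : ℂ)) n := by
  simp [absLogMean, logMean]

lemma norm_logMean_le_absLogMean (s : ℕ → ℂ) (n : ℕ) : ‖logMean s n‖ ≤ absLogMean s n := by
  rw [logMean, absLogMean, norm_div, Complex.norm_real, Real.norm_eq_abs,
    abs_of_nonneg (Real.log_natCast_nonneg n)]
  refine div_le_div_of_nonneg_right ((norm_sum_le _ _).trans (Finset.sum_le_sum fun k _ => ?_))
    (Real.log_natCast_nonneg n)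
  have h2 : ‖(k : ℂ) + 1‖ = (k : ℝ) + 1 := by
    rw [← Nat.cast_add_one, Complex.norm_natCast]
    push_cast
    rfl
  rw [norm_div, h2]

/-- The absolute value of a uniformly almost periodic sequence has a logarithmic mean: it is a
uniform limit of polynomials in the squared absolute values of trigonometric polynomials. -/
lemma exists_tendsto_absLogMean {s : ℕ → ℂ} {R : ℝ}
    (h : ∀ ε : ℝ, 0 < ε → ∃ q ∈ trigPolySeq, (∀ r, ‖q r‖ ≤ R) ∧ ∀ r, ‖s r - q r‖ ≤ ε) :
    ∃ μ : ℝ, Tendsto (absLogMean s) atTop (𝓝 μ) := by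
  suffices h1 : ∃ μ : ℂ, Tendsto (logMean fun r => (‖s r‖ : ℂ)) atTop (𝓝 μ) by
    obtain ⟨μ, hμ⟩ := h1
    refine ⟨μ.re, ((Complex.continuous_re.tendsto μ).comp hμ).congr fun n => ?_⟩
    simp only [Function.comp, ← ofReal_absLogMean, Complex.ofReal_re]
  refine exists_tendsto_logMean_of_approx fun ε hε => ?_
  obtain ⟨q, hq, hqR, hsq⟩ := h (ε / 2) (by positivity)
  obtain ⟨p, hp⟩ := exists_polynomial_near_of_continuousOn 0 (R ^ 2) Real.sqrt
    Real.continuous_sqrt.continuousOn (ε / 2) (by positivity)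
  set z : ℕ → ℂ := q * fun r => (starRingEnd ℂ) (q r) with hz
  have hzm : z ∈ trigPolySeq := trigPolySeq.mul_mem hq (star_mem_trigPolySeq hq)
  have hzr : ∀ r, z r = ((‖q r‖ ^ 2 : ℝ) : ℂ) := by
    intro r
    simp only [hz, Pi.mul_apply]
    rw [Complex.mul_conj']
    push_cast
    rfl
  refine ⟨Polynomial.aeval z (p.map (algebraMap ℝ ℂ)), exists_tendsto_logMean_of_mem ?_,
    fun r => ?_⟩
  · exact (Algebra.adjoin_le (by simpa using hzm) : Algebra.adjoin ℂ {z} ≤ trigPolySeq)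
      (Polynomial.aeval_mem_adjoin_singleton ℂ z)
  · have h1 : (Polynomial.aeval z (p.map (algebraMap ℝ ℂ))) r = ((p.eval (‖q r‖ ^ 2) : ℝ) : ℂ) := by
      have h2 : (Polynomial.aeval z (p.map (algebraMap ℝ ℂ))) r =
          Polynomial.aeval (z r) (p.map (algebraMap ℝ ℂ)) :=
        (Polynomial.aeval_algHom_apply (Pi.evalAlgHom ℂ (fun _ : ℕ => ℂ) r) z _).symm
      rw [h2, hzr, Polynomial.aeval_map_algebraMap]
      exact Polynomial.aeval_algebraMap_apply ℂ (‖q r‖ ^ 2 : ℝ) p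
    rw [h1, ← Complex.ofReal_sub, Complex.norm_real, Real.norm_eq_abs]
    have h3 := hp (‖q r‖ ^ 2) ⟨by positivity, pow_le_pow_left₀ (norm_nonneg _) (hqR r) 2⟩
    rw [Real.sqrt_sq (norm_nonneg _)] at h3
    have h4 := abs_norm_sub_norm_le (s r) (q r)
    have h5 := hsq r
    rw [abs_le] at *
    rw [abs_lt] at h3
    constructor <;> linarith [h3.1, h3.2, h4.1, h4.2]

/-- The sequence `r ↦ ∑ J α exp (-i r α)`, up to normalization the Fourier coefficients of the
measure `∑ J α δ_α`. -/
def jumpSeq (J : ℝ → ℝ) (L : Set ℝ) (r : ℕ) : ℂ := ∑' α : L, (J α : ℂ) * expSeq (-(α : ℝ)) r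

variable {J : ℝ → ℝ} {L : Set ℝ}

lemma summable_jumpSeq (hJ : Summable fun α : L => |J α|) (r : ℕ) :
    Summable fun α : L => (J α : ℂ) * expSeq (-(α : ℝ)) r := by
  refine Summable.of_norm_bounded hJ fun α => ?_
  simp

lemma exists_tendsto_absLogMean_jumpSeq (hJ : Summable fun α : L => |J α|) :
    ∃ μ : ℝ, Tendsto (absLogMean (jumpSeq J L)) atTop (𝓝 μ) := by
  refine exists_tendsto_absLogMean (R := ∑' α : L, |J α|) fun ε hε => ?_
  obtain ⟨A, hA⟩ := (((tendsto_order.1 hJ.hasSum).1 _ (sub_lt_self _ hε))).exists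
  have hb : ∀ (B : Finset L) (r : ℕ), ‖∑ α ∈ B, (J α : ℂ) * expSeq (-(α : ℝ)) r‖ ≤
      ∑ α ∈ B, |J α| := by
    intro B r
    refine (norm_sum_le _ _).trans (Finset.sum_le_sum fun α _ => ?_)
    simp
  refine ⟨∑ α ∈ A, (J α : ℂ) • expSeq (-(α : ℝ)),
    trigPolySeq.sum_mem fun α _ => trigPolySeq.smul_mem (expSeq_mem _) _, fun r => ?_, fun r => ?_⟩
  · simp only [Finset.sum_apply, Pi.smul_apply, smul_eq_mul]
    exact (hb A r).trans (hJ.sum_le_tsum A fun _ _ => abs_nonneg _)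
  · simp only [Finset.sum_apply, Pi.smul_apply, smul_eq_mul]
    refine le_of_tendsto (((summable_jumpSeq hJ r).hasSum.sub_const _).norm) ?_
    filter_upwards [eventually_ge_atTop A] with B hB
    rw [← Finset.sum_sdiff hB, add_sub_cancel_right]
    refine (hb _ r).trans ?_
    have h1 := hJ.sum_le_tsum B fun _ _ => abs_nonneg _
    rw [← Finset.sum_sdiff hB] at h1
    linarith

lemma sin_half_ne_zero {β : ℝ} (h0 : β ≠ 0) (h1 : |β| < 2 * Real.pi) : Real.sin (β / 2) ≠ 0 := by
  rw [abs_lt] at h1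
  intro h
  rcases lt_or_gt_of_ne h0 with h2 | h2
  · have := Real.sin_neg_of_neg_of_neg_pi_lt (x := β / 2) (by linarith) (by linarith)
    linarith
  · have := Real.sin_pos_of_pos_of_lt_pi (x := β / 2) (by linarith) (by linarith)
    linarith

/-- The logarithmic mean of `|∑ J α exp (-i r α)|` dominates every `|J α|`, the mean against
`exp (i r α)`. -/
lemma abs_le_of_tendsto_absLogMean (hL : L ⊆ Set.Ioo 0 (2 * Real.pi))
    (hJ : Summable fun α : L => |J α|) {μ : ℝ}
    (hμ : Tendsto (absLogMean (jumpSeq J L)) atTop (𝓝 μ)) (α₀ : L) : |J α₀| ≤ μ := by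
  classical
  set A : ℕ → ℂ := fun r => jumpSeq J L r * expSeq α₀ r with hA
  have h1 : ∀ n, logMean A n = ∑' α : L, (J α : ℂ) * logMean (expSeq (α₀ - α)) n := by
    intro n
    have h2 : ∀ r, HasSum (fun α : L => (J α : ℂ) * expSeq (α₀ - α) r) (A r) := by
      intro r
      have := (summable_jumpSeq hJ r).hasSum.mul_right (expSeq α₀ r)
      refine this.congr_fun fun α => ?_
      rw [sub_eq_neg_add, expSeq_add]
      ring
    have h3 := (hasSum_sum fun k (_ : k ∈ Finset.range n) =>
      (h2 (k + 1)).div_const ((k : ℂ) + 1)).div_const (Real.log n : ℂ)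
    rw [logMean, ← h3.tsum_eq]
    refine tsum_congr fun α => ?_
    simp only [logMean, mul_div_assoc, ← Finset.mul_sum]
  have h2 : Tendsto (fun n => ∑' α : L, (J α : ℂ) * logMean (expSeq (α₀ - α)) n) atTop
      (𝓝 (∑' α : L, if α = α₀ then (J α : ℂ) else 0)) := by
    refine tendsto_tsum_of_dominated_convergence (bound := fun α : L => |J α| * 2)
      (hJ.mul_right 2) (fun α => ?_) ?_
    · split_ifs with h
      · subst h
        have : expSeq ((α : ℝ) - α) = fun _ => 1 := by
          ext r
          simp [expSeq]
        rw [this]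
        simpa using tendsto_logMean_one.const_mul (J α : ℂ)
      · have h3 : (α₀ : ℝ) - α ≠ 0 := sub_ne_zero.2 fun h4 => h (Subtype.ext h4.symm)
        have h4 := hL α₀.2
        have h5 := hL α.2
        have h6 : |(α₀ : ℝ) - α| < 2 * Real.pi := by
          rw [abs_lt]
          constructor <;> linarith [h4.1, h4.2, h5.1, h5.2]
        simpa using (tendsto_logMean_expSeq (sin_half_ne_zero h3 h6)).const_mul (J α : ℂ)
    · filter_upwards [eventually_ge_atTop 3] with n hn α
      have := norm_logMean_le (fun r => (norm_expSeq (α₀ - α) r).le) hn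
      rw [norm_mul, Complex.norm_real, Real.norm_eq_abs]
      exact mul_le_mul_of_nonneg_left (by linarith) (abs_nonneg _)
  rw [tsum_ite_eq] at h2
  have h3 := (h2.congr fun n => (h1 n).symm).norm
  rw [Complex.norm_real, Real.norm_eq_abs] at h3
  refine le_of_tendsto_of_tendsto' h3 hμ fun n => ?_
  refine (norm_logMean_le_absLogMean A n).trans (le_of_eq ?_)
  simp [absLogMean, hA]

/-! ### Averages of the logarithm -/

/-- If the partial sums of `w` grow like `μ log n`, the average of `log (m + 1)` with weights `w m`
is asymptotically half of `log n`. -/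
lemma tendsto_sum_mul_log_div {w G : ℕ → ℝ} {μ : ℝ} (hμ : μ ≠ 0)
    (hG : ∀ n, G n = ∑ m ∈ Finset.range (n + 1), w m)
    (hlim : Tendsto (fun n : ℕ => G n / Real.log n) atTop (𝓝 μ)) :
    Tendsto (fun n : ℕ => (∑ m ∈ Finset.range (n + 1), w m * Real.log (m + 1)) /
      (Real.log n * G n)) atTop (𝓝 (1 / 2)) := by
  -- `ℓ` shifts the logarithm by one, so that it starts at `ℓ 0 = 0`; `δ` denotes its increments
  set ℓ : ℕ → ℝ := fun m => Real.log (m + 1) with hℓ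
  set δ : ℕ → ℝ := fun m => ℓ (m + 1) - ℓ m with hδ
  have hℓ0 : ∀ m, 0 ≤ ℓ m := fun m => Real.log_nonneg (by linarith [m.cast_nonneg (α := ℝ)])
  have hδ0 : ∀ m, 0 ≤ δ m := fun m => sub_nonneg.2 (Real.log_le_log (by positivity) (by
    push_cast
    linarith))
  have hδ1 : ∀ m, δ m ≤ 1 := by
    intro m
    simp only [hδ, hℓ]
    rw [← Real.log_div (by positivity) (by positivity)]
    refine (Real.log_le_sub_one_of_pos (by positivity)).trans ?_
    rw [sub_le_iff_le_add, div_le_iff₀ (by positivity)]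
    push_cast
    linarith [m.cast_nonneg (α := ℝ)]
  have hsumδ : ∀ n, ∑ m ∈ Finset.range n, δ m = ℓ n := by
    intro n
    rw [Finset.sum_range_sub]
    simp [hℓ]
  have hsumℓδ : ∀ n, 2 * ∑ m ∈ Finset.range n, ℓ m * δ m =
      ℓ n ^ 2 - ∑ m ∈ Finset.range n, δ m ^ 2 := by
    intro n
    have h1 : ℓ n ^ 2 = ∑ m ∈ Finset.range n, (ℓ (m + 1) ^ 2 - ℓ m ^ 2) := by
      rw [Finset.sum_range_sub (fun m => ℓ m ^ 2)]
      simp [hℓ]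
    rw [h1, ← Finset.sum_sub_distrib, Finset.mul_sum]
    refine Finset.sum_congr rfl fun m _ => ?_
    simp only [hδ]
    ring
  have hsq0 : ∀ n, 0 ≤ ∑ m ∈ Finset.range n, δ m ^ 2 := fun n =>
    Finset.sum_nonneg fun _ _ => sq_nonneg _
  have hsq1 : ∀ n, ∑ m ∈ Finset.range n, δ m ^ 2 ≤ ℓ n := by
    intro n
    rw [← hsumδ]
    refine Finset.sum_le_sum fun m _ => ?_
    have := mul_le_mul_of_nonneg_left (hδ1 m) (hδ0 m)
    linarith [sq (δ m)]
  have hℓtop : Tendsto ℓ atTop atTop := by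
    have := tendsto_log_natCast.comp (tendsto_add_atTop_nat 1)
    refine this.congr fun n => ?_
    simp [hℓ]
  have hℓpos : ∀ᶠ n in atTop, 1 ≤ ℓ n := hℓtop.eventually_ge_atTop 1
  -- `∑ ℓ δ / ℓ² → 1/2`
  have hA : Tendsto (fun n => (∑ m ∈ Finset.range n, ℓ m * δ m) / ℓ n ^ 2) atTop (𝓝 (1 / 2)) := by
    have h1 : Tendsto (fun n => 1 / 2 - 1 / 2 * (ℓ n)⁻¹) atTop (𝓝 (1 / 2)) := by
      have h0 := (hℓtop.inv_tendsto_atTop.const_mul (1 / 2 : ℝ)).const_sub (1 / 2 : ℝ)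
      rwa [mul_zero, sub_zero] at h0
    refine tendsto_of_tendsto_of_tendsto_of_le_of_le' h1 tendsto_const_nhds ?_ ?_
    · filter_upwards [hℓpos] with n hn
      have h2 := hsumℓδ n
      have h3 := hsq1 n
      have h4 : 0 < ℓ n := by linarith
      rw [le_div_iff₀ (by positivity)]
      have h5 : (1 / 2 - 1 / 2 * (ℓ n)⁻¹) * ℓ n ^ 2 = (ℓ n ^ 2 - ℓ n) / 2 := by
        field_simp
      linarith
    · filter_upwards [hℓpos] with n hn
      have h2 := hsumℓδ n
      have h3 := hsq0 n
      have h4 : 0 < ℓ n := by linarith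
      rw [div_le_iff₀ (by positivity)]
      linarith
  have hlogℓ : Tendsto (fun n : ℕ => Real.log n / ℓ n) atTop (𝓝 1) := by
    have h1 : Tendsto (fun n => 1 - (ℓ n)⁻¹) atTop (𝓝 1) := by
      simpa using hℓtop.inv_tendsto_atTop.const_sub 1
    refine tendsto_of_tendsto_of_tendsto_of_le_of_le' h1 tendsto_const_nhds ?_ ?_
    · filter_upwards [hℓpos] with n hn
      have h2 := (log_add_one_le_harmonicSum n).trans (harmonicSum_le n)
      have h4 : 0 < ℓ n := by linarith
      rw [le_div_iff₀ h4, sub_mul, inv_mul_cancel₀ h4.ne']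
      simp only [hℓ]
      linarith
    · filter_upwards [hℓpos, eventually_ge_atTop 1] with n hn hn1
      have h4 : 0 < ℓ n := by linarith
      have h5 : (0 : ℝ) < n := by exact_mod_cast hn1
      rw [div_le_one h4]
      exact Real.log_le_log h5 (by linarith)
  have hGℓ : Tendsto (fun n => G n / ℓ n) atTop (𝓝 μ) := by
    have h1 := hlim.mul hlogℓ
    rw [mul_one] at h1
    refine h1.congr' ?_
    filter_upwards [eventually_ge_atTop 3] with n hn
    have := one_le_log_natCast hn
    rw [div_mul_div_cancel₀ (by linarith)]
  -- `∑ G δ / ℓ² → μ/2`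
  have hB : Tendsto (fun n => (∑ m ∈ Finset.range n, G m * δ m) / ℓ n ^ 2) atTop
      (𝓝 (μ * (1 / 2))) := by
    have h1 : (fun m => (G m - μ * ℓ m) * δ m) =o[atTop] fun m => ℓ m * δ m := by
      refine Asymptotics.IsLittleO.mul_isBigO ?_ (Asymptotics.isBigO_refl _ _)
      rw [Asymptotics.isLittleO_iff_tendsto' (by
        filter_upwards [hℓpos] with n hn h
        linarith)]
      have h2 := hGℓ.sub_const μ
      rw [sub_self] at h2
      refine h2.congr' ?_
      filter_upwards [hℓpos] with n hn
      have h4 : ℓ n ≠ 0 := by linarith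
      field_simp
    have htop : Tendsto (fun n => ∑ m ∈ Finset.range n, ℓ m * δ m) atTop atTop := by
      have h2 : Tendsto (fun n => 1 / 2 * (ℓ n * (ℓ n - 1))) atTop atTop := by
        refine Tendsto.const_mul_atTop (by norm_num) (hℓtop.atTop_mul_atTop₀ ?_)
        exact tendsto_atTop_add_const_right _ (-1) hℓtop
      refine tendsto_atTop_mono (fun n => ?_) h2
      have h3 := hsumℓδ n
      have h4 := hsq1 n
      linarith [sq (ℓ n)]
    have h2 := h1.sum_range (fun m => mul_nonneg (hℓ0 m) (hδ0 m)) htop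
    have h3 : Tendsto (fun n => (∑ m ∈ Finset.range n, (G m - μ * ℓ m) * δ m) /
        ∑ m ∈ Finset.range n, ℓ m * δ m) atTop (𝓝 0) := h2.tendsto_div_nhds_zero
    have h4 := (h3.mul hA).add (hA.const_mul μ)
    rw [zero_mul, zero_add] at h4
    refine h4.congr' ?_
    filter_upwards [htop.eventually_gt_atTop 0] with n hn
    rw [div_mul_div_cancel₀ hn.ne', ← mul_div_assoc, ← add_div]
    congr 1
    rw [Finset.mul_sum, ← Finset.sum_add_distrib]
    exact Finset.sum_congr rfl fun m _ => by ring
  have habel : ∀ n, ∑ m ∈ Finset.range (n + 1), w m * ℓ m =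
      G n * ℓ n - ∑ m ∈ Finset.range n, G m * δ m := by
    intro n
    induction n with
    | zero => simp [hG, hℓ]
    | succ n ih =>
      have h1 : G (n + 1) = G n + w (n + 1) := by rw [hG, hG, Finset.sum_range_succ]
      rw [Finset.sum_range_succ, ih, Finset.sum_range_succ, h1]
      simp only [hδ]
      ring
  have hC : Tendsto (fun n => (∑ m ∈ Finset.range (n + 1), w m * ℓ m) / ℓ n ^ 2) atTop
      (𝓝 (μ - μ * (1 / 2))) := by
    refine (hGℓ.sub hB).congr' ?_
    filter_upwards [hℓpos] with n hn
    have h4 : ℓ n ≠ 0 := by linarith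
    rw [habel]
    field_simp
  have hD := hC.div (hlogℓ.mul hGℓ) (by simpa using hμ)
  have h5 : (μ - μ * (1 / 2)) / (1 * μ) = 1 / 2 := by
    field_simp
    norm_num
  rw [h5] at hD
  refine hD.congr' ?_
  filter_upwards [hℓpos] with n hn
  have h4 : ℓ n ≠ 0 := by linarith
  simp only [Pi.div_apply]
  rw [div_mul_div_comm, ← sq, div_div_div_cancel_right₀ (pow_ne_zero 2 h4)]

end LogMeans

/-! ### The cosine sums `∑ cos (k t) / k` -/

section CosSum

/-- The cosine sum `∑_{1 ≤ k ≤ m} cos (k t) / k`. -/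
def cosSum (m : ℕ) (t : ℝ) : ℝ :=
  ∑ k ∈ Finset.range m, Real.cos (((k : ℝ) + 1) * t) / ((k : ℝ) + 1)

/-- The conjugate Dirichlet kernel `∑_{1 ≤ k ≤ m} sin (k t)`. -/
def sinSum (m : ℕ) (t : ℝ) : ℝ := ∑ k ∈ Finset.range m, Real.sin (((k : ℝ) + 1) * t)

lemma continuous_sinSum (m : ℕ) : Continuous (sinSum m) := by
  unfold sinSum
  fun_prop

lemma hasDerivAt_cosSum (m : ℕ) (t : ℝ) : HasDerivAt (cosSum m) (-sinSum m t) t := by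
  unfold cosSum sinSum
  rw [← Finset.sum_neg_distrib]
  refine HasDerivAt.fun_sum fun k _ => ?_
  have h1 : HasDerivAt (fun t : ℝ => ((k : ℝ) + 1) * t) ((k : ℝ) + 1) t := by
    simpa using (hasDerivAt_id t).const_mul ((k : ℝ) + 1)
  have h2 := (h1.cos).div_const ((k : ℝ) + 1)
  have h3 : (k : ℝ) + 1 ≠ 0 := by positivity
  rwa [mul_div_assoc, div_self h3, mul_one] at h2

lemma cosSum_zero_right (m : ℕ) : cosSum m 0 = harmonicSum m := by
  simp [cosSum, harmonicSum]

lemma abs_cosSum_le (m : ℕ) (t : ℝ) : |cosSum m t| ≤ harmonicSum m := by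
  refine (Finset.abs_sum_le_sum_abs _ _).trans (Finset.sum_le_sum fun k _ => ?_)
  rw [abs_div, abs_of_pos (by positivity : (0 : ℝ) < (k : ℝ) + 1)]
  exact div_le_div_of_nonneg_right (Real.abs_cos_le_one _) (by positivity)

lemma exists_abs_cosSum_le {t : ℝ} (ht : Real.sin (t / 2) ≠ 0) : ∃ K, ∀ m, |cosSum m t| ≤ K := by
  obtain ⟨K, hK⟩ := exists_norm_sum_expSeq_div_le ht
  refine ⟨K, fun m => ?_⟩
  have h : (∑ k ∈ Finset.range m, expSeq t (k + 1) / ((k : ℂ) + 1)).re = cosSum m t := by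
    rw [Complex.re_sum]
    refine Finset.sum_congr rfl fun k _ => ?_
    have h1 : (k : ℂ) + 1 = (((k : ℝ) + 1 : ℝ) : ℂ) := by push_cast; rfl
    rw [h1, Complex.div_ofReal_re, expSeq, mul_comm Complex.I, Complex.exp_ofReal_mul_I_re]
    push_cast
    rfl
  rw [← h]
  exact (Complex.abs_re_le_norm _).trans (hK m)

lemma geomExp_succ_im (m : ℕ) (t : ℝ) : (geomExp (m + 1) t).im = sinSum m t := by
  rw [geomExp, Finset.sum_range_succ', Complex.add_im, Complex.im_sum]
  simp only [mul_comm Complex.I, Complex.exp_ofReal_mul_I_im]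
  simp [sinSum]

lemma abs_sinSum_mul_abs_sin_le (m : ℕ) (t : ℝ) : |sinSum m t| * |Real.sin (t / 2)| ≤ 1 := by
  refine le_trans (mul_le_mul_of_nonneg_right ?_ (abs_nonneg _))
    (norm_geomExp_mul_abs_sin_le (m + 1) t)
  rw [← geomExp_succ_im]
  exact Complex.abs_im_le_norm _

lemma two_mul_sin_mul_sinSum (m : ℕ) (t : ℝ) : 2 * Real.sin (t / 2) * sinSum m t =
    Real.cos (t / 2) - Real.cos (m * t + t / 2) := by
  induction m with
  | zero => simp [sinSum]
  | succ m ih =>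
    have h : sinSum (m + 1) t = sinSum m t + Real.sin (((m : ℝ) + 1) * t) :=
      Finset.sum_range_succ _ _
    have h1 := Real.cos_sub (((m : ℝ) + 1) * t) (t / 2)
    have h2 := Real.cos_add (((m : ℝ) + 1) * t) (t / 2)
    rw [show ((m : ℝ) + 1) * t - t / 2 = m * t + t / 2 by ring] at h1
    rw [h, mul_add, ih]
    push_cast
    linarith

/-- The conjugate Dirichlet kernel is almost positive on `[0, π]`, so that its integral nearly gives
its `L¹` norm. -/
lemma neg_half_le_sinSum (m : ℕ) {t : ℝ} (h0 : 0 ≤ t) (h1 : t ≤ Real.pi) :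
    -(1 / 2) ≤ sinSum m t := by
  rcases h0.eq_or_lt with rfl | h0
  · simp [sinSum]
  have hs : 0 < Real.sin (t / 2) :=
    Real.sin_pos_of_pos_of_lt_pi (by linarith) (by linarith [Real.pi_pos])
  have hc : 0 ≤ Real.cos (t / 2) :=
    Real.cos_nonneg_of_neg_pi_div_two_le_of_le (by linarith [Real.pi_pos]) (by linarith)
  have h2 := two_mul_sin_mul_sinSum m t
  rw [Real.cos_add] at h2
  have h3 : 2 * Real.sin (t / 2) * (sinSum m t + 1 / 2) =
      Real.cos (t / 2) * (1 - Real.cos (m * t)) + Real.sin (t / 2) * (1 + Real.sin (m * t)) := by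
    linarith
  have h4 : 0 ≤ 2 * Real.sin (t / 2) * (sinSum m t + 1 / 2) := by
    rw [h3]
    exact add_nonneg (mul_nonneg hc (by linarith [Real.cos_le_one (m * t)]))
      (mul_nonneg hs.le (by linarith [Real.neg_one_le_sin (m * t)]))
  have h5 := nonneg_of_mul_nonneg_right h4 (by positivity)
  linarith

lemma integral_sinSum (m : ℕ) (a b : ℝ) :
    ∫ t in a..b, sinSum m t = cosSum m a - cosSum m b := by
  have h := intervalIntegral.integral_eq_sub_of_hasDerivAt (a := a) (b := b)
    (fun t _ => hasDerivAt_cosSum m t) ((continuous_sinSum m).neg.intervalIntegrable _ _)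
  rw [intervalIntegral.integral_neg] at h
  linarith

lemma sinSum_two_pi_sub (m : ℕ) (t : ℝ) : sinSum m (2 * Real.pi - t) = -sinSum m t := by
  unfold sinSum
  rw [← Finset.sum_neg_distrib]
  refine Finset.sum_congr rfl fun k _ => ?_
  rw [← Real.sin_nat_mul_two_pi_sub (((k : ℝ) + 1) * t) (k + 1)]
  congr 1
  push_cast
  ring

lemma sinSum_periodic (m : ℕ) : Function.Periodic (sinSum m) (2 * Real.pi) := by
  intro t
  refine Finset.sum_congr rfl fun k _ => ?_
  rw [← Real.sin_add_nat_mul_two_pi (((k : ℝ) + 1) * t) (k + 1)]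
  congr 1
  push_cast
  ring

/-- The variation of a translated cosine sum over an interval of length at most `2π`. -/
lemma exists_integral_abs_sinSum_le : ∃ K : ℝ, 0 ≤ K ∧ ∀ (m : ℕ) (α a b : ℝ), a ≤ b →
    b ≤ a + 2 * Real.pi → ∫ t in a..b, |sinSum m (t - α)| ≤ 2 * Real.log (m + 1) + K := by
  obtain ⟨K, hK⟩ := exists_abs_cosSum_le (t := Real.pi) (by simp)
  have hK0 : 0 ≤ K := (abs_nonneg _).trans (hK 0)
  refine ⟨2 * (1 + K + Real.pi), by positivity, fun m α a b hab hb => ?_⟩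
  have hc : Continuous fun t => |sinSum m t| := (continuous_sinSum m).abs
  have hper : Function.Periodic (fun t => |sinSum m t|) (2 * Real.pi) := fun t => by
    simp only [sinSum_periodic m t]
  have h1 : ∫ t in a..b, |sinSum m (t - α)| ≤ ∫ t in (0 : ℝ)..2 * Real.pi, |sinSum m t| := by
    rw [intervalIntegral.integral_comp_sub_right (fun t => |sinSum m t|)]
    have h2 := hper.intervalIntegral_add_eq 0 (a - α)
    rw [zero_add] at h2
    rw [h2]
    refine intervalIntegral.integral_mono_interval le_rfl (by linarith) (by linarith)
      (ae_of_all _ fun t => abs_nonneg _) (hc.intervalIntegrable _ _)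
  have h2 : ∫ t in (0 : ℝ)..2 * Real.pi, |sinSum m t| =
      2 * ∫ t in (0 : ℝ)..Real.pi, |sinSum m t| := by
    rw [← integral_two_pi_eq_two_mul hc fun t => by rw [sinSum_two_pi_sub, abs_neg],
      integral_Icc_eq_integral_Ioc, intervalIntegral.integral_of_le Real.two_pi_pos.le]
  have h3 : ∫ t in (0 : ℝ)..Real.pi, |sinSum m t| ≤
      ∫ t in (0 : ℝ)..Real.pi, (sinSum m t + 1) := by
    refine intervalIntegral.integral_mono_on Real.pi_pos.le (hc.intervalIntegrable _ _)
      (((continuous_sinSum m).add continuous_const).intervalIntegrable _ _) fun t ht => ?_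
    have := neg_half_le_sinSum m ht.1 ht.2
    rw [abs_le]
    constructor <;> linarith
  rw [intervalIntegral.integral_add ((continuous_sinSum m).intervalIntegrable _ _) (by simp),
    integral_sinSum, cosSum_zero_right] at h3
  simp only [intervalIntegral.integral_const, sub_zero, smul_eq_mul, mul_one] at h3
  have h4 := neg_abs_le (cosSum m Real.pi)
  have h5 := hK m
  have h6 := harmonicSum_le m
  have h7 : Real.log m ≤ Real.log (m + 1) := by
    rcases m.eq_zero_or_pos with rfl | hm
    · simp
    · exact Real.log_le_log (by exact_mod_cast hm) (by linarith)
  linarith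

/-- Away from its centre, the variation of a translated cosine sum stays bounded. -/
lemma exists_integral_abs_sinSum_le_of_notMem {α a b : ℝ} (ha : 0 ≤ a) (hab : a ≤ b)
    (hb : b ≤ 2 * Real.pi) (hα : α ∈ Set.Ioo 0 (2 * Real.pi)) (hα' : α ∉ Set.Icc a b) :
    ∃ K : ℝ, ∀ m : ℕ, ∫ t in a..b, |sinSum m (t - α)| ≤ K := by
  have hne : ∀ t ∈ Set.Icc a b, 0 < |Real.sin ((t - α) / 2)| := by
    intro t ht
    refine abs_pos.2 (sin_half_ne_zero (sub_ne_zero.2 fun h => hα' (h ▸ ht)) ?_)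
    rw [abs_lt]
    constructor <;> linarith [ht.1, ht.2, hα.1, hα.2]
  obtain ⟨t₀, ht₀, hmin⟩ := isCompact_Icc.exists_isMinOn (Set.nonempty_Icc.2 hab)
    (f := fun t => |Real.sin ((t - α) / 2)|) (by fun_prop)
  set c := |Real.sin ((t₀ - α) / 2)| with hc
  have hc0 : 0 < c := hne t₀ ht₀
  refine ⟨∫ _ in a..b, 1 / c, fun m => intervalIntegral.integral_mono_on hab ?_ (by simp)
    fun t ht => ?_⟩
  · have := continuous_sinSum m
    exact Continuous.intervalIntegrable (by fun_prop) _ _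
  · rw [le_div_iff₀ hc0]
    exact (mul_le_mul_of_nonneg_left (hmin ht) (abs_nonneg _)).trans
      (abs_sinSum_mul_abs_sin_le m (t - α))

/-- The increments of a translated cosine sum over a grid add up at most to the integral of the
absolute value of its derivative. -/
lemma sum_abs_cosSum_sub_le (m : ℕ) (α : ℝ) {a b : ℝ} {p : ℕ → ℝ} (hp : Monotone p)
    (hab : ∀ k, p k ∈ Set.Icc a b) (n : ℕ) :
    ∑ k ∈ Finset.range n, |cosSum m (p (k + 1) - α) - cosSum m (p k - α)| ≤
      ∫ t in a..b, |sinSum m (t - α)| := by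
  have hs := continuous_sinSum m
  have hi : ∀ c e : ℝ, IntervalIntegrable (fun t => |sinSum m (t - α)|) volume c e := fun c e =>
    Continuous.intervalIntegrable (by fun_prop) _ _
  have h1 : ∑ k ∈ Finset.range n, |cosSum m (p (k + 1) - α) - cosSum m (p k - α)| ≤
      ∑ k ∈ Finset.range n, ∫ t in p k..p (k + 1), |sinSum m (t - α)| := by
    refine Finset.sum_le_sum fun k _ => ?_
    rw [abs_sub_comm, ← integral_sinSum, ← intervalIntegral.integral_comp_sub_right (sinSum m)]
    exact intervalIntegral.abs_integral_le_integral_abs (hp (Nat.le_succ k))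
  refine h1.trans ?_
  rw [intervalIntegral.sum_integral_adjacent_intervals fun k _ => hi _ _]
  exact intervalIntegral.integral_mono_interval (hab 0).1 (hp (Nat.zero_le n)) (hab n).2
    (ae_of_all _ fun t => abs_nonneg _) (hi _ _)

end CosSum

/-! ### Fourier coefficients of the jump part -/

section JumpCoefficients

/-- The Fourier coefficient of a function of one variable. -/
def lineCoefficient (h : ℝ → ℝ) (r : ℤ) : ℂ :=
  (2 * (Real.pi : ℂ))⁻¹ * ∫ t in Set.Icc 0 (2 * Real.pi),
    (h t : ℂ) * Complex.exp (Complex.I * (((-r : ℤ) * t : ℝ) : ℂ))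

lemma exp_int_mul_periodic (k : ℤ) : Function.Periodic
    (fun t : ℝ => Complex.exp (Complex.I * ((k * t : ℝ) : ℂ))) (2 * Real.pi) := by
  intro t
  simp only
  rw [Complex.exp_eq_exp_iff_exists_int]
  refine ⟨k, ?_⟩
  push_cast
  ring

lemma integral_exp_int_mul_Icc (k : ℤ) :
    ∫ t in Set.Icc 0 (2 * Real.pi), Complex.exp (Complex.I * ((k * t : ℝ) : ℂ)) =
      if k = 0 then 2 * (Real.pi : ℂ) else 0 := by
  rw [integral_Icc_eq_integral_Ioc, ← intervalIntegral.integral_of_le Real.two_pi_pos.le,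
    ← integral_exp_int_mul]
  have h := (exp_int_mul_periodic k).intervalIntegral_add_eq 0 (-Real.pi)
  rw [zero_add, show -Real.pi + 2 * Real.pi = Real.pi by ring] at h
  exact h

variable {d : ℕ}

/-- The coefficients of a function of one coordinate are supported on that axis. -/
lemma fourierCoefficient_comp_eval (h : ℝ → ℝ) (k : Fin d) (ν : Fin d → ℤ) :
    fourierCoefficient (fun x => h (x k)) ν =
      if ∀ l, l ≠ k → ν l = 0 then lineCoefficient h (ν k) else 0 := by
  have h1 : ∀ x : Fin d → ℝ, (h (x k) : ℂ) * character (-ν) x =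
      ∏ l, (if l = k then (h (x l) : ℂ) else 1) *
        Complex.exp (Complex.I * (((-ν l : ℤ) * x l : ℝ) : ℂ)) := by
    intro x
    rw [Finset.prod_mul_distrib, character_eq_prod]
    simp
  rw [fourierCoefficient_eq, restrict_periodBox]
  simp only [h1]
  rw [integral_fintype_prod_eq_prod (fun (l : Fin d) (t : ℝ) =>
    (if l = k then (h t : ℂ) else 1) * Complex.exp (Complex.I * (((-ν l : ℤ) * t : ℝ) : ℂ)))]
  have h2 : ∀ l, l ≠ k → ∫ t in Set.Icc 0 (2 * Real.pi),
      (if l = k then (h t : ℂ) else 1) * Complex.exp (Complex.I * (((-ν l : ℤ) * t : ℝ) : ℂ)) =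
      if ν l = 0 then 2 * (Real.pi : ℂ) else 0 := by
    intro l hl
    simp only [hl, if_false, one_mul]
    rw [integral_exp_int_mul_Icc]
    simp
  have hπ : (2 * (Real.pi : ℂ)) ≠ 0 := by simp
  rw [← Finset.mul_prod_erase _ _ (Finset.mem_univ k),
    Finset.prod_congr rfl fun l hl => h2 l (Finset.ne_of_mem_erase hl)]
  simp only [if_true]
  split_ifs with h3
  · rw [Finset.prod_congr rfl fun l hl => if_pos (h3 l (Finset.ne_of_mem_erase hl)),
      Finset.prod_const, Finset.card_erase_of_mem (Finset.mem_univ k), Finset.card_univ,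
      Fintype.card_fin, lineCoefficient]
    have h4 : (2 * (Real.pi : ℂ)) ^ d = (2 * (Real.pi : ℂ)) ^ (d - 1) * (2 * (Real.pi : ℂ)) := by
      rw [← pow_succ, Nat.sub_add_cancel k.pos]
    rw [h4, one_div, mul_inv]
    have h5 : (2 * (Real.pi : ℂ)) ^ (d - 1) ≠ 0 := pow_ne_zero _ hπ
    generalize (2 * (Real.pi : ℂ)) ^ (d - 1) = P at h5
    generalize 2 * (Real.pi : ℂ) = Q
    generalize (∫ t : ℝ in Set.Icc 0 (2 * Real.pi),
      (h t : ℂ) * Complex.exp (Complex.I * (((-ν k : ℤ) * t : ℝ) : ℂ))) = W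
    linear_combination (Q⁻¹ * W) * inv_mul_cancel₀ h5
  · push Not at h3
    obtain ⟨l, hl, hl0⟩ := h3
    rw [Finset.prod_eq_zero (Finset.mem_erase.2 ⟨hl, Finset.mem_univ l⟩) (if_neg hl0), mul_zero,
      mul_zero]

lemma sum_freqBox_of_axis {M : Type*} [AddCommMonoid M] {Φ : (Fin d → ℤ) → M} {k : Fin d}
    (hΦ : ∀ ν, (¬ ∀ l, l ≠ k → ν l = 0) → Φ ν = 0) (n : ℕ) :
    ∑ ν ∈ freqBox d n, Φ ν = ∑ r ∈ Finset.Icc (-(n : ℤ)) n, Φ (Pi.single k r) := by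
  classical
  rw [← Finset.sum_filter_of_ne (p := fun ν => ∀ l, l ≠ k → ν l = 0)
    fun ν _ h => by_contra fun h1 => h (hΦ ν h1)]
  refine Finset.sum_bij' (fun ν _ => ν k) (fun r _ => Pi.single k r) ?_ ?_ ?_ ?_ ?_
  · intro ν hν
    exact Fintype.mem_piFinset.1 (Finset.mem_filter.1 hν).1 k
  · intro r hr
    refine Finset.mem_filter.2 ⟨Fintype.mem_piFinset.2 fun l => ?_, fun l hl => by simp [hl]⟩
    by_cases hl : l = k
    · subst hl
      simpa using hr
    · simp [hl]
  · intro ν hν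
    ext l
    by_cases hl : l = k
    · subst hl
      simp
    · simp [hl, (Finset.mem_filter.1 hν).2 l hl]
  · intro r _
    simp
  · intro ν hν
    congr 1
    ext l
    by_cases hl : l = k
    · subst hl
      simp
    · simp [hl, (Finset.mem_filter.1 hν).2 l hl]

lemma integral_sawtooth_mul_exp (α : ℝ) (r : ℤ) :
    ∫ t in Set.Icc 0 (2 * Real.pi), (sawtooth (t - α) : ℂ) *
      Complex.exp (Complex.I * (((-r : ℤ) * t : ℝ) : ℂ)) =
      if r = 0 then 0 else Complex.exp (Complex.I * (((-r : ℤ) * α : ℝ) : ℂ)) / (Complex.I * r) := by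
  set φ : ℝ → ℂ := fun t => (sawtooth t : ℂ) *
    Complex.exp (Complex.I * (((-r : ℤ) * t : ℝ) : ℂ)) with hφ
  have hper : Function.Periodic φ (2 * Real.pi) := fun t => by
    simp only [hφ, sawtooth_periodic t, exp_int_mul_periodic (-r) t]
  have h1 : ∀ t : ℝ, (sawtooth (t - α) : ℂ) * Complex.exp (Complex.I * (((-r : ℤ) * t : ℝ) : ℂ)) =
      Complex.exp (Complex.I * (((-r : ℤ) * α : ℝ) : ℂ)) * φ (t - α) := by
    intro t
    simp only [hφ]
    rw [mul_left_comm, ← Complex.exp_add]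
    congr 2
    push_cast
    ring
  simp only [h1]
  rw [integral_const_mul, integral_Icc_eq_integral_Ioc,
    ← intervalIntegral.integral_of_le Real.two_pi_pos.le,
    intervalIntegral.integral_comp_sub_right φ]
  have h2 := hper.intervalIntegral_add_eq 0 (0 - α)
  rw [zero_add, show 0 - α + 2 * Real.pi = 2 * Real.pi - α by ring] at h2
  rw [← h2]
  have h3 : ∫ t in (0 : ℝ)..2 * Real.pi, φ t = ∫ t in (0 : ℝ)..2 * Real.pi,
      (1 / 2 - (t : ℂ) / (2 * Real.pi)) * Complex.exp (-(Complex.I * r) * t) := by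
    rw [intervalIntegral.integral_of_le Real.two_pi_pos.le,
      intervalIntegral.integral_of_le Real.two_pi_pos.le, integral_Ioc_eq_integral_Ioo,
      integral_Ioc_eq_integral_Ioo]
    refine setIntegral_congr_fun measurableSet_Ioo fun t ht => ?_
    simp only [hφ]
    rw [sawtooth_of_mem ⟨ht.1.le, ht.2⟩]
    push_cast
    congr 2
    ring
  have hπ : (Real.pi : ℂ) ≠ 0 := by exact_mod_cast Real.pi_ne_zero
  rw [h3]
  split_ifs with hr
  · subst hr
    have h4 : ∀ t : ℝ, (1 / 2 - (t : ℂ) / (2 * Real.pi)) *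
        Complex.exp (-(Complex.I * ((0 : ℤ) : ℂ)) * t) = ((1 / 2 - t / (2 * Real.pi) : ℝ) : ℂ) := by
      intro t
      simp
    simp only [h4]
    rw [intervalIntegral.integral_ofReal, intervalIntegral.integral_sub (by simp)
      (Continuous.intervalIntegrable (by fun_prop) _ _), intervalIntegral.integral_const,
      intervalIntegral.integral_div, integral_id]
    simp
    field_simp
    ring
  · have hc : -(Complex.I * r) ≠ 0 := by
      simpa using hr
    set c : ℂ := -(Complex.I * r) with hc'
    have hd : ∀ t : ℝ, HasDerivAt (fun t : ℝ => (1 / 2 - (t : ℂ) / (2 * Real.pi)) *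
        (Complex.exp (c * t) / c) + Complex.exp (c * t) / (2 * Real.pi * c ^ 2))
        ((1 / 2 - (t : ℂ) / (2 * Real.pi)) * Complex.exp (c * t)) t := by
      intro t
      have e1 : HasDerivAt (fun t : ℝ => Complex.exp (c * t)) (Complex.exp (c * t) * c) t := by
        have := ((Complex.ofRealCLM.hasDerivAt (x := t)).const_mul c).cexp
        simpa using this
      have e2 : HasDerivAt (fun t : ℝ => 1 / 2 - (t : ℂ) / (2 * Real.pi)) (-(1 / (2 * Real.pi))) t := by
        have := ((Complex.ofRealCLM.hasDerivAt (x := t)).div_const (2 * (Real.pi : ℂ))).const_sub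
          (1 / 2)
        simpa using this
      have e3 := (e2.mul (e1.div_const c)).add (e1.div_const (2 * Real.pi * c ^ 2))
      refine e3.congr_deriv ?_
      field_simp
      ring
    rw [intervalIntegral.integral_eq_sub_of_hasDerivAt (fun t _ => hd t)
      (Continuous.intervalIntegrable (by fun_prop) _ _)]
    have e4 : Complex.exp (c * ((2 * Real.pi : ℝ) : ℂ)) = 1 := by
      rw [← Complex.exp_zero, Complex.exp_eq_exp_iff_exists_int]
      refine ⟨-r, ?_⟩
      rw [hc']
      push_cast
      ring
    rw [e4]
    have e5 : Complex.I * r = -c := by rw [hc', neg_neg]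
    rw [e5]
    push_cast
    simp only [mul_zero, Complex.exp_zero]
    field_simp
    ring

variable {J : ℝ → ℝ} {L : Set ℝ}

/-- The sum `∑ J α exp (-i r α)` for integers `r`. -/
def jumpSum (J : ℝ → ℝ) (L : Set ℝ) (r : ℤ) : ℂ :=
  ∑' α : L, (J α : ℂ) * Complex.exp (Complex.I * (((-r : ℤ) * (α : ℝ) : ℝ) : ℂ))

lemma summable_jumpSum (hJ : Summable fun α : L => |J α|) (r : ℤ) : Summable fun α : L =>
    (J α : ℂ) * Complex.exp (Complex.I * (((-r : ℤ) * (α : ℝ) : ℝ) : ℂ)) := by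
  refine Summable.of_norm_bounded hJ fun α => ?_
  rw [norm_mul, mul_comm Complex.I, Complex.norm_exp_ofReal_mul_I]
  simp

lemma jumpSum_natCast (r : ℕ) : jumpSum J L r = jumpSeq J L r := by
  refine tsum_congr fun α => ?_
  rw [expSeq]
  congr 4
  push_cast
  ring

lemma jumpSum_neg (r : ℤ) : jumpSum J L (-r) = (starRingEnd ℂ) (jumpSum J L r) := by
  rw [jumpSum, jumpSum, Complex.conj_tsum]
  refine tsum_congr fun α => ?_
  rw [map_mul, Complex.conj_ofReal, ← Complex.exp_conj]
  simp

lemma lineCoefficient_jumpPart (hL : L.Countable) (hJ : Summable fun α : L => |J α|) (r : ℤ) :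
    lineCoefficient (jumpPart J L) r =
      if r = 0 then 0 else (2 * (Real.pi : ℂ))⁻¹ * (jumpSum J L r / (Complex.I * r)) := by
  have : Countable L := hL.to_subtype
  set e : ℝ → ℂ := fun t => Complex.exp (Complex.I * (((-r : ℤ) * t : ℝ) : ℂ)) with he
  have hen : ∀ t, ‖e t‖ = 1 := fun t => by
    simp only [he]
    rw [mul_comm, Complex.norm_exp_ofReal_mul_I]
  have hec : Continuous e := by fun_prop
  have hb : ∀ (α : L) (t : ℝ), ‖(J α : ℂ) * ((sawtooth (t - α) : ℂ) * e t)‖ ≤ |J α| := by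
    intro α t
    rw [norm_mul, norm_mul, hen, mul_one, Complex.norm_real, Complex.norm_real, Real.norm_eq_abs,
      Real.norm_eq_abs]
    have := abs_sawtooth_le (t - α)
    exact mul_le_of_le_one_right (abs_nonneg _) (by linarith)
  have hi : ∀ α : L, Integrable (fun t => (J α : ℂ) * ((sawtooth (t - α) : ℂ) * e t))
      (volume.restrict (Set.Icc 0 (2 * Real.pi))) := by
    intro α
    refine Integrable.of_bound (Measurable.aestronglyMeasurable ?_) (|J α|)
      (ae_of_all _ fun t => hb α t)
    have h1 : Measurable fun t : ℝ => (sawtooth (t - α) : ℂ) :=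
      Complex.measurable_ofReal.comp (measurable_sawtooth.comp (measurable_id.sub_const _))
    exact measurable_const.mul (h1.mul hec.measurable)
  have hs := hasSum_integral_of_summable_integral_norm hi (by
    refine Summable.of_nonneg_of_le (fun α => integral_nonneg fun t => norm_nonneg _) (fun α => ?_)
      (hJ.mul_right (2 * Real.pi))
    calc ∫ t in Set.Icc 0 (2 * Real.pi), ‖(J α : ℂ) * ((sawtooth (t - α) : ℂ) * e t)‖
        ≤ ∫ _ in Set.Icc 0 (2 * Real.pi), |J α| :=
          integral_mono (hi α).norm (integrable_const _) fun t => hb α t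
      _ = |J α| * (2 * Real.pi) := by
          rw [setIntegral_const, smul_eq_mul, mul_comm]
          simp [Real.pi_pos.le])
  have h1 : ∀ t, (jumpPart J L t : ℂ) * e t =
      ∑' α : L, (J α : ℂ) * ((sawtooth (t - α) : ℂ) * e t) := by
    intro t
    rw [jumpPart, Complex.ofReal_tsum, ← tsum_mul_right]
    refine tsum_congr fun α => ?_
    push_cast
    ring
  have h2 : ∫ t in Set.Icc 0 (2 * Real.pi), (jumpPart J L t : ℂ) * e t =
      ∑' α : L, (J α : ℂ) * ∫ t in Set.Icc 0 (2 * Real.pi), (sawtooth (t - α) : ℂ) * e t := by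
    simp only [h1]
    rw [← hs.tsum_eq]
    simp only [integral_const_mul]
  rw [lineCoefficient, h2]
  simp only [he, integral_sawtooth_mul_exp]
  split_ifs with hr
  · simp
  · rw [jumpSum]
    simp only [← mul_div_assoc, tsum_div_const]

lemma lineCoefficient_jumpPart_zero (hL : L.Countable) (hJ : Summable fun α : L => |J α|) :
    lineCoefficient (jumpPart J L) 0 = 0 := by
  simp [lineCoefficient_jumpPart hL hJ]

lemma sum_norm_lineCoefficient_jumpPart (hL : L.Countable) (hJ : Summable fun α : L => |J α|)
    (n : ℕ) : ∑ r ∈ Finset.Icc (-(n : ℤ)) n, ‖lineCoefficient (jumpPart J L) r‖ =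
      Real.pi⁻¹ * ∑ k ∈ Finset.range n, ‖jumpSeq J L (k + 1)‖ / ((k : ℝ) + 1) := by
  rw [sum_Icc_neg, lineCoefficient_jumpPart_zero hL hJ, norm_zero, zero_add, Finset.mul_sum]
  refine Finset.sum_congr rfl fun k _ => ?_
  have h0 : (k : ℤ) + 1 ≠ 0 := by omega
  have h1 : jumpSum J L ((k : ℤ) + 1) = jumpSeq J L (k + 1) := by
    rw [← jumpSum_natCast]
    push_cast
    rfl
  have h2 : ‖(k : ℂ) + 1‖ = (k : ℝ) + 1 := by
    rw [← Nat.cast_add_one, Complex.norm_natCast]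
    push_cast
    rfl
  rw [lineCoefficient_jumpPart hL hJ, lineCoefficient_jumpPart hL hJ, if_neg h0,
    if_neg (neg_ne_zero.2 h0), jumpSum_neg, h1]
  simp only [norm_mul, norm_div, norm_inv, Complex.norm_conj, Complex.norm_I, Int.cast_neg,
    norm_neg, Int.cast_add, Int.cast_natCast, Int.cast_one, h2, Complex.norm_real,
    Complex.norm_ofNat, Real.norm_eq_abs, abs_of_pos Real.pi_pos, one_mul]
  have := Real.pi_pos
  field_simp
  ring

lemma summable_cosSum (hJ : Summable fun α : L => |J α|) (m : ℕ) (t : ℝ) :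
    Summable fun α : L => J α * cosSum m (t - α) := by
  refine Summable.of_norm_bounded (hJ.mul_right (harmonicSum m)) fun α => ?_
  rw [norm_mul, Real.norm_eq_abs, Real.norm_eq_abs]
  exact mul_le_mul_of_nonneg_left (abs_cosSum_le _ _) (abs_nonneg _)

/-- The conjugate partial sums of the jump part. -/
lemma sum_sign_mul_lineCoefficient_jumpPart (hL : L.Countable)
    (hJ : Summable fun α : L => |J α|) (m : ℕ) (t : ℝ) :
    -Complex.I * ∑ r ∈ Finset.Icc (-(m : ℤ)) m, ((r.sign : ℤ) : ℂ) *
      lineCoefficient (jumpPart J L) r * Complex.exp (Complex.I * ((r * t : ℝ) : ℂ)) =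
      ((-(Real.pi⁻¹ * ∑' α : L, J α * cosSum m (t - α)) : ℝ) : ℂ) := by
  have hterm : ∀ k : ℕ, HasSum (fun α : L => Complex.I * (Real.pi : ℂ)⁻¹ * ((J α : ℂ) *
      ((Real.cos (((k : ℝ) + 1) * (t - α)) / ((k : ℝ) + 1) : ℝ) : ℂ)) * (-1))
      (lineCoefficient (jumpPart J L) ((k : ℤ) + 1) *
        Complex.exp (Complex.I * ((((k : ℤ) + 1 : ℤ) * t : ℝ) : ℂ)) -
      lineCoefficient (jumpPart J L) (-((k : ℤ) + 1)) *
        Complex.exp (Complex.I * (((-((k : ℤ) + 1) : ℤ) * t : ℝ) : ℂ))) := by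
    intro k
    have h0 : (k : ℤ) + 1 ≠ 0 := by omega
    rw [lineCoefficient_jumpPart hL hJ, lineCoefficient_jumpPart hL hJ, if_neg h0,
      if_neg (neg_ne_zero.2 h0)]
    have e1 := ((((summable_jumpSum hJ ((k : ℤ) + 1)).hasSum.div_const
      (Complex.I * (((k : ℤ) + 1 : ℤ) : ℂ))).mul_left (2 * (Real.pi : ℂ))⁻¹).mul_right
        (Complex.exp (Complex.I * ((((k : ℤ) + 1 : ℤ) * t : ℝ) : ℂ))))
    have e2 := ((((summable_jumpSum hJ (-((k : ℤ) + 1))).hasSum.div_const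
      (Complex.I * ((-((k : ℤ) + 1) : ℤ) : ℂ))).mul_left (2 * (Real.pi : ℂ))⁻¹).mul_right
        (Complex.exp (Complex.I * (((-((k : ℤ) + 1) : ℤ) * t : ℝ) : ℂ))))
    refine (e1.sub e2).congr_fun fun α => ?_
    have e3 : Complex.exp (Complex.I * (((-((k : ℤ) + 1) : ℤ) * (α : ℝ) : ℝ) : ℂ)) *
        Complex.exp (Complex.I * ((((k : ℤ) + 1 : ℤ) * t : ℝ) : ℂ)) =
        Complex.exp ((((k : ℝ) + 1) * (t - α) : ℝ) * Complex.I) := by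
      rw [← Complex.exp_add]
      congr 1
      push_cast
      ring
    have e4 : Complex.exp (Complex.I * (((-(-((k : ℤ) + 1)) : ℤ) * (α : ℝ) : ℝ) : ℂ)) *
        Complex.exp (Complex.I * (((-((k : ℤ) + 1) : ℤ) * t : ℝ) : ℂ)) =
        Complex.exp (-((((k : ℝ) + 1) * (t - α) : ℝ) * Complex.I)) := by
      rw [← Complex.exp_add]
      congr 1
      push_cast
      ring
    have hk : (k : ℂ) + 1 ≠ 0 := by exact_mod_cast h0
    have hπ : (Real.pi : ℂ) ≠ 0 := by exact_mod_cast Real.pi_ne_zero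
    have e5 : ((Real.cos (((k : ℝ) + 1) * (t - α)) / ((k : ℝ) + 1) : ℝ) : ℂ) =
        (Complex.exp ((((k : ℝ) + 1) * (t - α) : ℝ) * Complex.I) +
          Complex.exp (-((((k : ℝ) + 1) * (t - α) : ℝ) * Complex.I))) / 2 / ((k : ℂ) + 1) := by
      rw [Complex.ofReal_div, Complex.ofReal_cos, Complex.cos, neg_mul]
      push_cast
      rfl
    rw [e5, ← e3, ← e4]
    generalize Complex.exp (Complex.I * (((-((k : ℤ) + 1) : ℤ) * (α : ℝ) : ℝ) : ℂ)) = A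
    generalize Complex.exp (Complex.I * ((((k : ℤ) + 1 : ℤ) * t : ℝ) : ℂ)) = B
    generalize Complex.exp (Complex.I * (((-(-((k : ℤ) + 1)) : ℤ) * (α : ℝ) : ℝ) : ℂ)) = A'
    generalize Complex.exp (Complex.I * (((-((k : ℤ) + 1) : ℤ) * t : ℝ) : ℂ)) = B'
    push_cast
    rw [div_eq_mul_inv _ (Complex.I * ((k : ℂ) + 1)), div_eq_mul_inv _ (Complex.I * -((k : ℂ) + 1))]
    simp only [mul_inv, Complex.inv_I, inv_neg]
    field_simp
    ring
  have hsum := (hasSum_sum fun k (_ : k ∈ Finset.range m) => hterm k).mul_left (-Complex.I)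
  have hsign1 : ∀ k : ℕ, ((k : ℤ) + 1).sign = 1 := fun k => Int.sign_eq_one_of_pos (by positivity)
  have hLHS : ∑ r ∈ Finset.Icc (-(m : ℤ)) m, ((r.sign : ℤ) : ℂ) *
      lineCoefficient (jumpPart J L) r * Complex.exp (Complex.I * ((r * t : ℝ) : ℂ)) =
      ∑ k ∈ Finset.range m, (lineCoefficient (jumpPart J L) ((k : ℤ) + 1) *
        Complex.exp (Complex.I * ((((k : ℤ) + 1 : ℤ) * t : ℝ) : ℂ)) -
      lineCoefficient (jumpPart J L) (-((k : ℤ) + 1)) *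
        Complex.exp (Complex.I * (((-((k : ℤ) + 1) : ℤ) * t : ℝ) : ℂ))) := by
    rw [sum_Icc_neg]
    simp only [Int.sign_zero, Int.cast_zero, zero_mul, zero_add, Int.sign_neg, hsign1, Int.cast_one,
      one_mul, Int.cast_neg (1 : ℤ), neg_mul, sub_eq_add_neg]
  rw [hLHS, ← hsum.tsum_eq, ← tsum_mul_left, ← tsum_neg, Complex.ofReal_tsum]
  refine tsum_congr fun α => ?_
  rw [cosSum, Complex.ofReal_neg, Complex.ofReal_mul, Complex.ofReal_mul, Complex.ofReal_sum,
    Finset.mul_sum, Finset.mul_sum, Finset.mul_sum, ← Finset.sum_neg_distrib]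
  refine Finset.sum_congr rfl fun k _ => ?_
  rw [Complex.ofReal_inv]
  linear_combination ((Real.pi : ℂ)⁻¹ * ((J α : ℂ) *
      ((Real.cos (((k : ℝ) + 1) * (t - α)) / ((k : ℝ) + 1) : ℝ) : ℂ))) * Complex.I_mul_I

end JumpCoefficients

/-! ### Splitting off the jump part -/

section Decomposition

variable {d : ℕ} {f : (Fin d → ℝ) → ℝ} {J : Fin d → ℝ → ℝ} {C : ℝ}

lemma isIntegrableTorusFun_jumpPart {J : ℝ → ℝ} {L : Set ℝ} (hL : L.Countable)
    (hJ : Summable fun α : L => |J α|) (k : Fin d) :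
    IsIntegrableTorusFun fun x : Fin d → ℝ => jumpPart J L (x k) := by
  refine IsIntegrableTorusFun.of_ae_le (A := (∑' α : L, |J α|) * (1 / 2)) (C := 0)
    ((measurable_jumpPart hL hJ).comp (measurable_pi_apply k)) (fun x n => ?_)
    (ae_of_all _ fun x => by simpa using abs_jumpPart_le hJ (x k))
  exact jumpPart_periodic.int_mul (n k) (x k)

lemma fourierCoefficient_eq_regularPart_add (hF : HasLipschitzIncrements (regularPart f J) C)
    (hJ : ∀ k, Summable fun α : jumpSet J k => |J k α|) (ν : Fin d → ℤ) :
    fourierCoefficient f ν = fourierCoefficient (regularPart f J) ν +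
      ∑ k, fourierCoefficient (fun x => jumpPart (J k) (jumpSet J k) (x k)) ν := by
  have h1 : ∀ k, IsIntegrableTorusFun fun x : Fin d → ℝ => jumpPart (J k) (jumpSet J k) (x k) :=
    fun k => isIntegrableTorusFun_jumpPart (countable_jumpSet (hJ k)) (hJ k) k
  simp only [fourierCoefficient_eq]
  rw [← Finset.mul_sum, ← mul_add,
    ← integral_finsetSum _ fun k _ => (h1 k).integrable_mul_character (-ν),
    ← integral_add (hF.isIntegrable.integrable_mul_character (-ν))
      (integrable_finsetSum _ fun k _ => (h1 k).integrable_mul_character (-ν))]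
  congr 1
  refine integral_congr_ae (ae_of_all _ fun x => ?_)
  simp only [regularPart]
  rw [← Finset.sum_mul, ← add_mul]
  congr 1
  push_cast
  ring

/-- Only the jumps in the direction `j` contribute to the `j`-th conjugate partial sums, through
translated cosine sums. -/
lemma conjPartialSum_eq_regularPart_add (hF : HasLipschitzIncrements (regularPart f J) C)
    (hJ : ∀ k, Summable fun α : jumpSet J k => |J k α|) (j : Fin d) (m : ℕ) (x : Fin d → ℝ) :
    conjPartialSum f j m x = conjPartialSum (regularPart f J) j m x +
      ((-(Real.pi⁻¹ * ∑' α : jumpSet J j, J j α * cosSum m (x j - α)) : ℝ) : ℂ) := by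
  rw [← sum_sign_mul_lineCoefficient_jumpPart (countable_jumpSet (hJ j)) (hJ j)]
  simp only [conjPartialSum]
  rw [← mul_add]
  congr 1
  simp only [fourierCoefficient_eq_regularPart_add hF hJ, mul_add, add_mul, Finset.mul_sum,
    Finset.sum_mul]
  rw [Finset.sum_add_distrib, Finset.sum_comm]
  congr 1
  rw [Finset.sum_eq_single j]
  · rw [sum_freqBox_of_axis (k := j)]
    · refine Finset.sum_congr rfl fun r _ => ?_
      have h1 : character (Pi.single j r) x = Complex.exp (Complex.I * ((r * x j : ℝ) : ℂ)) := by
        rw [character_eq_prod, Finset.prod_eq_single j]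
        · simp
        · intro k _ hk
          simp [hk]
        · simp
      rw [h1, fourierCoefficient_comp_eval, if_pos fun l hl => by simp [hl]]
      simp
    · intro ν hν
      rw [fourierCoefficient_comp_eval, if_neg hν]
      simp
  · intro k _ hk
    refine Finset.sum_eq_zero fun ν _ => ?_
    rw [fourierCoefficient_comp_eval]
    split_ifs with h
    · simp [h j (Ne.symm hk)]
    · simp
  · simp

/-- The coefficient sums of `f` differ from those of the jump part by a bounded quantity. -/
lemma abs_coeffSum_sub_le (hF : HasLipschitzIncrements (regularPart f J) C)
    (hJ : ∀ k, Summable fun α : jumpSet J k => |J k α|) (n : ℕ) :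
    |coeffSum f n - ∑ k, Real.pi⁻¹ * ∑ q ∈ Finset.range n,
      ‖jumpSeq (J k) (jumpSet J k) (q + 1)‖ / ((q : ℝ) + 1)| ≤ coeffSum (regularPart f J) n := by
  set c : Fin d → (Fin d → ℤ) → ℂ := fun k ν =>
    fourierCoefficient (fun x => jumpPart (J k) (jumpSet J k) (x k)) ν with hc
  have hczero : ∀ k ν, ν k = 0 → c k ν = 0 := by
    intro k ν h
    simp only [hc]
    rw [fourierCoefficient_comp_eval, h,
      lineCoefficient_jumpPart_zero (countable_jumpSet (hJ k)) (hJ k), ite_self]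
  -- at each frequency at most one axis contributes
  have hnorm : ∀ ν, ‖∑ k, c k ν‖ = ∑ k, ‖c k ν‖ := by
    intro ν
    by_cases h : ∃ k, c k ν ≠ 0
    · obtain ⟨k, hk⟩ := h
      have h1 : ∀ l, l ≠ k → c l ν = 0 := by
        intro l hl
        refine hczero l ν ?_
        by_contra h2
        refine hk ?_
        simp only [hc]
        rw [fourierCoefficient_comp_eval, if_neg fun h3 => h2 (h3 l hl)]
      rw [Finset.sum_eq_single k (fun l _ hl => h1 l hl) (by simp),
        Finset.sum_eq_single k (fun l _ hl => by rw [h1 l hl, norm_zero]) (by simp)]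
    · push Not at h
      simp [h]
  have haxis : ∀ k, ∑ ν ∈ freqBox d n, ‖c k ν‖ = Real.pi⁻¹ * ∑ q ∈ Finset.range n,
      ‖jumpSeq (J k) (jumpSet J k) (q + 1)‖ / ((q : ℝ) + 1) := by
    intro k
    rw [← sum_norm_lineCoefficient_jumpPart (countable_jumpSet (hJ k)) (hJ k),
      sum_freqBox_of_axis (k := k)]
    · refine Finset.sum_congr rfl fun r _ => ?_
      simp only [hc]
      rw [fourierCoefficient_comp_eval, if_pos fun l hl => by simp [hl]]
      simp
    · intro ν hν
      simp only [hc]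
      rw [fourierCoefficient_comp_eval, if_neg hν, norm_zero]
  simp only [← haxis]
  rw [Finset.sum_comm, coeffSum, coeffSum, ← Finset.sum_sub_distrib]
  refine (Finset.abs_sum_le_sum_abs _ _).trans (Finset.sum_le_sum fun ν _ => ?_)
  rw [← hnorm]
  refine (abs_norm_sub_norm_le _ _).trans (le_of_eq ?_)
  rw [fourierCoefficient_eq_regularPart_add hF hJ, add_sub_cancel_right]

/-- The coefficient sums grow like a multiple of `log n`, which is nonzero in the presence of
jumps. -/
lemma exists_tendsto_coeffSum_div_log (hF : HasLipschitzIncrements (regularPart f J) C)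
    (hJ : ∀ k, Summable fun α : jumpSet J k => |J k α|) (j : Fin d) :
    ∃ μ : ℝ, Tendsto (fun n : ℕ => coeffSum f n / Real.log n) atTop (𝓝 μ) ∧
      ((jumpSet J j).Nonempty → μ ≠ 0) := by
  choose μ hμ using fun k => exists_tendsto_absLogMean_jumpSeq (hJ k)
  have hμ0 : ∀ k, 0 ≤ μ k := fun k => ge_of_tendsto' (hμ k) fun n =>
    div_nonneg (Finset.sum_nonneg fun _ _ => by positivity) (Real.log_natCast_nonneg n)
  obtain ⟨S, hS⟩ := hF.exists_sum_fourierCoefficient_le j.pos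
  have h1 : Tendsto (fun n : ℕ => ∑ k, Real.pi⁻¹ * absLogMean (jumpSeq (J k) (jumpSet J k)) n) atTop
      (𝓝 (∑ k, Real.pi⁻¹ * μ k)) := tendsto_finsetSum _ fun k _ => (hμ k).const_mul _
  refine ⟨∑ k, Real.pi⁻¹ * μ k, ?_, ?_⟩
  · have h2 : Tendsto (fun n : ℕ => coeffSum f n / Real.log n -
        ∑ k, Real.pi⁻¹ * absLogMean (jumpSeq (J k) (jumpSet J k)) n) atTop (𝓝 0) := by
      refine squeeze_zero_norm' ?_ (tendsto_const_div_log S)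
      filter_upwards [eventually_ge_atTop 3] with n hn
      have hlog := one_le_log_natCast hn
      have h3 := (abs_coeffSum_sub_le hF hJ n).trans (hS n)
      have h4 : coeffSum f n / Real.log n -
          ∑ k, Real.pi⁻¹ * absLogMean (jumpSeq (J k) (jumpSet J k)) n =
          (coeffSum f n - ∑ k, Real.pi⁻¹ * ∑ q ∈ Finset.range n,
            ‖jumpSeq (J k) (jumpSet J k) (q + 1)‖ / ((q : ℝ) + 1)) / Real.log n := by
        rw [sub_div, Finset.sum_div]
        simp only [absLogMean, mul_div_assoc]
      rw [h4, Real.norm_eq_abs, abs_div, abs_of_nonneg (by linarith : 0 ≤ Real.log n)]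
      exact div_le_div_of_nonneg_right h3 (by linarith)
    simpa using h2.add h1
  · rintro ⟨α, hα⟩
    have h2 : |J j α| ≤ μ j :=
      abs_le_of_tendsto_absLogMean (jumpSet_subset J j) (hJ j) (hμ j) ⟨α, hα⟩
    have h3 : 0 < μ j := (abs_pos.2 hα.2).trans_le h2
    have h4 : 0 < ∑ k, Real.pi⁻¹ * μ k :=
      Finset.sum_pos' (fun k _ => mul_nonneg (by positivity) (hμ0 k))
        ⟨j, Finset.mem_univ j, by positivity⟩
    exact h4.ne'

/-! ### The weights of the conjugate partial sums -/

/-- The sum of the absolute values of the coefficients with `‖ν‖_∞ = m`. -/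
def shellSum (f : (Fin d → ℝ) → ℝ) (m : ℕ) : ℝ :=
  ∑ ν ∈ freqBox d m with maxNorm ν = m, ‖fourierCoefficient f ν‖

lemma shellSum_nonneg (f : (Fin d → ℝ) → ℝ) (m : ℕ) : 0 ≤ shellSum f m :=
  Finset.sum_nonneg fun _ _ => norm_nonneg _

lemma mem_freqBox {ν : Fin d → ℤ} {n : ℕ} : ν ∈ freqBox d n ↔ maxNorm ν ≤ n := by
  simp only [freqBox, Fintype.mem_piFinset, maxNorm, Finset.sup_le_iff, Finset.mem_univ,
    true_implies, Finset.mem_Icc]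
  refine forall_congr' fun k => ?_
  omega

lemma sum_freqBox_eq_sum_shellSum (f : (Fin d → ℝ) → ℝ) (X : ℕ → ℂ) (n : ℕ) :
    ∑ ν ∈ freqBox d n, X (maxNorm ν) * (‖fourierCoefficient f ν‖ : ℂ) =
      ∑ m ∈ Finset.range (n + 1), X m * (shellSum f m : ℂ) := by
  rw [← Finset.sum_fiberwise_of_maps_to (t := Finset.range (n + 1)) (g := maxNorm)
    fun ν hν => Finset.mem_range_succ_iff.2 (mem_freqBox.1 hν)]
  refine Finset.sum_congr rfl fun m hm => ?_
  rw [shellSum, Complex.ofReal_sum, Finset.mul_sum]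
  refine Finset.sum_congr ?_ fun ν hν => ?_
  · ext ν
    have := Finset.mem_range_succ_iff.1 hm
    simp only [Finset.mem_filter, mem_freqBox]
    omega
  · rw [(Finset.mem_filter.1 hν).2]

lemma coeffSum_eq_sum_shellSum (f : (Fin d → ℝ) → ℝ) (n : ℕ) :
    coeffSum f n = ∑ m ∈ Finset.range (n + 1), shellSum f m := by
  have h := sum_freqBox_eq_sum_shellSum f (fun _ => 1) n
  simp only [one_mul] at h
  exact_mod_cast h

/-- The weights with which the conjugate partial sums enter the jump detector. -/
def shellWeight (f : (Fin d → ℝ) → ℝ) (n m : ℕ) : ℝ :=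
  shellSum f m / (Real.log n * coeffSum f n)

lemma coeffSum_nonneg (f : (Fin d → ℝ) → ℝ) (n : ℕ) : 0 ≤ coeffSum f n :=
  Finset.sum_nonneg fun _ _ => norm_nonneg _

lemma shellWeight_nonneg (f : (Fin d → ℝ) → ℝ) (n m : ℕ) : 0 ≤ shellWeight f n m :=
  div_nonneg (shellSum_nonneg f m) (mul_nonneg (Real.log_natCast_nonneg n) (coeffSum_nonneg f n))

lemma sum_shellWeight_le (f : (Fin d → ℝ) → ℝ) (n : ℕ) :
    ∑ m ∈ Finset.range (n + 1), shellWeight f n m ≤ 1 / Real.log n := by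
  simp only [shellWeight]
  rw [← Finset.sum_div, ← coeffSum_eq_sum_shellSum]
  rcases (coeffSum_nonneg f n).eq_or_lt with h | h
  · rw [← h]
    simpa using Real.log_natCast_nonneg n
  · rw [mul_comm, ← div_div, div_self h.ne']

lemma sum_shellWeight_mul_log_le (f : (Fin d → ℝ) → ℝ) {n : ℕ} (hn : 3 ≤ n) :
    ∑ m ∈ Finset.range (n + 1), shellWeight f n m * Real.log (m + 1) ≤ 2 := by
  have hlog := one_le_log_natCast hn
  have h0 : Real.log ((n : ℝ) + 1) ≤ 2 * Real.log n :=
    (log_add_one_le_harmonicSum n).trans ((harmonicSum_le n).trans (by linarith))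
  calc ∑ m ∈ Finset.range (n + 1), shellWeight f n m * Real.log (m + 1)
      ≤ ∑ m ∈ Finset.range (n + 1), shellWeight f n m * Real.log (n + 1) := by
        refine Finset.sum_le_sum fun m hm => mul_le_mul_of_nonneg_left ?_ (shellWeight_nonneg f n m)
        have : (m : ℝ) ≤ n := by exact_mod_cast Finset.mem_range_succ_iff.1 hm
        exact Real.log_le_log (by positivity) (by linarith)
    _ ≤ 1 / Real.log n * (2 * Real.log n) := by
        rw [← Finset.sum_mul]
        exact mul_le_mul (sum_shellWeight_le f n) h0
          (Real.log_nonneg (by linarith [n.cast_nonneg (α := ℝ)])) (by positivity)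
    _ = 2 := by field_simp

lemma tendsto_sum_shellWeight (f : (Fin d → ℝ) → ℝ) :
    Tendsto (fun n => ∑ m ∈ Finset.range (n + 1), shellWeight f n m) atTop (𝓝 0) :=
  squeeze_zero (fun n => Finset.sum_nonneg fun _ _ => shellWeight_nonneg f n _)
    (sum_shellWeight_le f) (tendsto_const_div_log 1)

lemma tendsto_sum_shellWeight_mul_log (hF : HasLipschitzIncrements (regularPart f J) C)
    (hJ : ∀ k, Summable fun α : jumpSet J k => |J k α|) {j : Fin d} (hj : (jumpSet J j).Nonempty) :
    Tendsto (fun n => ∑ m ∈ Finset.range (n + 1), shellWeight f n m * Real.log (m + 1)) atTop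
      (𝓝 (1 / 2)) := by
  obtain ⟨μ, hμ, hμ0⟩ := exists_tendsto_coeffSum_div_log hF hJ j
  refine (tendsto_sum_mul_log_div (hμ0 hj) (coeffSum_eq_sum_shellSum f) hμ).congr fun n => ?_
  rw [Finset.sum_div]
  refine Finset.sum_congr rfl fun m _ => ?_
  rw [shellWeight]
  ring

/-- The part of the jump detector that carries the jumps: a superposition of weighted averages of
cosine sums, centred at the jumps. -/
def jumpTrace (w : ℕ → ℕ → ℝ) (J : ℝ → ℝ) (L : Set ℝ) (n : ℕ) (t : ℝ) : ℝ :=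
  Real.pi⁻¹ * ∑' α : L, J α * ∑ m ∈ Finset.range (n + 1), w n m * cosSum m (t - α)

lemma jumpDetector_eq (hF : HasLipschitzIncrements (regularPart f J) C)
    (hJ : ∀ k, Summable fun α : jumpSet J k => |J k α|) (j : Fin d) (n : ℕ) (x : Fin d → ℝ) :
    jumpDetector f j n x =
      (∑ m ∈ Finset.range (n + 1), (-shellWeight f n m) • conjPartialSum (regularPart f J) j m x) +
        (jumpTrace (shellWeight f) (J j) (jumpSet J j) n (x j) : ℂ) := by
  have h1 : jumpTrace (shellWeight f) (J j) (jumpSet J j) n (x j) =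
      ∑ m ∈ Finset.range (n + 1), shellWeight f n m *
        (Real.pi⁻¹ * ∑' α : jumpSet J j, J j α * cosSum m (x j - α)) := by
    have h2 := hasSum_sum fun m (_ : m ∈ Finset.range (n + 1)) =>
      ((summable_cosSum (hJ j) m (x j)).hasSum.mul_left (shellWeight f n m))
    rw [jumpTrace]
    have h3 : ∀ α : jumpSet J j, J j α * ∑ m ∈ Finset.range (n + 1),
        shellWeight f n m * cosSum m (x j - α) =
        ∑ m ∈ Finset.range (n + 1), shellWeight f n m * (J j α * cosSum m (x j - α)) := by
      intro α
      rw [Finset.mul_sum]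
      exact Finset.sum_congr rfl fun m _ => by ring
    simp only [h3]
    rw [h2.tsum_eq, Finset.mul_sum]
    exact Finset.sum_congr rfl fun m _ => by ring
  rw [jumpDetector, sum_freqBox_eq_sum_shellSum f (fun m => conjPartialSum f j m x), h1,
    Complex.ofReal_sum, ← Finset.sum_add_distrib, Finset.mul_sum]
  refine Finset.sum_congr rfl fun m _ => ?_
  rw [conjPartialSum_eq_regularPart_add hF hJ, Complex.real_smul, shellWeight]
  push_cast
  ring

end Decomposition

/-! ### The variation of the jump trace -/

section JumpTrace

variable {w : ℕ → ℕ → ℝ} {J : ℝ → ℝ} {L : Set ℝ}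

/-- Weights that vanish in the limit, while the average of `log (m + 1)` against them stays
bounded, and tends to `1 / 2` if there are jumps. -/
structure IsLogWeight (w : ℕ → ℕ → ℝ) (L : Set ℝ) : Prop where
  nonneg : ∀ n m, 0 ≤ w n m
  sum_tendsto : Tendsto (fun n => ∑ m ∈ Finset.range (n + 1), w n m) atTop (𝓝 0)
  sum_log_le : ∀ᶠ n : ℕ in atTop, ∑ m ∈ Finset.range (n + 1), w n m * Real.log (m + 1) ≤ 2
  sum_log_tendsto : L.Nonempty →
    Tendsto (fun n => ∑ m ∈ Finset.range (n + 1), w n m * Real.log (m + 1)) atTop (𝓝 (1 / 2))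

lemma IsLogWeight.sum_mul_le (hw : IsLogWeight w L) {X Y : ℕ → ℝ} {c K : ℝ}
    (h : ∀ m, X m ≤ c * Y m + K) (n : ℕ) :
    ∑ m ∈ Finset.range (n + 1), w n m * X m ≤
      c * ∑ m ∈ Finset.range (n + 1), w n m * Y m + K * ∑ m ∈ Finset.range (n + 1), w n m := by
  rw [Finset.mul_sum, Finset.mul_sum, ← Finset.sum_add_distrib]
  refine Finset.sum_le_sum fun m _ => ?_
  have := mul_le_mul_of_nonneg_left (h m) (hw.nonneg n m)
  linarith

lemma harmonicSum_le_log_add_one (m : ℕ) : harmonicSum m ≤ 1 * Real.log (m + 1) + 1 := by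
  have h6 := harmonicSum_le m
  have h7 : Real.log m ≤ Real.log (m + 1) := by
    rcases m.eq_zero_or_pos with rfl | hm
    · simp
    · exact Real.log_le_log (by exact_mod_cast hm) (by linarith)
  linarith

/-- The averages of cosine sums tend to `1 / 2` at the centre. -/
lemma IsLogWeight.tendsto_sum_cosSum_zero (hw : IsLogWeight w L) (hL : L.Nonempty) :
    Tendsto (fun n => ∑ m ∈ Finset.range (n + 1), w n m * cosSum m 0) atTop (𝓝 (1 / 2)) := by
  simp only [cosSum_zero_right]
  have h1 := ((hw.sum_log_tendsto hL).const_mul 1).add (hw.sum_tendsto.const_mul 1)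
  rw [mul_zero, add_zero, one_mul] at h1
  exact tendsto_of_tendsto_of_tendsto_of_le_of_le (hw.sum_log_tendsto hL) h1
    (fun n => Finset.sum_le_sum fun m _ =>
      mul_le_mul_of_nonneg_left (log_add_one_le_harmonicSum m) (hw.nonneg n m))
    fun n => hw.sum_mul_le harmonicSum_le_log_add_one n

/-- The averages of cosine sums tend to `0` away from the centre. -/
lemma IsLogWeight.tendsto_sum_cosSum (hw : IsLogWeight w L) {t : ℝ} (ht : Real.sin (t / 2) ≠ 0) :
    Tendsto (fun n => ∑ m ∈ Finset.range (n + 1), w n m * cosSum m t) atTop (𝓝 0) := by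
  obtain ⟨K, hK⟩ := exists_abs_cosSum_le ht
  refine squeeze_zero_norm (a := fun n => K * ∑ m ∈ Finset.range (n + 1), w n m) (fun n => ?_) ?_
  · rw [Real.norm_eq_abs, Finset.mul_sum]
    refine (Finset.abs_sum_le_sum_abs _ _).trans (Finset.sum_le_sum fun m _ => ?_)
    rw [abs_mul, abs_of_nonneg (hw.nonneg n m), mul_comm]
    exact mul_le_mul_of_nonneg_right (hK m) (hw.nonneg n m)
  · simpa using hw.sum_tendsto.const_mul K

lemma IsLogWeight.eventually_abs_sum_cosSum_le (hw : IsLogWeight w L) :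
    ∀ᶠ n in atTop, ∀ t, |∑ m ∈ Finset.range (n + 1), w n m * cosSum m t| ≤ 3 := by
  filter_upwards [hw.sum_log_le, (tendsto_order.1 hw.sum_tendsto).2 1 one_pos] with n h1 h2 t
  have h3 : |∑ m ∈ Finset.range (n + 1), w n m * cosSum m t| ≤
      ∑ m ∈ Finset.range (n + 1), w n m * harmonicSum m := by
    refine (Finset.abs_sum_le_sum_abs _ _).trans (Finset.sum_le_sum fun m _ => ?_)
    rw [abs_mul, abs_of_nonneg (hw.nonneg n m)]
    exact mul_le_mul_of_nonneg_left (abs_cosSum_le m t) (hw.nonneg n m)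
  have h4 := hw.sum_mul_le harmonicSum_le_log_add_one n
  linarith

/-- The jump trace tends to a multiple of the jump function. -/
lemma IsLogWeight.tendsto_jumpTrace (hw : IsLogWeight w L) (hL : L ⊆ Set.Ioo 0 (2 * Real.pi))
    (hJ : Summable fun α : L => |J α|) {t : ℝ} (ht : t ∈ Set.Icc 0 (2 * Real.pi)) :
    Tendsto (fun n => jumpTrace w J L n t) atTop
      (𝓝 (Real.pi⁻¹ * ∑' α : L, if (α : ℝ) = t then J α * (1 / 2) else 0)) := by
  refine Tendsto.const_mul _ ?_
  refine tendsto_tsum_of_dominated_convergence (bound := fun α : L => |J α| * 3)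
    (hJ.mul_right 3) (fun α => ?_) ?_
  · split_ifs with h
    · rw [h, sub_self, ← h]
      exact (hw.tendsto_sum_cosSum_zero ⟨α, α.2⟩).const_mul _
    · have h1 : t - α ≠ 0 := sub_ne_zero.2 (Ne.symm h)
      have h2 := hL α.2
      have h3 : |t - α| < 2 * Real.pi := by
        rw [abs_lt]
        constructor <;> linarith [ht.1, ht.2, h2.1, h2.2]
      simpa using (hw.tendsto_sum_cosSum (sin_half_ne_zero h1 h3)).const_mul (J α)
  · filter_upwards [hw.eventually_abs_sum_cosSum_le] with n hn α
    rw [Real.norm_eq_abs, abs_mul]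
    exact mul_le_mul_of_nonneg_left (hn _) (abs_nonneg _)

lemma tsum_jump_ite (t : ℝ) : (∑' α : L, if (α : ℝ) = t then J α * (1 / 2) else 0) =
    L.indicator (fun s => J s * (1 / 2)) t := by
  classical
  by_cases h : t ∈ L
  · rw [Set.indicator_of_mem h, tsum_eq_single ⟨t, h⟩]
    · simp
    · intro α hα
      rw [if_neg fun h1 => hα (Subtype.ext h1)]
  · rw [Set.indicator_of_notMem h]
    have h1 : ∀ α : L, (if (α : ℝ) = t then J α * (1 / 2) else 0) = 0 := fun α =>
      if_neg fun h2 : (α : ℝ) = t => h (by rw [← h2]; exact α.2)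
    simp only [h1, tsum_zero]

variable {a b : ℝ}

/-- Every value below the total size of the jumps is eventually exceeded by the variation of the
jump trace, by lower semicontinuity of the variation. -/
lemma IsLogWeight.eventually_lt_eVariationOn (hw : IsLogWeight w L)
    (hL : L ⊆ Set.Ioo 0 (2 * Real.pi)) (hLc : L.Countable) (hJ : Summable fun α : L => |J α|)
    (ha : 0 ≤ a) (hb : b ≤ 2 * Real.pi)
    (hsum : Summable fun α : ↥(L ∩ Set.Ioo a b) => |J α|) {c : ENNReal}
    (hc : c < ENNReal.ofReal (Real.pi⁻¹ * ∑' α : ↥(L ∩ Set.Ioo a b), |J α|)) :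
    ∀ᶠ n in atTop, c < eVariationOn (jumpTrace w J L n) (Set.Icc a b) := by
  set P : ℝ → ℝ := fun t => Real.pi⁻¹ * L.indicator (fun s => J s * (1 / 2)) t with hP
  have hlim : ∀ t ∈ Set.Icc a b, Tendsto (fun n => jumpTrace w J L n t) atTop (𝓝 (P t)) := by
    intro t ht
    have := hw.tendsto_jumpTrace hL hJ (t := t) ⟨ha.trans ht.1, ht.2.trans hb⟩
    rwa [tsum_jump_ite] at this
  refine eVariationOn.lowerSemicontinuous_aux hlim ?_
  have h1 := (ENNReal.tendsto_ofReal (hsum.hasSum.mul_left Real.pi⁻¹))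
  obtain ⟨A, hA⟩ := ((tendsto_order.1 h1).1 c hc).exists
  refine hA.trans_le ?_
  have h2 : ENNReal.ofReal (∑ α ∈ A, Real.pi⁻¹ * |J α|) =
      ∑ α ∈ A.map (Function.Embedding.subtype _), ENNReal.ofReal (Real.pi⁻¹ * |J α|) := by
    rw [ENNReal.ofReal_sum_of_nonneg fun _ _ => by positivity, Finset.sum_map]
    rfl
  rw [h2]
  have hmem : ∀ α ∈ A.map (Function.Embedding.subtype (· ∈ L ∩ Set.Ioo a b)),
      α ∈ L ∩ Set.Ioo a b := by
    intro α hα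
    simp only [Finset.mem_map, Function.Embedding.subtype_apply] at hα
    obtain ⟨β, _, rfl⟩ := hα
    exact β.2
  refine sum_le_eVariationOn_of_local (fun α hα => (hmem α hα).2) fun α hα c e hac hcα hαe heb => ?_
  -- between jumps, the limit function vanishes on both sides of `α`
  have hdense : Dense Lᶜ := hLc.dense_compl ℝ
  obtain ⟨s, hs, hsI⟩ := hdense.exists_between hcα
  obtain ⟨t, ht, htI⟩ := hdense.exists_between hαe
  have hPs : P s = 0 := by simp only [hP]; rw [Set.indicator_of_notMem hs, mul_zero]
  have hPt : P t = 0 := by simp only [hP]; rw [Set.indicator_of_notMem ht, mul_zero]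
  have hPα : P α = Real.pi⁻¹ * (J α * (1 / 2)) := by
    simp only [hP]; rw [Set.indicator_of_mem (hmem α hα).1]
  have e1 : edist (P α) (P s) ≤ eVariationOn P (Set.Icc c α) :=
    eVariationOn.edist_le P ⟨hcα.le, le_rfl⟩ ⟨hsI.1.le, hsI.2.le⟩
  have e2 : edist (P α) (P t) ≤ eVariationOn P (Set.Icc α e) :=
    eVariationOn.edist_le P ⟨le_rfl, hαe.le⟩ ⟨htI.1.le, htI.2.le⟩
  have e3 := eVariationOn.Icc_add_Icc P (s := Set.univ) hcα.le hαe.le (Set.mem_univ α)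
  simp only [Set.univ_inter] at e3
  rw [← e3]
  refine le_trans (le_of_eq ?_) (add_le_add e1 e2)
  rw [hPs, hPt, hPα, edist_dist, dist_zero_right, Real.norm_eq_abs, abs_mul, abs_mul,
    abs_of_pos (inv_pos.2 Real.pi_pos), ← ENNReal.ofReal_add (by positivity) (by positivity)]
  congr 1
  norm_num
  ring

/-- Every value above the total size of the jumps eventually bounds the variation of the jump
trace. -/
lemma IsLogWeight.eventually_sum_abs_jumpTrace_le (hw : IsLogWeight w L)
    (hL : L ⊆ Set.Ioo 0 (2 * Real.pi)) (hJ : Summable fun α : L => |J α|)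
    (ha : 0 ≤ a) (hab : a ≤ b) (hb : b ≤ 2 * Real.pi) (haL : a ∉ L) (hbL : b ∉ L) {c : ℝ}
    (hc : Real.pi⁻¹ * ∑' α : ↥(L ∩ Set.Ioo a b), |J α| < c) :
    ∀ᶠ n in atTop, ∀ (N : ℕ) (p : ℕ → ℝ), Monotone p → (∀ k, p k ∈ Set.Icc a b) →
      ∑ k ∈ Finset.range N, |jumpTrace w J L n (p (k + 1)) - jumpTrace w J L n (p k)| ≤ c := by
  classical
  obtain ⟨K, hK0, hK⟩ := exists_integral_abs_sinSum_le
  -- `v n α` is the weighted average of the variations of the cosine sums centred at `α`, and `B n`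
  -- bounds it for every `α`
  set v : ℕ → ℝ → ℝ := fun n α =>
    ∑ m ∈ Finset.range (n + 1), w n m * ∫ t in a..b, |sinSum m (t - α)| with hv
  set B : ℕ → ℝ := fun n => 2 * ∑ m ∈ Finset.range (n + 1), w n m * Real.log (m + 1) +
    K * ∑ m ∈ Finset.range (n + 1), w n m with hB
  have hv0 : ∀ n α, 0 ≤ v n α := fun n α => Finset.sum_nonneg fun m _ =>
    mul_nonneg (hw.nonneg n m) (intervalIntegral.integral_nonneg hab fun _ _ => abs_nonneg _)
  have hvB : ∀ n α, v n α ≤ B n := fun n α =>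
    hw.sum_mul_le (fun m => hK m α a b hab (by linarith)) n
  have hBlim : L.Nonempty → Tendsto B atTop (𝓝 1) := by
    intro hne
    have := ((hw.sum_log_tendsto hne).const_mul 2).add (hw.sum_tendsto.const_mul K)
    norm_num at this
    exact this
  have hBle : ∀ᶠ n in atTop, B n ≤ 4 + K := by
    filter_upwards [hw.sum_log_le, (tendsto_order.1 hw.sum_tendsto).2 1 one_pos] with n h1 h2
    have := mul_le_mul_of_nonneg_left h2.le hK0
    simp only [hB]
    linarith
  have hvlim : ∀ α ∈ L, α ∉ Set.Ioo a b → Tendsto (fun n => v n α) atTop (𝓝 0) := by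
    intro α hα hαI
    have hαI' : α ∉ Set.Icc a b := by
      rintro ⟨h1, h2⟩
      exact hαI ⟨lt_of_le_of_ne h1 fun h => haL (h ▸ hα), lt_of_le_of_ne h2 fun h => hbL (h ▸ hα)⟩
    obtain ⟨M, hM⟩ := exists_integral_abs_sinSum_le_of_notMem ha hab hb (hL hα) hαI'
    refine squeeze_zero (fun n => hv0 n α)
      (fun n => hw.sum_mul_le (Y := fun _ => 0) (c := 0) (K := M) (fun m => by simpa using hM m) n) ?_
    simpa using hw.sum_tendsto.const_mul M
  -- dominated convergence over the jumps
  have hU : Tendsto (fun n => ∑' α : L, |J α| *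
      (if (α : ℝ) ∈ Set.Ioo a b then B n else v n α)) atTop
      (𝓝 (∑' α : L, |J α| * (if (α : ℝ) ∈ Set.Ioo a b then 1 else 0))) := by
    refine tendsto_tsum_of_dominated_convergence (bound := fun α : L => |J α| * (4 + K))
      (hJ.mul_right _) (fun α => ?_) ?_
    · refine Tendsto.const_mul _ ?_
      split_ifs with h
      · exact hBlim ⟨α, α.2⟩
      · exact hvlim α α.2 h
    · filter_upwards [hBle] with n hn α
      have h1 : |(if (α : ℝ) ∈ Set.Ioo a b then B n else v n α)| ≤ 4 + K := by
        have h2 := (hv0 n α).trans (hvB n α)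
        split_ifs
        · rwa [abs_of_nonneg h2]
        · rw [abs_of_nonneg (hv0 n α)]
          exact (hvB n α).trans hn
      rw [Real.norm_eq_abs, abs_mul, abs_abs]
      exact mul_le_mul_of_nonneg_left h1 (abs_nonneg _)
  have hT : ∑' α : L, |J α| * (if (α : ℝ) ∈ Set.Ioo a b then 1 else 0) =
      ∑' α : ↥(L ∩ Set.Ioo a b), |J α| := by
    rw [tsum_subtype L (fun α => |J α| * (if α ∈ Set.Ioo a b then 1 else 0)),
      tsum_subtype (L ∩ Set.Ioo a b) (fun α => |J α|)]
    refine tsum_congr fun α => ?_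
    by_cases h1 : α ∈ L <;> by_cases h2 : α ∈ Set.Ioo a b <;>
      simp only [Set.indicator, Set.mem_inter_iff, h1, h2, and_true, and_false, if_true, if_false,
        mul_one, mul_zero]
  rw [hT] at hU
  have hU' := hU.const_mul Real.pi⁻¹
  filter_upwards [(tendsto_order.1 hU').2 c hc, hBle, hw.eventually_abs_sum_cosSum_le]
    with n hn hBn hcos N p hp hpI
  refine le_trans ?_ hn.le
  have hsumm : ∀ t, Summable fun α : L =>
      J α * ∑ m ∈ Finset.range (n + 1), w n m * cosSum m (t - α) := by
    intro t
    refine Summable.of_norm_bounded (hJ.mul_right 3) fun α => ?_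
    rw [Real.norm_eq_abs, abs_mul]
    exact mul_le_mul_of_nonneg_left (hcos _) (abs_nonneg _)
  set D : L → ℕ → ℝ := fun α k => |J α| * ∑ m ∈ Finset.range (n + 1),
    w n m * |cosSum m (p (k + 1) - α) - cosSum m (p k - α)| with hD
  have hDle : ∀ (α : L) (k : ℕ),
      |J α * ∑ m ∈ Finset.range (n + 1), w n m * cosSum m (p (k + 1) - α) -
      J α * ∑ m ∈ Finset.range (n + 1), w n m * cosSum m (p k - α)| ≤ D α k := by
    intro α k
    rw [← mul_sub, abs_mul, ← Finset.sum_sub_distrib]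
    refine mul_le_mul_of_nonneg_left ?_ (abs_nonneg _)
    refine (Finset.abs_sum_le_sum_abs _ _).trans (Finset.sum_le_sum fun m _ => ?_)
    rw [← mul_sub, abs_mul, abs_of_nonneg (hw.nonneg n m)]
  have hDsum : ∀ (α : L) (M : ℕ), ∑ k ∈ Finset.range M, D α k ≤ |J α| * v n α := by
    intro α M
    simp only [hD]
    rw [← Finset.mul_sum, Finset.sum_comm]
    refine mul_le_mul_of_nonneg_left (Finset.sum_le_sum fun m _ => ?_) (abs_nonneg _)
    rw [← Finset.mul_sum]
    exact mul_le_mul_of_nonneg_left (sum_abs_cosSum_sub_le m α hp hpI M) (hw.nonneg n m)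
  have hD0 : ∀ α k, 0 ≤ D α k := fun α k => mul_nonneg (abs_nonneg _)
    (Finset.sum_nonneg fun m _ => mul_nonneg (hw.nonneg n m) (abs_nonneg _))
  have hvs : Summable fun α : L => |J α| * (if (α : ℝ) ∈ Set.Ioo a b then B n else v n α) := by
    refine Summable.of_nonneg_of_le (fun α => mul_nonneg (abs_nonneg _) ?_) (fun α => ?_)
      (hJ.mul_right (4 + K))
    · split_ifs
      · exact (hv0 n α).trans (hvB n α)
      · exact hv0 n α
    · refine mul_le_mul_of_nonneg_left ?_ (abs_nonneg _)
      split_ifs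
      · exact hBn
      · exact (hvB n α).trans hBn
  have hvle : ∀ α : L, v n α ≤ if (α : ℝ) ∈ Set.Ioo a b then B n else v n α := by
    intro α
    split_ifs
    · exact hvB n α
    · exact le_rfl
  have hDs : ∀ k, Summable fun α : L => D α k := by
    intro k
    refine Summable.of_nonneg_of_le (fun α => hD0 α k) (fun α => ?_) hvs
    refine le_trans ?_ ((hDsum α (k + 1)).trans (mul_le_mul_of_nonneg_left (hvle α) (abs_nonneg _)))
    exact Finset.single_le_sum (f := fun k => D α k) (fun i _ => hD0 α i)
      (Finset.self_mem_range_succ k)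
  have hstep : ∀ k, |jumpTrace w J L n (p (k + 1)) - jumpTrace w J L n (p k)| ≤
      Real.pi⁻¹ * ∑' α : L, D α k := by
    intro k
    rw [jumpTrace, jumpTrace, ← mul_sub, abs_mul, abs_of_pos (inv_pos.2 Real.pi_pos),
      ← (hsumm _).tsum_sub (hsumm _), ← Real.norm_eq_abs]
    refine mul_le_mul_of_nonneg_left ?_ (inv_pos.2 Real.pi_pos).le
    exact tsum_of_norm_bounded (hDs k).hasSum fun α => hDle α k
  refine (Finset.sum_le_sum fun k _ => hstep k).trans ?_
  rw [← Finset.mul_sum]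
  refine mul_le_mul_of_nonneg_left ?_ (inv_pos.2 Real.pi_pos).le
  rw [← Summable.tsum_finsetSum fun k _ => hDs k]
  refine Summable.tsum_le_tsum (fun α => ?_) (summable_sum fun k _ => hDs k) hvs
  exact (hDsum α N).trans (mul_le_mul_of_nonneg_left (hvle α) (abs_nonneg _))

end JumpTrace

/-! ### The variation of the jump detector -/

section Main

variable {d : ℕ} {f : (Fin d → ℝ) → ℝ} {J : Fin d → ℝ → ℝ} {C : ℝ}

lemma isLogWeight_shellWeight (hF : HasLipschitzIncrements (regularPart f J) C)
    (hJ : ∀ k, Summable fun α : jumpSet J k => |J k α|) (j : Fin d) :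
    IsLogWeight (shellWeight f) (jumpSet J j) where
  nonneg := shellWeight_nonneg f
  sum_tendsto := tendsto_sum_shellWeight f
  sum_log_le := by
    filter_upwards [eventually_ge_atTop 3] with n hn using sum_shellWeight_mul_log_le f hn
  sum_log_tendsto := tendsto_sum_shellWeight_mul_log hF hJ

/-- The part of the jump detector that comes from the regular part. -/
def regularDetector (f : (Fin d → ℝ) → ℝ) (J : Fin d → ℝ → ℝ) (j : Fin d) (n : ℕ)
    (x : Fin d → ℝ) : ℂ :=
  ∑ m ∈ Finset.range (n + 1), (-shellWeight f n m) • conjPartialSum (regularPart f J) j m x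

/-- The regular part of the jump detector has vanishing variation. -/
lemma eventually_gridSum_regularDetector_le (hF : HasLipschitzIncrements (regularPart f J) C)
    (j : Fin d) {δ : ℝ} (hδ : 0 < δ) :
    ∀ᶠ n in atTop, ∀ (u : Finset (Fin d)) (N : ℕ) (p : Fin d → ℕ → ℝ) (b : Fin d → ℝ),
      u.Nonempty → IsPeriodGrid u p → gridSum (regularDetector f J j n) u N p b ≤ δ := by
  obtain ⟨K, hK⟩ := hF.exists_gridSum_conjPartialSum_le j (ε := δ / 4) (by positivity)
  have h1 := (tendsto_sum_shellWeight f).const_mul K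
  rw [mul_zero] at h1
  filter_upwards [eventually_ge_atTop 3, (tendsto_order.1 h1).2 (δ / 2) (by positivity)]
    with n hn h2 u N p b hu hp
  have h3 := sum_shellWeight_mul_log_le f hn
  unfold regularDetector
  refine (gridSum_finset_sum_le _ _ u N p b).trans ?_
  calc ∑ m ∈ Finset.range (n + 1),
        gridSum (fun x => (-shellWeight f n m) • conjPartialSum (regularPart f J) j m x) u N p b
      ≤ ∑ m ∈ Finset.range (n + 1), shellWeight f n m * (δ / 4 * Real.log (m + 1) + K) := by
        refine Finset.sum_le_sum fun m _ => ?_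
        rw [gridSum_smul, norm_neg, Real.norm_eq_abs, abs_of_nonneg (shellWeight_nonneg f n m)]
        exact mul_le_mul_of_nonneg_left (hK m u N p b hu hp) (shellWeight_nonneg f n m)
    _ = δ / 4 * ∑ m ∈ Finset.range (n + 1), shellWeight f n m * Real.log (m + 1) +
        K * ∑ m ∈ Finset.range (n + 1), shellWeight f n m := by
        rw [Finset.mul_sum, Finset.mul_sum, ← Finset.sum_add_distrib]
        exact Finset.sum_congr rfl fun m _ => by ring
    _ ≤ δ := by
        have := mul_le_mul_of_nonneg_left h3 (by positivity : 0 ≤ δ / 4)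
        linarith

lemma gridSum_singleton (P : ℝ → ℝ) (j : Fin d) (N : ℕ) (p : Fin d → ℕ → ℝ) (b : Fin d → ℝ) :
    gridSum (fun x : Fin d → ℝ => (P (x j) : ℂ)) {j} N p b =
      ∑ k ∈ Finset.range N, |P (p j (k + 1)) - P (p j k)| := by
  rw [← insert_empty_eq j, gridSum_insert _ (Finset.notMem_empty j)]
  refine Finset.sum_congr rfl fun k _ => ?_
  rw [gridSum_empty]
  simp only [Function.update_self]
  rw [← Complex.ofReal_sub, Complex.norm_real, Real.norm_eq_abs]

lemma gridSum_comp_eval_eq_zero (P : ℝ → ℝ) {j : Fin d} {u : Finset (Fin d)} (hu : u.Nonempty)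
    (huj : u ≠ {j}) (N : ℕ) (p : Fin d → ℕ → ℝ) (b : Fin d → ℝ) :
    gridSum (fun x : Fin d → ℝ => (P (x j) : ℂ)) u N p b = 0 := by
  obtain ⟨i, hi, hij⟩ : ∃ i ∈ u, i ≠ j := by
    by_contra h
    push Not at h
    exact huj (Finset.eq_singleton_iff_nonempty_unique_mem.2 ⟨hu, h⟩)
  refine Finset.sum_eq_zero fun k _ => ?_
  rw [mixedDiff_eq_zero hi fun x t => by simp [Function.update_of_ne hij.symm], norm_zero]

variable {a b : Fin d → ℝ}

lemma isPeriodGrid_of_mem_Icc (hab : ∀ i, 0 ≤ a i ∧ a i < b i ∧ b i ≤ 2 * Real.pi)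
    {p : Fin d → ℕ → ℝ} (hp : ∀ i, Monotone (p i) ∧ ∀ k, p i k ∈ Set.Icc (a i) (b i))
    (u : Finset (Fin d)) : IsPeriodGrid u p := fun i _ =>
  ⟨(hp i).1, fun k => by
    have h1 := ((hp i).2 k).2
    have h2 := ((hp i).2 0).1
    have h3 := hab i
    linarith⟩

/-- In the faces other than the edge in the direction `j`, the variation of the jump detector
vanishes in the limit. -/
lemma tendsto_vitaliVariation_jumpDetector_of_ne
    (hF : HasLipschitzIncrements (regularPart f J) C)
    (hJ : ∀ k, Summable fun α : jumpSet J k => |J k α|)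
    (hab : ∀ i, 0 ≤ a i ∧ a i < b i ∧ b i ≤ 2 * Real.pi) {j : Fin d} {u : Finset (Fin d)}
    (hu : u.Nonempty) (huj : u ≠ {j}) :
    Tendsto (fun n => vitaliVariation (jumpDetector f j n) u a b) atTop (𝓝 0) := by
  rw [ENNReal.tendsto_nhds_zero]
  intro ε hε
  obtain ⟨δ, hδ0, hδε⟩ := ENNReal.lt_iff_exists_nnreal_btwn.1 hε
  have hδ0' : (0 : ℝ) < δ := by exact_mod_cast hδ0
  filter_upwards [eventually_gridSum_regularDetector_le hF j hδ0'] with n hn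
  refine le_trans (vitaliVariation_le_ofReal (C := δ) fun N p hp => ?_)
    ((ENNReal.ofReal_coe_nnreal).le.trans hδε.le)
  have h1 : jumpDetector f j n = fun x => regularDetector f J j n x +
      (jumpTrace (shellWeight f) (J j) (jumpSet J j) n (x j) : ℂ) :=
    funext fun x => jumpDetector_eq hF hJ j n x
  rw [h1]
  refine (gridSum_add_le _ _ u N p b).trans ?_
  rw [gridSum_comp_eval_eq_zero _ hu huj, add_zero]
  exact hn u N p b hu (isPeriodGrid_of_mem_Icc hab hp u)

/-- Along the edge in the direction `j`, the variation of the jump detector tends to the total size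
of the jumps, up to the factor `1 / π`. -/
lemma tendsto_vitaliVariation_jumpDetector
    (hF : HasLipschitzIncrements (regularPart f J) C)
    (hJ : ∀ k, Summable fun α : jumpSet J k => |J k α|)
    (hab : ∀ i, 0 ≤ a i ∧ a i < b i ∧ b i ≤ 2 * Real.pi) {j : Fin d}
    (haj : a j ∉ jumpSet J j) (hbj : b j ∉ jumpSet J j)
    (hsum : Summable fun α : ↥(jumpSet J j ∩ Set.Ioo (a j) (b j)) => |J j α|) :
    Tendsto (fun n => vitaliVariation (jumpDetector f j n) {j} a b) atTop
      (𝓝 (ENNReal.ofReal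
        (Real.pi⁻¹ * ∑' α : ↥(jumpSet J j ∩ Set.Ioo (a j) (b j)), |J j α|))) := by
  have hw := isLogWeight_shellWeight hF hJ j
  set P : ℕ → ℝ → ℝ := jumpTrace (shellWeight f) (J j) (jumpSet J j) with hP
  set T : ℝ := Real.pi⁻¹ * ∑' α : ↥(jumpSet J j ∩ Set.Ioo (a j) (b j)), |J j α| with hT
  have hT0 : 0 ≤ T := mul_nonneg (inv_pos.2 Real.pi_pos).le (tsum_nonneg fun _ => abs_nonneg _)
  have hdec : ∀ n, jumpDetector f j n = fun x => regularDetector f J j n x + (P n (x j) : ℂ) :=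
    fun n => funext fun x => jumpDetector_eq hF hJ j n x
  have hLsub := jumpSet_subset J j
  have hLc := countable_jumpSet (hJ j)
  refine tendsto_order.2 ⟨fun c hc => ?_, fun c hc => ?_⟩
  · have hctop : c ≠ ⊤ := (hc.trans_le le_top).ne
    have hcT : c.toReal < T := by
      rwa [← ENNReal.ofReal_toReal hctop, ENNReal.ofReal_lt_ofReal_iff_of_nonneg
        ENNReal.toReal_nonneg] at hc
    set δ : ℝ := (T - c.toReal) / 2 with hδ
    have hδ0 : 0 < δ := by
      rw [hδ]
      linarith
    have hc1 : ENNReal.ofReal (c.toReal + δ) < ENNReal.ofReal T := by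
      rw [ENNReal.ofReal_lt_ofReal_iff_of_nonneg (by positivity), hδ]
      linarith
    filter_upwards [hw.eventually_lt_eVariationOn hLsub hLc (hJ j) (hab j).1 (hab j).2.2 hsum hc1,
      eventually_gridSum_regularDetector_le hF j hδ0] with n hn1 hn2
    have hle : eVariationOn (P n) (Set.Icc (a j) (b j)) ≤
        vitaliVariation (jumpDetector f j n) {j} a b + ENNReal.ofReal δ := by
      refine iSup_le ?_
      rintro ⟨N, q, hq, hqI⟩
      set p : Fin d → ℕ → ℝ := fun i k => if i = j then q k else b i with hp
      have hpI : ∀ i, Monotone (p i) ∧ ∀ k, p i k ∈ Set.Icc (a i) (b i) := by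
        intro i
        by_cases hi : i = j
        · subst hi
          refine ⟨fun k l hkl => ?_, fun k => ?_⟩
          · simpa [hp] using hq hkl
          · simpa [hp] using hqI k
        · refine ⟨fun k l _ => ?_, fun k => ?_⟩
          · simp [hp, hi]
          · simpa [hp, hi] using (hab i).2.1.le
      have h1 : ∑ i ∈ Finset.range N, edist (P n (q (i + 1))) (P n (q i)) =
          ENNReal.ofReal (gridSum (fun x : Fin d → ℝ => (P n (x j) : ℂ)) {j} N p b) := by
        rw [gridSum_singleton, ENNReal.ofReal_sum_of_nonneg fun _ _ => abs_nonneg _]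
        refine Finset.sum_congr rfl fun k _ => ?_
        simp [hp, edist_dist, Real.dist_eq]
      have h2 : (fun x : Fin d → ℝ => (P n (x j) : ℂ)) =
          fun x => jumpDetector f j n x - regularDetector f J j n x := by
        ext x
        rw [hdec]
        simp
      simp only
      rw [h1, h2]
      refine (ENNReal.ofReal_le_ofReal (gridSum_sub_le _ _ {j} N p b)).trans ?_
      rw [ENNReal.ofReal_add (gridSum_nonneg _ _ _ _ _) (gridSum_nonneg _ _ _ _ _)]
      exact add_le_add (gridSum_le_vitaliVariation _ _ _ _ _ _ hpI)
        (ENNReal.ofReal_le_ofReal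
          (hn2 {j} N p b (Finset.singleton_nonempty j) (isPeriodGrid_of_mem_Icc hab hpI _)))
    have h3 := hn1.trans_le hle
    rw [ENNReal.ofReal_add ENNReal.toReal_nonneg hδ0.le, ENNReal.ofReal_toReal hctop] at h3
    exact lt_of_add_lt_add_right h3
  · obtain ⟨r, hr1, hr2⟩ := ENNReal.lt_iff_exists_nnreal_btwn.1 hc
    have hTr : T < r := by
      rw [← ENNReal.ofReal_coe_nnreal, ENNReal.ofReal_lt_ofReal_iff_of_nonneg hT0] at hr1
      exact hr1
    set δ : ℝ := (r - T) / 2 with hδ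
    have hδ0 : 0 < δ := by
      rw [hδ]
      linarith
    filter_upwards [hw.eventually_sum_abs_jumpTrace_le hLsub (hJ j) (hab j).1 (hab j).2.1.le
      (hab j).2.2 haj hbj (c := T + δ) (by linarith),
      eventually_gridSum_regularDetector_le hF j hδ0] with n hn1 hn2
    refine lt_of_le_of_lt (vitaliVariation_le_ofReal (C := r) fun N p hp => ?_)
      ((ENNReal.ofReal_coe_nnreal).le.trans_lt hr2)
    rw [hdec]
    refine (gridSum_add_le _ _ {j} N p b).trans ?_
    rw [gridSum_singleton]
    have h1 := hn1 N (p j) (hp j).1 (hp j).2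
    have h2 := hn2 {j} N p b (Finset.singleton_nonempty j) (isPeriodGrid_of_mem_Icc hab hp _)
    simp only [hδ] at h1 h2
    linarith

end Main

end

theorem lemma3p2 (d : ℕ) (hd : 2 ≤ d) :
    ∃ K : ℝ, 0 < K ∧
      ∀ (f : (Fin d → ℝ) → ℝ) (g : Fin d → (Fin d → ℝ) → ℝ) (J : Fin d → ℝ → ℝ),
        Measurable f →
        IsTorusFun f →
        IsBVInEachVariable f →
        -- every partial derivative is of bounded variation in all variables
        (∀ j, IsPartialDerivative f j (g j) ∧
          hardyKrauseVariation (g j) (fun _ => 0) (fun _ => 2 * Real.pi) ≠ ⊤) →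
        -- jumps occur only across hyperplanes `x_j = α`, with magnitude `J j α`, `α` in `(0, 2π)`
        (∀ j x, jumpAt f j x = J j (x j)) →
        (∀ j, J j 0 = 0) →
        ∀ (a b : Fin d → ℝ), (∀ i, 0 ≤ a i ∧ a i < b i ∧ b i ≤ 2 * Real.pi) →
        ∀ j : Fin d, a j ∉ jumpSet J j → b j ∉ jumpSet J j →
          (Summable fun α : ↥(jumpSet J j ∩ Set.Ioo (a j) (b j)) => |J j α|) ∧
          Tendsto (fun n : ℕ => hardyKrauseVariation (jumpDetector f j n) a b) atTop
            (𝓝 (ENNReal.ofReal (K * (1 / Real.pi) *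
              ∑' α : ↥(jumpSet J j ∩ Set.Ioo (a j) (b j)), |J j α|))) := by
  refine ⟨1, one_pos, fun f g J hfm hf hbv hg hJump hJ0 a b hab j haj hbj => ?_⟩
  have hJ := summable_jumpSet hf hbv hJump
  obtain ⟨C, hF⟩ := exists_hasLipschitzIncrements_regularPart hfm hf hbv hg hJump hJ0
  have hsum : Summable fun α : ↥(jumpSet J j ∩ Set.Ioo (a j) (b j)) => |J j α| :=
    (hJ j).comp_injective (Set.inclusion_injective Set.inter_subset_left)
  refine ⟨hsum, ?_⟩
  set T : ENNReal := ENNReal.ofReal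
    (Real.pi⁻¹ * ∑' α : ↥(jumpSet J j ∩ Set.Ioo (a j) (b j)), |J j α|) with hT
  have hlim : Tendsto (fun n => hardyKrauseVariation (jumpDetector f j n) a b) atTop
      (𝓝 (∑ u ∈ (Finset.univ : Finset (Finset (Fin d))).filter (fun u => u.Nonempty),
        if u = {j} then T else 0)) := by
    refine tendsto_finsetSum _ fun u hu => ?_
    split_ifs with h
    · rw [h]
      exact tendsto_vitaliVariation_jumpDetector hF hJ hab haj hbj hsum
    · exact tendsto_vitaliVariation_jumpDetector_of_ne hF hJ hab (Finset.mem_filter.1 hu).2 h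
  rw [Finset.sum_ite_eq', if_pos (by simp)] at hlim
  rwa [one_mul, one_div]
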